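/- **Theorem.** Let $n\ge 3$, let $S^n$ be the unit sphere of $\mathbb{R}^{n+1}$ with north pole $e_{n+1}=(0,\dots,0,1)$, let $\theta\in(0,\pi/2]$, and put $$B_\theta=\{x\in S^n: x\cdot e_{n+1}>\cos\theta\},\qquad \partial B_\theta=\{x\in S^n: x\cdot e_{n+1}=\cos\theta\}.$$ For $f\in C^\infty(S^n)$ real-valued, $\xi\in S^n$ and $t\in(-1,1)$, let $$(Mf)(\xi,t)=\frac{(1-t^2)^{(1-n)/2}}{\sigma_{n-1}}\int_{\{y\in S^n:\ \xi\cdot y=t\}}f(y)\,d\sigma(y),\qquad \sigma_{n-1}=\frac{2\pi^{n/2}}{\Gamma(n/2)},$$ where $d\sigma$ is the $(n-1)$-dimensional surface measure; this is the mean of $f$ over the geodesic sphere with center $\xi$ and radius $\arccos t$. Suppose that the (closed) support of $f$ is contained in $B_\theta$. With $d\xi$ the surface measure of $\partial B_\theta$, define for $x\in B_\theta$ $$f_0(x)=-\int_{\partial B_\theta}\Big(\frac{d}{dt}\Big)^{n-3}\big[(Mf)(\xi,t)(1-t^2)^{n/2-1}\big]\Big|_{t=\xi\cdot x}\,d\xi\qquad\text{if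 } n=3,5,\dots,$$ $$f_0(x)=\frac1\pi\int_{\partial B_\theta}d\xi\int_{\cos2\theta}^1\Big(\frac{d}{dt}\Big)^{n-2}\big[(Mf)(\xi,t)(1-t^2)^{n/2-1}\big]\log|t-\xi\cdot x|\,dt\qquad\text{if } n=4,6,\dots.$$ Then, for every $\xi\in\partial B_\theta$, the function $t\mapsto(Mf)(\xi,t)(1-t^2)^{n/2-1}$ is $C^\infty$ on $(-1,1)$; for every $x\in B_\theta$ the integrals defining $f_0(x)$ converge absolutely (for even $n$: the inner integral for every $\xi\in\partial B_\theta$, and the outer integral of its values); the function $x'\mapsto f_0(x',\sqrt{1-|x'|^2})$ is $C^\infty$ on $\{x'\in\mathbb{R}^n:|x'|<\sin\theta\}$; and for every $x=(x',x_{n+1})\in B_\theta$ $$f(x)=\frac{d_n\,x_{n+1}}{\sin\theta}\,\Delta_{x'}f_0\big(x',\sqrt{1-|x'|^2}\big),\qquad d_n=\frac{(-1)^{[n/2-1]}}{2^{n-1}\pi^{n/2-1}\Gamma(n/2)},$$ where $[\cdot]$ is the integer part and $\Delta_{x'}=\partial_1^2+\dots+\partial_n^2$. -/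

import Mathlib

namespace SphericalMeans

open MeasureTheory Metric

/-- The unit sphere `S^n` in `ℝ^{n+1}`. The coordinate `x_{n+1}` of the text is the coordinate with
index `Fin.last n`. -/
abbrev Sph (n : ℕ) : Type := sphere (0 : EuclideanSpace ℝ (Fin (n + 1))) 1

/-- The north pole `e_{n+1} = (0, …, 0, 1)`. -/
noncomputable def north (n : ℕ) : Sph n :=
  ⟨EuclideanSpace.single (Fin.last n) 1, by simp⟩

/-- The inner product `x · y` in `ℝ^{n+1}` of two points of `S^n`. -/
noncomputable def dot {n : ℕ} (x y : Sph n) : ℝ :=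
  inner ℝ (x : EuclideanSpace ℝ (Fin (n + 1))) (y : EuclideanSpace ℝ (Fin (n + 1)))

/-- The open spherical cap `B_θ = {x ∈ S^n : x · e_{n+1} > cos θ}`. -/
def cap (n : ℕ) (θ : ℝ) : Set (Sph n) := {x | Real.cos θ < dot x (north n)}

/-- The boundary `∂B_θ = {x ∈ S^n : x · e_{n+1} = cos θ}` of the cap. -/
def capBoundary (n : ℕ) (θ : ℝ) : Set (Sph n) := {x | dot x (north n) = Real.cos θ}

/-- `σ_{n-1} = 2 π^{n/2} / Γ(n/2)`, the area of the unit sphere `S^{n-1}` in `ℝ^n`. -/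
noncomputable def sphereArea (n : ℕ) : ℝ :=
  2 * Real.pi ^ ((n : ℝ) / 2) / Real.Gamma ((n : ℝ) / 2)

/-- The orthogonal complement `x^⊥` of `x` in `ℝ^{n+1}`. -/
noncomputable abbrev perp {n : ℕ} (x : Sph n) : Submodule ℝ (EuclideanSpace ℝ (Fin (n + 1))) :=
  (Submodule.span ℝ {(x : EuclideanSpace ℝ (Fin (n + 1)))})ᗮ

/-- The point `t x + √(1 - t²) u` of the section `{y ∈ S^n : x · y = t}`, where `u` is a unit vector
orthogonal to `x` and `|t| ≤ 1`. -/
noncomputable def sectionPoint {n : ℕ} (x : Sph n) (t : ℝ) (u : sphere (0 : perp x) 1) :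
    EuclideanSpace ℝ (Fin (n + 1)) :=
  t • (x : EuclideanSpace ℝ (Fin (n + 1))) +
    Real.sqrt (1 - t ^ 2) • ((u : perp x) : EuclideanSpace ℝ (Fin (n + 1)))

/-- The `(n-1)`-dimensional surface measure of the planar section `{y ∈ S^n : x · y = t}`, as a
measure on `S^n`. The section is the round sphere with centre `t x` and radius `√(1 - t²)` in the
hyperplane through `t x` orthogonal to `x`, so its surface measure is `(√(1 - t²))^{n-1}` times the
image of the surface measure of the unit sphere of `x^⊥` under `u ↦ t x + √(1 - t²) u`.
(For `n ≥ 2` and `|t| ≥ 1` this is the zero measure.) -/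
noncomputable def sectionMeasure {n : ℕ} (x : Sph n) (t : ℝ) : Measure (Sph n) :=
  (ENNReal.ofReal (Real.sqrt (1 - t ^ 2) ^ (n - 1)) •
    (volume : Measure (perp x)).toSphere.map (sectionPoint x t)).comap Subtype.val

/-- The surface measure of `∂B_θ`, which is the planar section `{ξ ∈ S^n : e_{n+1} · ξ = cos θ}`. -/
noncomputable def capBoundaryMeasure (n : ℕ) (θ : ℝ) : Measure (Sph n) :=
  sectionMeasure (north n) (Real.cos θ)

/-- The spherical mean
`(Mf)(x, t) = (1 - t²)^{(1-n)/2} / σ_{n-1} · ∫_{x · y = t} f(y) dσ(y)`, for `t ∈ (-1, 1)`. -/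
noncomputable def sphericalMean {n : ℕ} (f : Sph n → ℝ) (x : Sph n) (t : ℝ) : ℝ :=
  (1 - t ^ 2) ^ ((1 - (n : ℝ)) / 2) / sphereArea n * ∫ y, f y ∂(sectionMeasure x t)

/-- The function `t ↦ F(ξ, t) (1 - t²)^{n/2-1}`, for data `F` on `∂B_θ × (-1, 1)`. -/
noncomputable def weighted {n : ℕ} (F : Sph n → ℝ → ℝ) (ξ : Sph n) (t : ℝ) : ℝ :=
  F ξ t * (1 - t ^ 2) ^ ((n : ℝ) / 2 - 1)

/-- The integrand of the backprojection for odd `n`: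
`(d/dt)^{n-3} [F(ξ, t) (1 - t²)^{n/2-1}]` at `t = ξ · x`. -/
noncomputable def oddIntegrand {n : ℕ} (F : Sph n → ℝ → ℝ)
    (x : EuclideanSpace ℝ (Fin (n + 1))) (ξ : Sph n) : ℝ :=
  iteratedDeriv (n - 3) (weighted F ξ) (inner ℝ (ξ : EuclideanSpace ℝ (Fin (n + 1))) x)

/-- The integrand of the inner integral of the backprojection for even `n`:
`(d/dt)^{n-2} [F(ξ, t) (1 - t²)^{n/2-1}] log |t - ξ · x|`. -/
noncomputable def logIntegrand {n : ℕ} (F : Sph n → ℝ → ℝ)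
    (x : EuclideanSpace ℝ (Fin (n + 1))) (ξ : Sph n) (t : ℝ) : ℝ :=
  iteratedDeriv (n - 2) (weighted F ξ) t *
    Real.log |t - inner ℝ (ξ : EuclideanSpace ℝ (Fin (n + 1))) x|

/-- The integrand of the outer integral of the backprojection for even `n`. -/
noncomputable def evenIntegrand {n : ℕ} (θ : ℝ) (F : Sph n → ℝ → ℝ)
    (x : EuclideanSpace ℝ (Fin (n + 1))) (ξ : Sph n) : ℝ :=
  ∫ t in Real.cos (2 * θ)..1, logIntegrand F x ξ t

/-- The backprojection `f₀` of the data `F`. -/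
noncomputable def backprojection {n : ℕ} (θ : ℝ) (F : Sph n → ℝ → ℝ)
    (x : EuclideanSpace ℝ (Fin (n + 1))) : ℝ :=
  if Odd n then -∫ ξ, oddIntegrand F x ξ ∂(capBoundaryMeasure n θ)
  else 1 / Real.pi * ∫ ξ, evenIntegrand θ F x ξ ∂(capBoundaryMeasure n θ)

/-- The orthogonal projection `x ↦ x' = (x_1, …, x_n)` onto the hyperplane `x_{n+1} = 0`, which is
identified with `ℝ^n`. -/
noncomputable def proj {n : ℕ} (x : Sph n) : EuclideanSpace ℝ (Fin n) :=
  WithLp.toLp 2 fun i => (x : EuclideanSpace ℝ (Fin (n + 1))) i.castSucc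

/-- The point `(x', √(1 - |x'|²))` of `ℝ^{n+1}` above `x' ∈ ℝ^n`; it lies on the upper hemisphere
when `|x'| ≤ 1`. -/
noncomputable def lift {n : ℕ} (z : EuclideanSpace ℝ (Fin n)) : EuclideanSpace ℝ (Fin (n + 1)) :=
  WithLp.toLp 2 (Fin.snoc (α := fun _ => ℝ) z (Real.sqrt (1 - ‖z‖ ^ 2)))

/-- `d_n = (-1)^{[n/2-1]} / (2^{n-1} π^{n/2-1} Γ(n/2))`, where `[·]` is the integer part. -/
noncomputable def inversionConst (n : ℕ) : ℝ :=
  (-1) ^ ⌊(n : ℝ) / 2 - 1⌋ /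
    (2 ^ (n - 1) * Real.pi ^ ((n : ℝ) / 2 - 1) * Real.Gamma ((n : ℝ) / 2))

end SphericalMeans

open SphericalMeans MeasureTheory
open scoped Manifold ContDiff

open SphericalMeans MeasureTheory
open scoped Manifold ContDiff

/-! Up to a constant, `f₀` is the Newton potential of a density built from `f`, and Poisson's
equation returns `f`. Write `m = n - 2`, `x'` for the projection of `x`, and `w(ξ, t)` for the
weighted mean.

Slicing the sphere shows that `σ_{n-1} w(ξ, ·)` is the density of the image of `f dσ` under `y ↦ ξ ·
y` (`integral_weighted_sphericalMean_mul`). As `supp f` lies over an open ball in the equatorial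
hyperplane, the same integrals can be taken against `g(z) = f(z, √(1 - |z|²)) / √(1 - |z|²)`
(`integral_weighted_mul_eq_graph`).

The odd and even formulas are limits of one regularization. Integrating by parts `m` times moves the
derivatives of `w` from `log(ε + i(t - τ))` to `(ε + i(t - τ))^{-m}`. Since `log(ε + is)` tends to
`log|s| + i(π/2) sgn s`, the imaginary part yields a point value of `w^{(m-1)}` (odd `m`), and the
real part yields the logarithmic integral (even `m`). So `f₀(x)` is the limit of the integrals over
`∂B_θ` of `w(ξ, ·)` against `backKernel m ε (· - ξ · x)`.

Fubini puts the `ξ` integration first. With `ξ = cos θ e + sin θ u`, the argument of the kernel is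
affine in `u`, and the Funk–Hecke formula (`integral_toSphere_re_inv_pow`) reduces the integral to
`|z - x'|^{-m} Re J_m(ζ)`, where `J_k(ζ) = ∫ (1 - s²)^{(m-1)/2} (ζ - is)^{-k} ds` and `ζ` has real
part of order `ε`. The decisive fact is `tendsto_gegenbauerCauchy_re`: `Re J_m(η + is) → π` as `η →
0+`, whatever `s` in `(-1, 1)`. The condition `|s| < 1` holds because chords of the sphere over a
ball of radius less than `sin θ` have slope less than `tan θ` (`exists_abs_cos_mul_sub_le`). Thus
the kernel tends to a multiple of `|z - x'|^{2-n}`, independent of the heights of the points.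
`laplacian_newtonPotential` and the duplication formula for `Γ` then give the inversion formula with
its constant. -/

/-! ### Polar coordinates, slices and graphs for the surface measure of a sphere -/

open Set Metric Measure in
theorem lintegral_polar {E : Type*} [NormedAddCommGroup E] [NormedSpace ℝ E] [MeasurableSpace E]
    [BorelSpace E] [FiniteDimensional ℝ E] [Nontrivial E] (μ : Measure E) [μ.IsAddHaarMeasure]
    {F : E → ENNReal} (hF : Measurable F) :
    ∫⁻ x, F x ∂μ = ∫⁻ u : sphere (0 : E) 1, (∫⁻ r in Ioi (0 : ℝ),
      ENNReal.ofReal (r ^ (Module.finrank ℝ E - 1)) * F (r • (u : E))) ∂μ.toSphere := by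
  calc
    ∫⁻ x, F x ∂μ = ∫⁻ x : ({(0)}ᶜ : Set E), F x.1 ∂(μ.comap (↑)) := by
      rw [lintegral_subtype_comap (measurableSet_singleton _).compl F, restrict_compl_singleton]
    _ = ∫⁻ x, F ((x.2 : ℝ) • (x.1 : E)) ∂μ.toSphere.prod (.volumeIoiPow (Module.finrank ℝ E - 1)) := by
      rw [← μ.measurePreserving_homeomorphUnitSphereProd.lintegral_comp_emb
        (Homeomorph.measurableEmbedding _)]
      refine lintegral_congr fun x => ?_
      congr 1
      simp [smul_inv_smul₀ (norm_ne_zero_iff.2 x.2)]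
    _ = ∫⁻ u : sphere (0 : E) 1, ∫⁻ r : Ioi (0 : ℝ), F ((r : ℝ) • (u : E))
          ∂(.volumeIoiPow (Module.finrank ℝ E - 1)) ∂μ.toSphere := by
      rw [lintegral_prod _ (by fun_prop)]
    _ = _ := by
      refine lintegral_congr fun u => ?_
      rw [volumeIoiPow, lintegral_withDensity_eq_lintegral_mul _ (by fun_prop) (by fun_prop),
        ← lintegral_subtype_comap measurableSet_Ioi
          (fun r : ℝ => ENNReal.ofReal (r ^ (Module.finrank ℝ E - 1)) * F (r • (u : E)))]
      rfl

open Set Metric Measure in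
theorem integral_polar {E : Type*} [NormedAddCommGroup E] [NormedSpace ℝ E] [MeasurableSpace E]
    [BorelSpace E] [FiniteDimensional ℝ E] [Nontrivial E] (μ : Measure E) [μ.IsAddHaarMeasure]
    {F : E → ℝ} (hF : Integrable F μ) :
    ∫ x, F x ∂μ = ∫ u : sphere (0 : E) 1, (∫ r in Ioi (0 : ℝ),
      r ^ (Module.finrank ℝ E - 1) * F (r • (u : E))) ∂μ.toSphere := by
  have key : ∀ x : ({(0)}ᶜ : Set E), F x.1 =
      (fun x : sphere (0 : E) 1 × Ioi (0 : ℝ) => F ((x.2 : ℝ) • (x.1 : E)))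
        (homeomorphUnitSphereProd E x) := fun x => by
    simp [smul_inv_smul₀ (norm_ne_zero_iff.2 x.2)]
  have hint : Integrable (fun x : sphere (0 : E) 1 × Ioi (0 : ℝ) => F ((x.2 : ℝ) • (x.1 : E)))
      (μ.toSphere.prod (.volumeIoiPow (Module.finrank ℝ E - 1))) := by
    rw [← μ.measurePreserving_homeomorphUnitSphereProd.integrable_comp_emb
        (Homeomorph.measurableEmbedding _)]
    have h1 : Integrable (fun x : ({(0)}ᶜ : Set E) => F x.1) (μ.comap (↑)) := by
      have := integrableOn_iff_comap_subtypeVal (f := F) (μ := μ)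
        (measurableSet_singleton (0 : E)).compl
      exact this.1 hF.integrableOn
    refine h1.congr (Filter.Eventually.of_forall fun x => key x)
  calc
    ∫ x, F x ∂μ = ∫ x : ({(0)}ᶜ : Set E), F x.1 ∂(μ.comap (↑)) := by
      rw [integral_subtype_comap (measurableSet_singleton _).compl F, restrict_compl_singleton]
    _ = ∫ x, F ((x.2 : ℝ) • (x.1 : E)) ∂μ.toSphere.prod (.volumeIoiPow (Module.finrank ℝ E - 1)) := by
      rw [← μ.measurePreserving_homeomorphUnitSphereProd.integral_comp
        (Homeomorph.measurableEmbedding _)]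
      exact integral_congr_ae (Filter.Eventually.of_forall key)
    _ = ∫ u : sphere (0 : E) 1, ∫ r : Ioi (0 : ℝ), F ((r : ℝ) • (u : E))
          ∂(.volumeIoiPow (Module.finrank ℝ E - 1)) ∂μ.toSphere := integral_prod _ hint
    _ = _ := by
      refine integral_congr_ae (Filter.Eventually.of_forall fun u => ?_)
      dsimp only
      rw [volumeIoiPow, integral_withDensity_eq_integral_toReal_smul (by fun_prop) (by simp),
        ← integral_subtype_comap measurableSet_Ioi
          (fun r : ℝ => r ^ (Module.finrank ℝ E - 1) * F (r • (u : E)))]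
      refine integral_congr_ae (Filter.Eventually.of_forall fun r => ?_)
      simp [ENNReal.toReal_ofReal (pow_nonneg r.2.out.le _)]

theorem finrank_span_orthogonal {V : Type*} [NormedAddCommGroup V] [InnerProductSpace ℝ V]
    [FiniteDimensional ℝ V] {e : V} (he : ‖e‖ = 1) :
    Module.finrank ℝ (Submodule.span ℝ {e})ᗮ + 1 = Module.finrank ℝ V := by
  have h1 := Submodule.finrank_add_finrank_orthogonal (Submodule.span ℝ {e})
  have h2 := finrank_span_singleton (K := ℝ) (v := e) (by rintro rfl; simp at he)
  omega

/-- The isometry `ℝ × e^⊥ ≃ V`, `(s, p) ↦ s e + p`, for a unit vector `e`. -/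
noncomputable def spanOrthogonalIsometry {V : Type*} [NormedAddCommGroup V]
    [InnerProductSpace ℝ V] [FiniteDimensional ℝ V] {e : V} (he : ‖e‖ = 1) :
    WithLp 2 (ℝ × (Submodule.span ℝ {e})ᗮ) ≃ₗᵢ[ℝ] V :=
  LinearIsometry.toLinearIsometryEquiv
    { toLinearMap := ((LinearMap.toSpanSingleton ℝ V e).coprod (Submodule.subtype _)).comp
        (WithLp.linearEquiv 2 ℝ (ℝ × (Submodule.span ℝ {e})ᗮ)).toLinearMap
      norm_map' := fun x => by
        have h0 : inner ℝ (x.fst • e) (x.snd : V) = 0 := by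
          rw [inner_smul_left, Submodule.mem_orthogonal_singleton_iff_inner_right.1 x.snd.2, mul_zero]
        have h1 := norm_add_sq_eq_norm_sq_add_norm_sq_of_inner_eq_zero _ _ h0
        have h2 : ‖x.fst • e + (x.snd : V)‖ = ‖x‖ := by
          rw [WithLp.prod_norm_eq_of_L2, ← Real.sqrt_sq (norm_nonneg (_ + _)), pow_two, h1]
          simp [norm_smul, he, pow_two]
        exact h2 }
    (by
      rw [LinearEquiv.finrank_eq (WithLp.linearEquiv 2 ℝ (ℝ × (Submodule.span ℝ {e})ᗮ)),
        Module.finrank_prod, Module.finrank_self, add_comm, finrank_span_orthogonal he])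

theorem lintegral_span_orthogonal {V : Type*} [NormedAddCommGroup V] [InnerProductSpace ℝ V]
    [MeasurableSpace V] [BorelSpace V] [FiniteDimensional ℝ V] {e : V} (he : ‖e‖ = 1)
    {F : V → ENNReal} (hF : Measurable F) :
    ∫⁻ v, F v = ∫⁻ p : (Submodule.span ℝ {e})ᗮ, ∫⁻ s : ℝ, F (s • e + p) := by
  have h1 : MeasurePreserving (fun q : ℝ × (Submodule.span ℝ {e})ᗮ => q.1 • e + (q.2 : V)) :=
    (spanOrthogonalIsometry he).measurePreserving.comp
      (WithLp.volume_preserving_toLp ℝ (Submodule.span ℝ {e})ᗮ)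
  rw [← h1.lintegral_comp hF, Measure.volume_eq_prod, lintegral_prod_symm _ (by fun_prop)]

-- The function `1_{‖v‖ < 1} G(v / ‖v‖)` is integrated over `V` in two ways: in polar coordinates of
-- `V`, and by splitting `V = ℝ e ⊕ e^⊥` with polar coordinates in `e^⊥` and then in the half plane
-- spanned by `e` and `u`. Both produce the radial factor `C = ∫₀¹ r^{d+1} dr`, which cancels.
open Set Metric Measure in
theorem lintegral_toSphere_angle {V : Type*} [NormedAddCommGroup V] [InnerProductSpace ℝ V]
    [MeasurableSpace V] [BorelSpace V] [FiniteDimensional ℝ V] {e : V} (he : ‖e‖ = 1)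
    {d : ℕ} (hd : Module.finrank ℝ V = d + 2) {G : V → ENNReal} (hG : Measurable G) :
    ∫⁻ v : sphere (0 : V) 1, G v ∂(volume : Measure V).toSphere =
      ∫⁻ u : sphere (0 : (Submodule.span ℝ {e})ᗮ) 1, (∫⁻ φ in Ioo 0 Real.pi,
        ENNReal.ofReal (Real.sin φ ^ d) * G (Real.cos φ • e + Real.sin φ • ((u : (Submodule.span ℝ {e})ᗮ) : V)))
        ∂(volume : Measure (Submodule.span ℝ {e})ᗮ).toSphere := by
  have hdW : Module.finrank ℝ (Submodule.span ℝ {e})ᗮ = d + 1 := by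
    have := finrank_span_orthogonal he; omega
  have : Nontrivial (Submodule.span ℝ {e})ᗮ := Module.nontrivial_of_finrank_pos (R := ℝ) (by omega)
  have : Nontrivial V := Module.nontrivial_of_finrank_pos (R := ℝ) (by omega)
  set W := (Submodule.span ℝ {e})ᗮ
  set F : V → ENNReal := fun v => (Iio (1 : ℝ)).indicator 1 ‖v‖ * G (‖v‖⁻¹ • v) with hFdef
  have hind : Measurable ((Iio (1 : ℝ)).indicator (1 : ℝ → ENNReal)) :=
    measurable_one.indicator measurableSet_Iio
  have hF : Measurable F := by
    refine Measurable.mul (hind.comp measurable_norm) (hG.comp ?_)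
    exact (measurable_norm.inv).smul measurable_id
  set C : ENNReal := ∫⁻ r in Ioi (0 : ℝ), ENNReal.ofReal (r ^ (d + 1)) * (Iio (1 : ℝ)).indicator 1 r
    with hC
  have hC' : C = ENNReal.ofReal (1 / (d + 2)) := by
    calc C = ∫⁻ r in Ioi (0 : ℝ), (Iio (1 : ℝ)).indicator (fun r => ENNReal.ofReal (r ^ (d + 1))) r := by
          refine lintegral_congr fun r => ?_
          by_cases hr : r ∈ Iio (1 : ℝ)
          · simp [indicator_of_mem hr]
          · simp [indicator_of_notMem hr]
      _ = ENNReal.ofReal (∫ r in Ioo (0 : ℝ) 1, r ^ (d + 1)) := by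
          rw [setLIntegral_indicator measurableSet_Iio, inter_comm, Ioi_inter_Iio,
            ofReal_integral_eq_lintegral_ofReal]
          · exact ((continuous_pow (d + 1)).integrableOn_Icc (a := (0 : ℝ)) (b := 1)).mono_set
              Ioo_subset_Icc_self
          · filter_upwards [ae_restrict_mem measurableSet_Ioo] with y hy
            exact pow_nonneg hy.1.le _
      _ = ENNReal.ofReal (1 / (d + 2)) := by
          rw [← integral_Ioc_eq_integral_Ioo, ← intervalIntegral.integral_of_le zero_le_one,
            integral_pow]
          norm_num [add_assoc]
  have hC0 : C ≠ 0 := by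
    rw [hC', ne_eq, ENNReal.ofReal_eq_zero, not_le]
    positivity
  have hCt : C ≠ ⊤ := by
    rw [hC']; exact ENNReal.ofReal_ne_top
  have hFr : ∀ r : ℝ, 0 < r → ∀ v : V, ‖v‖ = 1 → F (r • v) = (Iio (1 : ℝ)).indicator 1 r * G v := by
    intro r hr v hv
    simp only [hFdef, norm_smul, hv, mul_one, Real.norm_of_nonneg hr.le, smul_smul,
      inv_mul_cancel₀ hr.ne', one_smul]
  have hL : ∫⁻ v, F v = C * ∫⁻ v : sphere (0 : V) 1, G v ∂(volume : Measure V).toSphere := by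
    rw [lintegral_polar volume hF, ← lintegral_const_mul' _ _ hCt]
    refine lintegral_congr fun u => ?_
    rw [hC, ← lintegral_mul_const _ (by fun_prop)]
    refine setLIntegral_congr_fun measurableSet_Ioi fun r hr => ?_
    rw [hFr r hr u (by simp), hd, mul_assoc]
    rfl
  have hR : ∫⁻ v, F v = C * ∫⁻ u : sphere (0 : W) 1, (∫⁻ φ in Ioo 0 Real.pi,
        ENNReal.ofReal (Real.sin φ ^ d) * G (Real.cos φ • e + Real.sin φ • ((u : W) : V)))
        ∂(volume : Measure W).toSphere := by
    rw [lintegral_span_orthogonal he hF, lintegral_polar volume (Measurable.lintegral_prod_right (by fun_prop)),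
      ← lintegral_const_mul' _ _ hCt]
    refine lintegral_congr fun u => ?_
    have hu : ∀ φ, ‖Real.cos φ • e + Real.sin φ • ((u : W) : V)‖ = 1 := by
      intro φ
      have h0 : inner ℝ (Real.cos φ • e) (Real.sin φ • ((u : W) : V)) = 0 := by
        rw [inner_smul_left, inner_smul_right,
          Submodule.mem_orthogonal_singleton_iff_inner_right.1 (u : W).2, mul_zero, mul_zero]
      have h1 := norm_add_sq_eq_norm_sq_add_norm_sq_of_inner_eq_zero _ _ h0
      have h2 : ‖((u : W) : V)‖ = 1 := norm_eq_of_mem_sphere u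
      rw [norm_smul, norm_smul, he, h2, mul_one, mul_one, Real.norm_eq_abs, Real.norm_eq_abs,
        abs_mul_abs_self, abs_mul_abs_self] at h1
      nlinarith [Real.sin_sq_add_cos_sq φ, norm_nonneg (Real.cos φ • e + Real.sin φ • ((u : W) : V))]
    calc ∫⁻ r in Ioi (0 : ℝ), ENNReal.ofReal (r ^ (Module.finrank ℝ W - 1)) *
          ∫⁻ s : ℝ, F (s • e + ((r • (u : W) : W) : V))
        = ∫⁻ r : ℝ, ∫⁻ s : ℝ, (Ioi (0 : ℝ)).indicator 1 r * ENNReal.ofReal (r ^ d) *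
            F (s • e + r • ((u : W) : V)) := by
          rw [← lintegral_indicator measurableSet_Ioi]
          refine lintegral_congr fun r => ?_
          by_cases hr : r ∈ Ioi (0 : ℝ)
          · rw [indicator_of_mem hr, lintegral_const_mul _ (by fun_prop)]
            simp [indicator_of_mem hr, hdW]
          · simp [indicator_of_notMem hr]
      _ = ∫⁻ p : ℝ × ℝ, (Ioi (0 : ℝ)).indicator 1 p.2 * ENNReal.ofReal (p.2 ^ d) *
            F (p.1 • e + p.2 • ((u : W) : V)) := by
          rw [Measure.volume_eq_prod, lintegral_prod_symm]
          refine Measurable.aemeasurable ?_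
          have : Measurable ((Ioi (0 : ℝ)).indicator (1 : ℝ → ENNReal)) :=
            measurable_one.indicator measurableSet_Ioi
          fun_prop
      -- Plane polar angles run over `(-π, π)`; the half plane where the radius in `e^⊥` is positive
      -- is `sin φ > 0`, that is, `φ ∈ (0, π)`. The Jacobian raises the power of `r` from `d` to `d
      -- + 1`.
      _ = ∫⁻ p in Ioi (0 : ℝ) ×ˢ Ioo (-Real.pi) Real.pi,
            (ENNReal.ofReal (p.1 ^ (d + 1)) * (Iio (1 : ℝ)).indicator 1 p.1) *
            ((Ioo (0:ℝ) Real.pi).indicator (fun φ => ENNReal.ofReal (Real.sin φ ^ d) *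
              G (Real.cos φ • e + Real.sin φ • ((u : W) : V))) p.2) := by
          rw [← lintegral_comp_polarCoord_symm, polarCoord_target]
          refine setLIntegral_congr_fun (measurableSet_Ioi.prod measurableSet_Ioo) fun p hp => ?_
          have hr : 0 < p.1 := hp.1
          simp only [polarCoord_symm_apply]
          by_cases hφ : p.2 ∈ Ioo (0 : ℝ) Real.pi
          · have hs := Real.sin_pos_of_mem_Ioo hφ
            rw [indicator_of_mem hφ, mul_smul, mul_smul, ← smul_add, hFr _ hr _ (hu _),
              indicator_of_mem (show p.1 * Real.sin p.2 ∈ Ioi (0 : ℝ) from mul_pos hr hs), mul_pow,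
              ENNReal.ofReal_mul (by positivity), pow_succ, ENNReal.ofReal_mul (by positivity)]
            simp only [Pi.one_apply, smul_eq_mul]
            ring
          · have hs : Real.sin p.2 ≤ 0 := by
              refine Real.sin_nonpos_of_nonpos_of_neg_pi_le ?_ hp.2.1.le
              by_contra hh
              exact hφ ⟨not_le.1 hh, hp.2.2⟩
            rw [indicator_of_notMem hφ, indicator_of_notMem]
            · simp
            · simpa using mul_nonpos_of_nonneg_of_nonpos hr.le hs
      _ = C * ∫⁻ φ in Ioo 0 Real.pi,
        ENNReal.ofReal (Real.sin φ ^ d) * G (Real.cos φ • e + Real.sin φ • ((u : W) : V)) := by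
          have hm : Measurable ((Ioo (0:ℝ) Real.pi).indicator fun φ => ENNReal.ofReal (Real.sin φ ^ d) *
              G (Real.cos φ • e + Real.sin φ • ((u : W) : V))) :=
            Measurable.indicator (by fun_prop) measurableSet_Ioo
          rw [Measure.volume_eq_prod, ← Measure.prod_restrict,
            lintegral_prod_mul (f := fun r : ℝ => ENNReal.ofReal (r ^ (d + 1)) * (Iio (1 : ℝ)).indicator 1 r)
              (by fun_prop) hm.aemeasurable, setLIntegral_indicator measurableSet_Ioo,
            inter_eq_left.2 (Ioo_subset_Ioo_left (by linarith [Real.pi_pos]))]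
  rw [← ENNReal.mul_right_inj hC0 hCt, ← hL, hR]

open Set in
theorem image_cos_Ioo : Real.cos '' Ioo 0 Real.pi = Ioo (-1) 1 := by
  ext t
  constructor
  · rintro ⟨φ, hφ, rfl⟩
    have h1 := Real.strictAntiOn_cos (left_mem_Icc.2 Real.pi_pos.le) (Ioo_subset_Icc_self hφ) hφ.1
    have h2 := Real.strictAntiOn_cos (Ioo_subset_Icc_self hφ) (right_mem_Icc.2 Real.pi_pos.le) hφ.2
    rw [Real.cos_zero] at h1
    rw [Real.cos_pi] at h2
    exact ⟨h2, h1⟩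
  · rintro ⟨h1, h2⟩
    exact ⟨Real.arccos t, ⟨Real.arccos_pos.2 h2, Real.arccos_lt_pi.2 h1⟩,
      Real.cos_arccos h1.le h2.le⟩

open Set in
theorem image_sin_Ioo : Real.sin '' Ioo 0 (Real.pi / 2) = Ioo 0 1 := by
  ext t
  constructor
  · rintro ⟨φ, hφ, rfl⟩
    refine ⟨Real.sin_pos_of_mem_Ioo ⟨hφ.1, by linarith [hφ.2, Real.pi_pos]⟩, ?_⟩
    have := Real.strictMonoOn_sin ⟨by linarith [hφ.1, Real.pi_pos], hφ.2.le⟩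
      (right_mem_Icc.2 (by linarith [Real.pi_pos])) hφ.2
    rwa [Real.sin_pi_div_two] at this
  · rintro ⟨h1, h2⟩
    exact ⟨Real.arcsin t, ⟨Real.arcsin_pos.2 h1, Real.arcsin_lt_pi_div_two.2 h2⟩,
      Real.sin_arcsin (by linarith) h2.le⟩

-- Substitution `t = cos φ` in the angular formula: `sin^d φ dφ` becomes `(1 - t²)^{(d-1)/2} dt`.
open Set Metric Measure in
theorem lintegral_toSphere_slice {V : Type*} [NormedAddCommGroup V] [InnerProductSpace ℝ V]
    [MeasurableSpace V] [BorelSpace V] [FiniteDimensional ℝ V] {e : V} (he : ‖e‖ = 1)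
    {d : ℕ} (hd : Module.finrank ℝ V = d + 2) {G : V → ENNReal} (hG : Measurable G) :
    ∫⁻ v : sphere (0 : V) 1, G v ∂(volume : Measure V).toSphere =
      ∫⁻ u : sphere (0 : (Submodule.span ℝ {e})ᗮ) 1, (∫⁻ t in Ioo (-1 : ℝ) 1,
        ENNReal.ofReal ((1 - t ^ 2) ^ (((d : ℝ) - 1) / 2)) *
          G (t • e + Real.sqrt (1 - t ^ 2) • ((u : (Submodule.span ℝ {e})ᗮ) : V)))
        ∂(volume : Measure (Submodule.span ℝ {e})ᗮ).toSphere := by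
  rw [lintegral_toSphere_angle he hd hG]
  refine lintegral_congr fun u => ?_
  rw [← image_cos_Ioo, lintegral_image_eq_lintegral_abs_deriv_mul measurableSet_Ioo
    (fun x _ => (Real.hasDerivAt_cos x).hasDerivWithinAt)
    (Real.injOn_cos.mono Ioo_subset_Icc_self)]
  refine setLIntegral_congr_fun measurableSet_Ioo fun φ hφ => ?_
  have hs := Real.sin_pos_of_mem_Ioo hφ
  have h1 : 1 - Real.cos φ ^ 2 = Real.sin φ ^ 2 := by linarith [Real.sin_sq_add_cos_sq φ]
  rw [h1, Real.sqrt_sq hs.le, ← mul_assoc, ← ENNReal.ofReal_mul (abs_nonneg _), abs_neg,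
    abs_of_pos hs]
  congr 2
  rw [← Real.rpow_natCast (Real.sin φ) 2, ← Real.rpow_mul hs.le, ← Real.rpow_natCast]
  nth_rw 2 [← Real.rpow_one (Real.sin φ)]
  rw [← Real.rpow_add hs]
  congr 1
  push_cast
  ring

-- Since `G` lives on the open hemisphere around `e`, only `φ < π/2` counts. There `r = sin φ` is
-- the radius in `e^⊥` and `dφ = dr / √(1 - r²)`, so the angular formula becomes polar coordinates
-- in the unit ball of `e^⊥`.
open Set Metric Measure in
theorem lintegral_toSphere_graph {V : Type*} [NormedAddCommGroup V] [InnerProductSpace ℝ V]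
    [MeasurableSpace V] [BorelSpace V] [FiniteDimensional ℝ V] {e : V} (he : ‖e‖ = 1)
    (hd : 2 ≤ Module.finrank ℝ V) {G : V → ENNReal} (hG : Measurable G)
    (hG0 : ∀ v, inner ℝ e v ≤ 0 → G v = 0) :
    ∫⁻ v : sphere (0 : V) 1, G v ∂(volume : Measure V).toSphere =
      ∫⁻ p in ball (0 : (Submodule.span ℝ {e})ᗮ) 1,
        ENNReal.ofReal (Real.sqrt (1 - ‖p‖ ^ 2))⁻¹ *
          G (Real.sqrt (1 - ‖p‖ ^ 2) • e + (p : V)) := by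
  obtain ⟨d, hd⟩ : ∃ d, Module.finrank ℝ V = d + 2 := ⟨_, (Nat.sub_add_cancel hd).symm⟩
  have hdW : Module.finrank ℝ (Submodule.span ℝ {e})ᗮ = d + 1 := by
    have := finrank_span_orthogonal he; omega
  have : Nontrivial (Submodule.span ℝ {e})ᗮ := Module.nontrivial_of_finrank_pos (R := ℝ) (by omega)
  rw [lintegral_toSphere_angle he hd hG, ← lintegral_indicator measurableSet_ball,
    lintegral_polar volume (Measurable.indicator (by fun_prop) measurableSet_ball)]
  set W := (Submodule.span ℝ {e})ᗮ
  refine lintegral_congr fun u => ?_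
  have hu : ‖(u : W)‖ = 1 := norm_eq_of_mem_sphere u
  calc ∫⁻ φ in Ioo 0 Real.pi, ENNReal.ofReal (Real.sin φ ^ d) *
          G (Real.cos φ • e + Real.sin φ • ((u : W) : V))
      = ∫⁻ φ in Ioo 0 (Real.pi / 2), ENNReal.ofReal (Real.sin φ ^ d) *
          G (Real.cos φ • e + Real.sin φ • ((u : W) : V)) := by
        rw [← lintegral_indicator measurableSet_Ioo, ← lintegral_indicator measurableSet_Ioo]
        refine lintegral_congr fun φ => ?_
        by_cases h1 : φ ∈ Ioo 0 (Real.pi / 2)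
        · have h2 : φ ∈ Ioo 0 Real.pi := ⟨h1.1, by linarith [h1.2, Real.pi_pos]⟩
          rw [indicator_of_mem h1, indicator_of_mem h2]
        rw [indicator_of_notMem h1]
        by_cases hφ : φ ∈ Ioo 0 Real.pi
        · rw [indicator_of_mem hφ, hG0, mul_zero]
          rw [inner_add_right, inner_smul_right, inner_smul_right,
            Submodule.mem_orthogonal_singleton_iff_inner_right.1 (u : W).2,
            real_inner_self_eq_norm_sq, he]
          have : Real.pi / 2 ≤ φ := by
            by_contra hh
            exact h1 ⟨hφ.1, not_le.1 hh⟩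
          have := Real.cos_nonpos_of_pi_div_two_le_of_le this (by linarith [hφ.2, Real.pi_pos])
          linarith
        · rw [indicator_of_notMem hφ]
    _ = ∫⁻ r in Ioo (0 : ℝ) 1, ENNReal.ofReal (r ^ d) * (ENNReal.ofReal (Real.sqrt (1 - r ^ 2))⁻¹ *
          G (Real.sqrt (1 - r ^ 2) • e + r • ((u : W) : V))) := by
        have hinj : InjOn Real.sin (Ioo 0 (Real.pi / 2)) :=
          Real.injOn_sin.mono (Ioo_subset_Icc_self.trans
            (Icc_subset_Icc_left (by linarith [Real.pi_pos])))
        rw [← image_sin_Ioo, lintegral_image_eq_lintegral_abs_deriv_mul measurableSet_Ioo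
          (fun x _ => (Real.hasDerivAt_sin x).hasDerivWithinAt) hinj]
        refine setLIntegral_congr_fun measurableSet_Ioo fun φ hφ => ?_
        have hφ' : φ ∈ Ioo (-(Real.pi / 2)) (Real.pi / 2) :=
          ⟨by linarith [hφ.1, Real.pi_pos], hφ.2⟩
        have hs := Real.cos_pos_of_mem_Ioo hφ'
        have h1 : 1 - Real.sin φ ^ 2 = Real.cos φ ^ 2 := by linarith [Real.sin_sq_add_cos_sq φ]
        rw [h1, Real.sqrt_sq hs.le, abs_of_pos hs, mul_left_comm, ← mul_assoc (ENNReal.ofReal _) _ (G _),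
          ← ENNReal.ofReal_mul hs.le, mul_inv_cancel₀ hs.ne', ENNReal.ofReal_one, one_mul]
    _ = _ := by
        refine Eq.symm (Eq.trans (setLIntegral_congr_fun measurableSet_Ioi (g := (Iio (1 : ℝ)).indicator
          fun r => ENNReal.ofReal (r ^ d) * (ENNReal.ofReal (Real.sqrt (1 - r ^ 2))⁻¹ *
          G (Real.sqrt (1 - r ^ 2) • e + r • ((u : W) : V)))) fun r hr => ?_) ?_)
        · have hn : ‖r • (u : W)‖ = r := by rw [norm_smul, hu, mul_one, Real.norm_of_nonneg (le_of_lt hr)]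
          by_cases h1 : r ∈ Iio (1 : ℝ)
          · rw [indicator_of_mem h1, indicator_of_mem (by simpa [hn] using h1), hn, hdW]
            rfl
          · rw [indicator_of_notMem h1, indicator_of_notMem (by simpa [hn] using h1), mul_zero]
        · rw [setLIntegral_indicator measurableSet_Iio, inter_comm, Ioi_inter_Iio]

-- The formula for nonnegative functions identifies the surface measure with the image of a product
-- measure; Fubini for integrable functions then allows `t` to be the outer variable.
open Set Metric Measure in
theorem integral_toSphere_slice {V : Type*} [NormedAddCommGroup V] [InnerProductSpace ℝ V]
    [MeasurableSpace V] [BorelSpace V] [FiniteDimensional ℝ V] {e : V} (he : ‖e‖ = 1)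
    {d : ℕ} (hd : Module.finrank ℝ V = d + 2) {G : V → ℝ} (hG : Measurable G)
    (hGi : Integrable (fun v : sphere (0 : V) 1 => G v) (volume : Measure V).toSphere) :
    ∫ v : sphere (0 : V) 1, G v ∂(volume : Measure V).toSphere =
      ∫ t in Ioo (-1 : ℝ) 1, (1 - t ^ 2) ^ (((d : ℝ) - 1) / 2) *
        ∫ u : sphere (0 : (Submodule.span ℝ {e})ᗮ) 1,
          G (t • e + Real.sqrt (1 - t ^ 2) • ((u : (Submodule.span ℝ {e})ᗮ) : V))
        ∂(volume : Measure (Submodule.span ℝ {e})ᗮ).toSphere := by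
  set W := (Submodule.span ℝ {e})ᗮ
  set ρ : ℝ → ENNReal := fun t => ENNReal.ofReal ((1 - t ^ 2) ^ (((d : ℝ) - 1) / 2)) with hρ
  set ν : Measure ℝ := (volume.restrict (Ioo (-1 : ℝ) 1)).withDensity ρ with hν
  have hρm : Measurable ρ := by fun_prop
  have : SFinite ν := by rw [hν]; infer_instance
  set Ψ : sphere (0 : W) 1 × ℝ → V := fun q => q.2 • e + Real.sqrt (1 - q.2 ^ 2) • ((q.1 : W) : V)
  have hΨ : Measurable Ψ := by fun_prop
  have hmeas : (volume : Measure V).toSphere.map Subtype.val =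
      ((volume : Measure W).toSphere.prod ν).map Ψ := by
    refine Measure.ext_of_lintegral _ fun F hF => ?_
    rw [lintegral_map hF measurable_subtype_coe, lintegral_map hF hΨ,
      lintegral_toSphere_slice he hd hF, lintegral_prod _ (by fun_prop)]
    refine lintegral_congr fun u => ?_
    rw [hν, lintegral_withDensity_eq_lintegral_mul _ hρm (by fun_prop)]
    rfl
  have hi : Integrable (fun q => G (Ψ q)) ((volume : Measure W).toSphere.prod ν) := by
    have h1 : Integrable G ((volume : Measure V).toSphere.map Subtype.val) :=
      (integrable_map_measure hG.aestronglyMeasurable measurable_subtype_coe.aemeasurable).2 hGi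
    rw [hmeas] at h1
    exact (integrable_map_measure hG.aestronglyMeasurable hΨ.aemeasurable).1 h1
  calc ∫ v : sphere (0 : V) 1, G v ∂(volume : Measure V).toSphere
      = ∫ v, G v ∂((volume : Measure V).toSphere.map Subtype.val) :=
        (integral_map measurable_subtype_coe.aemeasurable hG.aestronglyMeasurable).symm
    _ = ∫ q, G (Ψ q) ∂((volume : Measure W).toSphere.prod ν) := by
        rw [hmeas, integral_map hΨ.aemeasurable hG.aestronglyMeasurable]
    _ = ∫ t, ∫ u, G (Ψ (u, t)) ∂(volume : Measure W).toSphere ∂ν := integral_prod_symm _ hi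
    _ = _ := by
        rw [hν, integral_withDensity_eq_integral_toReal_smul hρm (by simp [hρ])]
        refine setIntegral_congr_fun measurableSet_Ioo fun t ht => ?_
        have : 0 ≤ 1 - t ^ 2 := by nlinarith [ht.1, ht.2]
        simp only [hρ, smul_eq_mul]
        rw [ENNReal.toReal_ofReal (Real.rpow_nonneg this _)]

-- The surface measure and the image of the weighted measure on the ball agree after restriction to
-- the half space where `G` can be nonzero. Only changes of variables occur, no Fubini, so
-- integrability plays no role.
open Set Metric Measure in
theorem integral_toSphere_graph {V : Type*} [NormedAddCommGroup V] [InnerProductSpace ℝ V]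
    [MeasurableSpace V] [BorelSpace V] [FiniteDimensional ℝ V] {e : V} (he : ‖e‖ = 1)
    (hd : 2 ≤ Module.finrank ℝ V) {G : V → ℝ} (hG : Measurable G)
    (hG0 : ∀ v, inner ℝ e v ≤ 0 → G v = 0) :
    ∫ v : sphere (0 : V) 1, G v ∂(volume : Measure V).toSphere =
      ∫ p in ball (0 : (Submodule.span ℝ {e})ᗮ) 1, (Real.sqrt (1 - ‖p‖ ^ 2))⁻¹ *
          G (Real.sqrt (1 - ‖p‖ ^ 2) • e + (p : V)) := by
  set W := (Submodule.span ℝ {e})ᗮ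
  set ρ : W → ENNReal := fun p => ENNReal.ofReal (Real.sqrt (1 - ‖p‖ ^ 2))⁻¹ with hρ
  have hρm : Measurable ρ := by fun_prop
  set ν : Measure W := (volume.restrict (ball (0 : W) 1)).withDensity ρ with hν
  set Ψ : W → V := fun p => Real.sqrt (1 - ‖p‖ ^ 2) • e + (p : V)
  have hΨ : Measurable Ψ := by fun_prop
  set H : Set V := {v | 0 < inner ℝ e v} with hH
  have hHm : MeasurableSet H := measurableSet_lt measurable_const (by fun_prop)
  have hmeas : ((volume : Measure V).toSphere.map Subtype.val).restrict H = (ν.map Ψ).restrict H := by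
    refine Measure.ext_of_lintegral _ fun F hF => ?_
    have hFi : Measurable (H.indicator F) := hF.indicator hHm
    rw [← lintegral_indicator hHm, ← lintegral_indicator hHm, lintegral_map hFi measurable_subtype_coe,
      lintegral_map hFi hΨ, lintegral_toSphere_graph he hd hFi, hν,
      lintegral_withDensity_eq_lintegral_mul _ hρm (g := fun p => H.indicator F (Ψ p)) (hFi.comp hΨ)]
    · rfl
    · intro v hv
      exact indicator_of_notMem (by simpa [hH] using hv) _
  have hGi : H.indicator G = G := by
    refine indicator_eq_self.2 fun v hv => ?_
    by_contra hh
    exact hv (hG0 v (by simpa [hH] using hh))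
  calc ∫ v : sphere (0 : V) 1, G v ∂(volume : Measure V).toSphere
      = ∫ v, G v ∂((volume : Measure V).toSphere.map Subtype.val) :=
        (integral_map measurable_subtype_coe.aemeasurable hG.aestronglyMeasurable).symm
    _ = ∫ v, G v ∂(ν.map Ψ) := by
        rw [← hGi, integral_indicator hHm, integral_indicator hHm, hmeas]
    _ = ∫ p, G (Ψ p) ∂ν := integral_map hΨ.aemeasurable hG.aestronglyMeasurable
    _ = _ := by
        rw [hν, integral_withDensity_eq_integral_toReal_smul hρm (by simp [hρ])]
        refine setIntegral_congr_fun measurableSet_ball fun p hp => ?_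
        simp only [hρ, smul_eq_mul]
        rw [ENNReal.toReal_ofReal (by positivity)]

open Set Metric Measure Pointwise in
/-- The surface measure of the unit sphere is invariant under linear isometries. -/
theorem integral_toSphere_isometry {V W : Type*} [NormedAddCommGroup V] [InnerProductSpace ℝ V]
    [MeasurableSpace V] [BorelSpace V] [FiniteDimensional ℝ V]
    [NormedAddCommGroup W] [InnerProductSpace ℝ W]
    [MeasurableSpace W] [BorelSpace W] [FiniteDimensional ℝ W] (L : V ≃ₗᵢ[ℝ] W) (G : W → ℝ) :
    ∫ u : sphere (0 : V) 1, G (L u) ∂(volume : Measure V).toSphere =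
      ∫ u : sphere (0 : W) 1, G u ∂(volume : Measure W).toSphere := by
  let e : sphere (0 : V) 1 ≃ₜ sphere (0 : W) 1 :=
    L.toHomeomorph.subtype fun x => by simp
  have he : (volume : Measure V).toSphere.map e = (volume : Measure W).toSphere := by
    refine Measure.ext fun s hs => ?_
    rw [Measure.map_apply e.measurable hs, toSphere_apply' _ (e.measurable hs), toSphere_apply' _ hs,
      LinearEquiv.finrank_eq L.toLinearEquiv]
    congr 1
    -- `toSphere` measures a subset of the sphere by the volume of the cone over it, and `L` carries
    -- cones to cones.
    have h1 : Set.Ioo (0 : ℝ) 1 • ((↑) '' (e ⁻¹' s) : Set V) =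
        L ⁻¹' (Set.Ioo (0 : ℝ) 1 • ((↑) '' s : Set W)) := by
      ext x
      simp only [Set.mem_smul, Set.mem_preimage, Set.mem_image]
      constructor
      · rintro ⟨r, hr, -, ⟨y, hy, rfl⟩, rfl⟩
        exact ⟨r, hr, L y, ⟨e y, hy, rfl⟩, by simp⟩
      · rintro ⟨r, hr, -, ⟨y, hy, rfl⟩, h⟩
        refine ⟨r, hr, L.symm y, ⟨e.symm y, by simpa using hy, rfl⟩, ?_⟩
        apply L.injective
        simp [h]
    rw [h1]
    exact L.measurePreserving.measure_preimage_emb L.toHomeomorph.measurableEmbedding _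
  rw [← he, e.measurableEmbedding.integral_map]
  rfl

/-! ### The Cauchy transform of the Gegenbauer weight and its boundary values -/

/-- The Gegenbauer weight `(1 - s²)^{(m-1)/2}`. -/
noncomputable def gegenbauerWeight (m : ℕ) (s : ℝ) : ℝ := (1 - s ^ 2) ^ (((m : ℝ) - 1) / 2)

/-- `∫_{-1}^1 (1 - s²)^{(m-1)/2} (ζ - i s)^{-k} ds`. -/
noncomputable def gegenbauerCauchy (m k : ℕ) (ζ : ℂ) : ℂ :=
  ∫ s in (-1 : ℝ)..1, (gegenbauerWeight m s : ℂ) * ((ζ - Complex.I * s) ^ k)⁻¹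

theorem continuous_gegenbauerWeight {m : ℕ} (hm : 1 ≤ m) : Continuous (gegenbauerWeight m) := by
  have : (1 : ℝ) ≤ m := by exact_mod_cast hm
  exact Continuous.rpow_const (by fun_prop) fun s => Or.inr (by linarith)

theorem gegenbauerWeight_nonneg {m : ℕ} {s : ℝ} (hs : s ∈ Set.Icc (-1 : ℝ) 1) :
    0 ≤ gegenbauerWeight m s :=
  Real.rpow_nonneg (by nlinarith [hs.1, hs.2]) _

theorem gegenbauerWeight_le_one {m : ℕ} (hm : 1 ≤ m) {s : ℝ} (hs : s ∈ Set.Icc (-1 : ℝ) 1) :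
    gegenbauerWeight m s ≤ 1 := by
  have : (1 : ℝ) ≤ m := by exact_mod_cast hm
  exact Real.rpow_le_one (by nlinarith [hs.1, hs.2]) (by nlinarith) (by linarith)

theorem norm_gegenbauerWeight_le {m : ℕ} (hm : 1 ≤ m) {s : ℝ} (hs : s ∈ Set.Icc (-1 : ℝ) 1) :
    ‖(gegenbauerWeight m s : ℂ)‖ ≤ 1 := by
  rw [Complex.norm_real, Real.norm_of_nonneg (gegenbauerWeight_nonneg hs)]
  exact gegenbauerWeight_le_one hm hs

theorem re_le_norm_sub_I_mul (ζ : ℂ) (s : ℝ) : ζ.re ≤ ‖ζ - Complex.I * s‖ := by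
  have := Complex.re_le_norm (ζ - Complex.I * s)
  simpa using this

theorem sub_I_mul_ne_zero {ζ : ℂ} (hζ : 0 < ζ.re) (s : ℝ) : ζ - Complex.I * s ≠ 0 := by
  rw [← norm_pos_iff]
  exact hζ.trans_le (re_le_norm_sub_I_mul ζ s)

theorem continuous_gegenbauerCauchy_integrand {m : ℕ} (hm : 1 ≤ m) (k : ℕ) {ζ : ℂ} (hζ : 0 < ζ.re) :
    Continuous fun s : ℝ => (gegenbauerWeight m s : ℂ) * ((ζ - Complex.I * s) ^ k)⁻¹ := by
  refine (Complex.continuous_ofReal.comp (continuous_gegenbauerWeight hm)).mul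
    (Continuous.inv₀ (by fun_prop) fun s => pow_ne_zero _ (sub_I_mul_ne_zero hζ s))

theorem norm_inv_pow_le {ζ : ℂ} {δ : ℝ} (hδ : 0 < δ) (h : δ ≤ ζ.re) (s : ℝ) (k : ℕ) :
    ‖((ζ - Complex.I * s) ^ k)⁻¹‖ ≤ (δ ^ k)⁻¹ := by
  rw [norm_inv, norm_pow]
  gcongr
  exact h.trans (re_le_norm_sub_I_mul ζ s)

theorem norm_gegenbauerCauchy_le {m : ℕ} (hm : 1 ≤ m) (k : ℕ) {ζ : ℂ} {δ : ℝ} (hδ : 0 < δ)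
    (h : δ ≤ ζ.re) : ‖gegenbauerCauchy m k ζ‖ ≤ 2 * (δ ^ k)⁻¹ := by
  have := intervalIntegral.norm_integral_le_of_norm_le_const (a := (-1 : ℝ)) (b := 1)
    (f := fun s : ℝ => (gegenbauerWeight m s : ℂ) * ((ζ - Complex.I * s) ^ k)⁻¹) (C := (δ ^ k)⁻¹)
    fun s hs => by
      rw [Set.uIoc_of_le (by norm_num)] at hs
      rw [norm_mul]
      exact (mul_le_mul (norm_gegenbauerWeight_le hm (Set.Ioc_subset_Icc_self hs))
        (norm_inv_pow_le hδ h s k) (norm_nonneg _) zero_le_one).trans_eq (one_mul _)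
  rw [gegenbauerCauchy]
  refine this.trans_eq ?_
  norm_num [mul_comm]

theorem hasDerivAt_gegenbauerCauchy {m : ℕ} (hm : 1 ≤ m) (k : ℕ) {ζ : ℂ} (hζ : 0 < ζ.re) :
    HasDerivAt (gegenbauerCauchy m k) (-k * gegenbauerCauchy m (k + 1) ζ) ζ := by
  -- Within distance `ζ.re / 2` of `ζ` the real part stays above `ζ.re / 2`, which bounds the
  -- differentiated kernels uniformly.
  have hre : ∀ x ∈ Metric.ball ζ (ζ.re / 2), ζ.re / 2 ≤ x.re := by
    intro x hx
    have h1 := Complex.abs_re_le_norm (x - ζ)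
    rw [← dist_eq_norm] at h1
    have h2 := Metric.mem_ball.1 hx
    have h3 := (abs_le.1 (h1.trans h2.le)).1
    rw [Complex.sub_re] at h3
    linarith
  have hpos : 0 < ζ.re / 2 := by linarith
  have key := intervalIntegral.hasDerivAt_integral_of_dominated_loc_of_deriv_le (μ := volume)
    (a := (-1 : ℝ)) (b := 1) (x₀ := ζ) (s := Metric.ball ζ (ζ.re / 2))
    (bound := fun _ => (k : ℝ) * ((ζ.re / 2) ^ (k + 1))⁻¹)
    (F := fun (ζ : ℂ) (s : ℝ) => (gegenbauerWeight m s : ℂ) * ((ζ - Complex.I * s) ^ k)⁻¹)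
    (F' := fun (ζ : ℂ) (s : ℝ) => -k * ((gegenbauerWeight m s : ℂ) *
      ((ζ - Complex.I * s) ^ (k + 1))⁻¹))
    (Metric.ball_mem_nhds _ hpos) ?_ ?_ ?_ ?_ ?_ ?_
  · have := key.2
    rwa [intervalIntegral.integral_const_mul] at this
  · filter_upwards [Metric.ball_mem_nhds ζ hpos] with x hx
    exact (continuous_gegenbauerCauchy_integrand hm k (hpos.trans_le (hre x hx))).aestronglyMeasurable
  · exact (continuous_gegenbauerCauchy_integrand hm k hζ).intervalIntegrable _ _
  · exact ((continuous_gegenbauerCauchy_integrand hm (k + 1) hζ).const_mul (-(k : ℂ))).aestronglyMeasurable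
  · refine Filter.Eventually.of_forall fun s hs x hx => ?_
    rw [Set.uIoc_of_le (by norm_num)] at hs
    rw [norm_mul, norm_neg, Complex.norm_natCast, norm_mul]
    gcongr
    exact (mul_le_mul (norm_gegenbauerWeight_le hm (Set.Ioc_subset_Icc_self hs))
        (norm_inv_pow_le hpos (hre x hx) s (k + 1)) (norm_nonneg _) zero_le_one).trans_eq (one_mul _)
  · exact intervalIntegrable_const
  · refine Filter.Eventually.of_forall fun s hs x hx => ?_
    have hne := sub_I_mul_ne_zero (hpos.trans_le (hre x hx)) s
    have h1 : HasDerivAt (fun x : ℂ => x - Complex.I * s) 1 x := (hasDerivAt_id x).sub_const _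
    have h2 := ((h1.pow k).inv (pow_ne_zero _ hne)).const_mul (gegenbauerWeight m s : ℂ)
    refine h2.congr_deriv ?_
    rcases k with _ | k
    · simp
    · simp only [Nat.add_sub_cancel, Pi.pow_apply]
      field_simp
      ring

/-- The derivative in `s` of `(1 - s²)^{(m+1)/2} (ζ - is)^{-(m+1)}` is a combination of the two
integrands, and its integral over `[-1, 1]` is zero because the boundary terms vanish. -/
theorem gegenbauerCauchy_recurrence {m : ℕ} (hm : 1 ≤ m) {ζ : ℂ} (hζ : 0 < ζ.re) :
    (1 + ζ ^ 2) * gegenbauerCauchy m (m + 2) ζ = ζ * gegenbauerCauchy m (m + 1) ζ := by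
  set f : ℝ → ℂ := fun s => (gegenbauerWeight (m + 2) s : ℂ) * ((ζ - Complex.I * s) ^ (m + 1))⁻¹
  set f' : ℝ → ℂ := fun s => (-(m + 1) * Complex.I) * ((ζ * ((gegenbauerWeight m s : ℂ) * ((ζ - Complex.I * s) ^ (m + 1))⁻¹) -
     (1 + ζ ^ 2) * ((gegenbauerWeight m s : ℂ) * ((ζ - Complex.I * s) ^ (m + 2))⁻¹))) with hf'
  have c1 := continuous_gegenbauerCauchy_integrand hm (m + 1) hζ
  have c2 := continuous_gegenbauerCauchy_integrand hm (m + 2) hζ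
  have hint : ∫ s in (-1 : ℝ)..1, f' s = f 1 - f (-1) := by
    refine intervalIntegral.integral_eq_sub_of_hasDerivAt_of_le (by norm_num)
      (continuous_gegenbauerCauchy_integrand (by omega) (m + 1) hζ).continuousOn (fun s hs => ?_) ?_
    · have hpos : 0 < 1 - s ^ 2 := by nlinarith [hs.1, hs.2]
      have hne := sub_I_mul_ne_zero hζ s
      have h0 : HasDerivAt (fun s : ℝ => 1 - s ^ 2) (-(2 * s)) s := by
        simpa using (hasDerivAt_pow 2 s).const_sub 1
      have h1 : HasDerivAt (gegenbauerWeight (m + 2)) (-(m + 1) * s * gegenbauerWeight m s) s := by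
        refine (h0.rpow_const (p := (((m + 2 : ℕ) : ℝ) - 1) / 2) (Or.inl hpos.ne')).congr_deriv ?_
        rw [gegenbauerWeight, show (((m + 2 : ℕ) : ℝ) - 1) / 2 - 1 = ((m : ℝ) - 1) / 2 by push_cast; ring]
        push_cast
        ring
      have h2 : HasDerivAt (fun s : ℝ => ζ - Complex.I * s) (-Complex.I) s := by
        simpa using ((Complex.ofRealCLM.hasDerivAt (x := s)).const_mul Complex.I).const_sub ζ
      have hw : (gegenbauerWeight (m + 2) s : ℂ) = (1 - s ^ 2) * gegenbauerWeight m s := by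
        have : gegenbauerWeight (m + 2) s = (1 - s ^ 2) * gegenbauerWeight m s := by
          rw [gegenbauerWeight, gegenbauerWeight, mul_comm, ← Real.rpow_add_one hpos.ne']
          congr 1
          push_cast
          ring
        rw [this]; push_cast; ring
      refine (h1.ofReal_comp.mul ((h2.pow (m + 1)).inv (pow_ne_zero _ hne))).congr_deriv ?_
      simp only [Pi.pow_apply, Pi.inv_apply, hf', Nat.add_sub_cancel]
      rw [hw]
      push_cast
      -- With `z` as the independent variable and `ζ = z + is`, clearing denominators leaves a
      -- polynomial identity modulo `i² = -1`.
      obtain ⟨z, hz⟩ : ∃ z, z = ζ - Complex.I * s := ⟨_, rfl⟩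
      have e2 : ζ = z + Complex.I * s := by rw [hz]; ring
      rw [← hz] at hne ⊢
      rw [e2, pow_succ z (m + 1), pow_succ z m]
      have hZ : z ^ m ≠ 0 := pow_ne_zero _ hne
      generalize z ^ m = Z at *
      have hI := Complex.I_sq
      generalize Complex.I = i at *
      generalize (gegenbauerWeight m s : ℂ) = w
      field_simp
      grind
    · exact (((c1.const_mul ζ).sub (c2.const_mul (1 + ζ ^ 2))).const_mul _).intervalIntegrable _ _
  have hend : f 1 - f (-1) = 0 := by
    have h0 : (((m + 2 : ℕ) : ℝ) - 1) / 2 ≠ 0 := by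
      push_cast
      have : (0 : ℝ) ≤ m := m.cast_nonneg
      intro h; linarith
    have h1 : gegenbauerWeight (m + 2) 1 = 0 := by
      rw [gegenbauerWeight, one_pow, sub_self, Real.zero_rpow h0]
    have h2 : gegenbauerWeight (m + 2) (-1) = 0 := by
      rw [gegenbauerWeight, neg_one_sq, sub_self, Real.zero_rpow h0]
    simp [f, h1, h2]
  rw [hend, hf', intervalIntegral.integral_const_mul, intervalIntegral.integral_sub
    ((c1.const_mul ζ).intervalIntegrable _ _) ((c2.const_mul _).intervalIntegrable _ _),
    intervalIntegral.integral_const_mul, intervalIntegral.integral_const_mul] at hint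
  have hne : (-((m : ℂ) + 1) * Complex.I) ≠ 0 := by
    refine mul_ne_zero (neg_ne_zero.2 ?_) Complex.I_ne_zero
    exact_mod_cast m.succ_ne_zero
  have := (mul_eq_zero.1 hint).resolve_left hne
  exact (sub_eq_zero.1 this).symm

theorem one_add_sq_re (ζ : ℂ) : (1 + ζ ^ 2).re = 1 + ζ.re ^ 2 - ζ.im ^ 2 := by
  simp [pow_two]; ring

theorem one_add_sq_mem_slitPlane {ζ : ℂ} (hζ : |ζ.im| < 1) : 1 + ζ ^ 2 ∈ Complex.slitPlane := by
  left
  rw [one_add_sq_re]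
  have := sq_lt_one_iff_abs_lt_one _ |>.2 hζ
  nlinarith [sq_nonneg ζ.re]

/-- `∫_{-1}^1 (1 - s²)^{(m-1)/2} ds`. -/
noncomputable def gegenbauerMass (m : ℕ) : ℝ := ∫ s in (-1 : ℝ)..1, gegenbauerWeight m s

/-- For large `η` the kernel is asymptotically `η^{-(m+1)}`, so only the mass of the weight
survives. This fixes the constant in the closed form of `gegenbauerCauchy m (m + 1)`. -/
theorem tendsto_gegenbauerCauchy_mul {m : ℕ} (hm : 1 ≤ m) :
    Filter.Tendsto (fun η : ℝ => gegenbauerCauchy m (m + 1) η *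
      (1 + (η : ℂ) ^ 2) ^ ((((m : ℝ) + 1) / 2 : ℝ) : ℂ)) Filter.atTop
      (nhds ((gegenbauerMass m : ℝ) : ℂ)) := by
  have hpw : ∀ η : ℝ, (1 + (η : ℂ) ^ 2) ^ ((((m : ℝ) + 1) / 2 : ℝ) : ℂ) =
      ((Real.sqrt (1 + η ^ 2) : ℝ) : ℂ) ^ (m + 1) := by
    intro η
    have h1 : (0 : ℝ) ≤ 1 + η ^ 2 := by positivity
    rw [show (1 + (η : ℂ) ^ 2) = ((1 + η ^ 2 : ℝ) : ℂ) by push_cast; ring,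
      ← Complex.ofReal_cpow h1, ← Complex.ofReal_pow, Real.sqrt_eq_rpow, ← Real.rpow_natCast _ (m + 1),
      ← Real.rpow_mul h1]
    congr 2
    push_cast
    ring
  have hone : Filter.Tendsto (fun η : ℝ => Real.sqrt (1 + η ^ 2) / η) Filter.atTop (nhds 1) := by
    have h1 : Filter.Tendsto (fun η : ℝ => Real.sqrt ((η⁻¹) ^ 2 + 1)) Filter.atTop (nhds 1) := by
      have := ((tendsto_inv_atTop_zero (𝕜 := ℝ)).pow 2).add_const 1 |>.sqrt
      simpa using this
    refine h1.congr' ?_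
    filter_upwards [Filter.eventually_gt_atTop 0] with η hη
    rw [← Real.sqrt_sq hη.le, ← Real.sqrt_div (by positivity), Real.sqrt_sq hη.le]
    congr 1
    field_simp
  have key : Filter.Tendsto (fun η : ℝ => ∫ s in (-1 : ℝ)..1, (gegenbauerWeight m s : ℂ) *
      (((Real.sqrt (1 + η ^ 2) : ℝ) : ℂ) / (η - Complex.I * s)) ^ (m + 1)) Filter.atTop
      (nhds (∫ s in (-1 : ℝ)..1, (gegenbauerWeight m s : ℂ))) := by
    refine intervalIntegral.tendsto_integral_filter_of_dominated_convergence (fun _ => 2 ^ (m + 1))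
      ?_ ?_ intervalIntegrable_const ?_
    · filter_upwards [Filter.eventually_gt_atTop 0] with η hη
      refine Continuous.aestronglyMeasurable ?_
      refine (Complex.continuous_ofReal.comp (continuous_gegenbauerWeight hm)).mul
        (Continuous.pow (Continuous.div (by fun_prop) (by fun_prop) fun s => ?_) _)
      exact sub_I_mul_ne_zero (by simpa using hη) s
    · filter_upwards [Filter.eventually_gt_atTop 0, hone.eventually (Iio_mem_nhds one_lt_two)]
        with η hη h2
      refine Filter.Eventually.of_forall fun s hs => ?_
      rw [Set.uIoc_of_le (by norm_num)] at hs
      rw [norm_mul, norm_pow, norm_div, Complex.norm_real (Real.sqrt _),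
        Real.norm_of_nonneg (Real.sqrt_nonneg _)]
      refine (mul_le_mul (norm_gegenbauerWeight_le hm (Set.Ioc_subset_Icc_self hs)) (pow_le_pow_left₀
        (by positivity) ?_ _) (by positivity) zero_le_one).trans_eq (one_mul _)
      refine le_trans ?_ (le_of_lt h2)
      exact div_le_div_of_nonneg_left (Real.sqrt_nonneg _) hη
        (by simpa using re_le_norm_sub_I_mul (η : ℂ) s)
    · refine Filter.Eventually.of_forall fun s hs => ?_
      have h3 : Filter.Tendsto (fun η : ℝ => ((Real.sqrt (1 + η ^ 2) : ℝ) : ℂ) / (η - Complex.I * s))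
          Filter.atTop (nhds 1) := by
        have h4 : Filter.Tendsto (fun η : ℝ => ((Real.sqrt (1 + η ^ 2) / η : ℝ) : ℂ) /
            (1 - Complex.I * s * ((η⁻¹ : ℝ) : ℂ))) Filter.atTop (nhds 1) := by
          have h5 := (Complex.continuous_ofReal.tendsto 0).comp (tendsto_inv_atTop_zero (𝕜 := ℝ))
          have h6 := ((Complex.continuous_ofReal.tendsto 1).comp hone).div
            ((h5.const_mul (Complex.I * s)).const_sub 1) (by simp)
          refine (h6.congr fun η => rfl).trans_eq ?_
          simp
        refine h4.congr' ?_
        filter_upwards [Filter.eventually_gt_atTop 0] with η hη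
        have hη' : (η : ℂ) ≠ 0 := by exact_mod_cast hη.ne'
        push_cast
        rw [div_div]
        congr 1
        field_simp
      simpa using (h3.pow (m + 1)).const_mul (gegenbauerWeight m s : ℂ)
  rw [intervalIntegral.integral_ofReal] at key
  refine key.congr fun η => ?_
  rw [hpw, gegenbauerCauchy, ← intervalIntegral.integral_mul_const]
  refine intervalIntegral.integral_congr fun s _ => ?_
  simp only [div_pow]
  rw [div_eq_mul_inv]
  ring

/-- The derivative formula and the recurrence give `(1 + ζ²) J' = -(m + 1) ζ J` for `J =
gegenbauerCauchy m (m + 1)`. Hence `J (1 + ζ²)^{(m+1)/2}` is constant on the half strip, which is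
convex and on which `1 + ζ²` avoids the branch cut; the constant is read off at infinity along the
real axis. -/
theorem gegenbauerCauchy_succ_eq {m : ℕ} (hm : 1 ≤ m) {ζ : ℂ} (hζ : 0 < ζ.re) (hζ1 : |ζ.im| < 1) :
    gegenbauerCauchy m (m + 1) ζ =
      gegenbauerMass m * (1 + ζ ^ 2) ^ (-(((m : ℝ) + 1) / 2 : ℝ) : ℂ) := by
  set a : ℂ := ((((m : ℝ) + 1) / 2 : ℝ) : ℂ) with ha
  set R : Set ℂ := {z | 0 < z.re} ∩ {z | |z.im| < 1} with hR
  have hRo : IsOpen R := (isOpen_lt continuous_const Complex.continuous_re).inter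
    (isOpen_lt (Complex.continuous_im.abs) continuous_const)
  have hRc : IsPreconnected R := by
    refine (Convex.inter (convex_halfSpace_re_gt 0) ?_).isPreconnected
    have : {z : ℂ | |z.im| < 1} = {z : ℂ | -1 < z.im} ∩ {z | z.im < 1} := by
      ext z; simp [abs_lt]
    rw [this]
    exact (convex_halfSpace_im_gt _).inter (convex_halfSpace_im_lt _)
  have hder : ∀ z ∈ R, HasDerivAt (fun z => gegenbauerCauchy m (m + 1) z * (1 + z ^ 2) ^ a) 0 z := by
    intro z hz
    have hs := one_add_sq_mem_slitPlane hz.2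
    have hne := Complex.slitPlane_ne_zero hs
    have h1 := hasDerivAt_gegenbauerCauchy hm (m + 1) hz.1
    have h2 : HasDerivAt (fun z : ℂ => 1 + z ^ 2) (2 * z) z := by
      simpa using (hasDerivAt_pow 2 z).const_add 1
    have h3 := h1.mul (h2.cpow_const (c := a) hs)
    refine h3.congr_deriv ?_
    have h4 : (1 + z ^ 2) ^ a = (1 + z ^ 2) ^ (a - 1) * (1 + z ^ 2) := by
      rw [Complex.cpow_sub _ _ hne, Complex.cpow_one, div_mul_cancel₀ _ hne]
    have h5 := gegenbauerCauchy_recurrence hm hz.1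
    rw [h4]
    have h6 : a * 2 = (m + 1 : ℕ) := by rw [ha]; push_cast; ring
    linear_combination (-((m + 1 : ℕ) : ℂ) * (1 + z ^ 2) ^ (a - 1)) * h5 +
      gegenbauerCauchy m (m + 1) z * (1 + z ^ 2) ^ (a - 1) * z * h6
  have hconst : ∀ z ∈ R, ∀ w ∈ R, gegenbauerCauchy m (m + 1) z * (1 + z ^ 2) ^ a =
      gegenbauerCauchy m (m + 1) w * (1 + w ^ 2) ^ a := by
    intro z hz w hw
    exact hRo.is_const_of_deriv_eq_zero hRc
      (fun x hx => (hder x hx).differentiableAt.differentiableWithinAt)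
      (fun x hx => (hder x hx).deriv) hz hw
  have hval : gegenbauerCauchy m (m + 1) ζ * (1 + ζ ^ 2) ^ a = gegenbauerMass m := by
    refine tendsto_nhds_unique ?_ (tendsto_gegenbauerCauchy_mul hm)
    refine tendsto_const_nhds.congr' ?_
    filter_upwards [Filter.eventually_gt_atTop 0] with η hη
    exact hconst ζ ⟨hζ, hζ1⟩ η ⟨by simpa using hη, by simp⟩
  have hs := one_add_sq_mem_slitPlane hζ1
  rw [← hval, Complex.cpow_neg, mul_assoc, mul_inv_cancel₀, mul_one]
  rw [Ne, Complex.cpow_eq_zero_iff]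
  exact fun h => Complex.slitPlane_ne_zero hs h.1

/-- Wallis: the reduction formula makes the left side independent of `m`, and for `m = 0` it is `2 ·
π`. -/
theorem integral_sin_pow_mul_integral_sin_pow_pred (m : ℕ) :
    ((m : ℝ) + 1) * (∫ x in (0 : ℝ)..Real.pi, Real.sin x ^ (m + 1)) *
      (∫ x in (0 : ℝ)..Real.pi, Real.sin x ^ m) = 2 * Real.pi := by
  induction m with
  | zero => simp; norm_num
  | succ k ih =>
    rw [integral_sin_pow, Real.sin_zero, Real.sin_pi]
    rw [← ih]
    push_cast
    field_simp
    ring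

theorem gegenbauerMass_eq (m : ℕ) :
    gegenbauerMass m = ∫ x in (0 : ℝ)..Real.pi, Real.sin x ^ m := by
  rw [gegenbauerMass, intervalIntegral.integral_of_le (by norm_num), integral_Ioc_eq_integral_Ioo,
    ← image_cos_Ioo, integral_image_eq_integral_abs_deriv_smul measurableSet_Ioo
    (fun x _ => (Real.hasDerivAt_cos x).hasDerivWithinAt)
    (Real.injOn_cos.mono Set.Ioo_subset_Icc_self), intervalIntegral.integral_of_le Real.pi_pos.le,
    integral_Ioc_eq_integral_Ioo]
  refine setIntegral_congr_fun measurableSet_Ioo fun φ hφ => ?_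
  have hs := Real.sin_pos_of_mem_Ioo hφ
  have h1 : 1 - Real.cos φ ^ 2 = Real.sin φ ^ 2 := by linarith [Real.sin_sq_add_cos_sq φ]
  simp only [gegenbauerWeight, smul_eq_mul]
  rw [h1, abs_neg, abs_of_pos hs, ← Real.rpow_natCast (Real.sin φ) 2, ← Real.rpow_mul hs.le,
    ← Real.rpow_natCast]
  nth_rw 1 [← Real.rpow_one (Real.sin φ)]
  rw [← Real.rpow_add hs]
  congr 1
  push_cast
  ring

/-- This identity is why the limit of `gegenbauerCauchy m m` at `0` is `π` for every `m`. -/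
theorem mul_gegenbauerMass_mul_integral_cos_pow {m : ℕ} (hm : 1 ≤ m) :
    m * gegenbauerMass m * ∫ x in (0 : ℝ)..Real.pi / 2, Real.cos x ^ (m - 1) = Real.pi := by
  obtain ⟨k, rfl⟩ : ∃ k, m = k + 1 := ⟨m - 1, by omega⟩
  rw [gegenbauerMass_eq, Nat.add_sub_cancel, EulerSine.integral_cos_pow_eq]
  have := integral_sin_pow_mul_integral_sin_pow_pred k
  push_cast
  linear_combination this / 2

theorem gegenbauerMass_nonneg (m : ℕ) : 0 ≤ gegenbauerMass m :=
  intervalIntegral.integral_nonneg (by norm_num) fun _ hs => gegenbauerWeight_nonneg hs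

/-- The strip keeps `ζ` away from the branch points `±i`: the real part of `1 + ζ²` is at least `1 -
(1 - κ)² ≥ κ`, as `κ ≤ 1` is forced by the bound on `|ζ.im|`. -/
theorem norm_one_add_sq_cpow_le {κ : ℝ} (hκ : 0 < κ) {a : ℝ} (ha : 0 ≤ a) {ζ : ℂ}
    (h : |ζ.im| ≤ 1 - κ) : ‖(1 + ζ ^ 2) ^ ((-a : ℝ) : ℂ)‖ ≤ κ ^ (-a) := by
  rw [Complex.norm_cpow_real]
  refine Real.rpow_le_rpow_of_nonpos hκ ?_ (by linarith)
  refine le_trans ?_ (Complex.re_le_norm _)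
  rw [one_add_sq_re]
  have := sq_abs ζ.im
  nlinarith [sq_nonneg ζ.re, abs_nonneg ζ.im]

theorem norm_gegenbauerCauchy_succ_le {m : ℕ} (hm : 1 ≤ m) {κ : ℝ} (hκ : 0 < κ)
    {ζ : ℂ} (hζ : 0 < ζ.re) (h : |ζ.im| ≤ 1 - κ) :
    ‖gegenbauerCauchy m (m + 1) ζ‖ ≤ gegenbauerMass m * κ ^ (-(((m : ℝ) + 1) / 2)) := by
  rw [gegenbauerCauchy_succ_eq hm hζ (by linarith), norm_mul, Complex.norm_real,
    Real.norm_of_nonneg (gegenbauerMass_nonneg m)]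
  refine mul_le_mul_of_nonneg_left ?_ (gegenbauerMass_nonneg m)
  have := norm_one_add_sq_cpow_le hκ (a := ((m : ℝ) + 1) / 2) (by positivity) h
  simpa using this

/-- The direct estimate blows up at the imaginary axis. Instead, the derivative `-m J_{m+1}` is
bounded on the strip by the closed form, and the mean value inequality along a horizontal segment
compares `J_m` with its value on `Re ζ = 1`, where it is at most `2`. The bound dominates the limit
`ε → 0` later. -/
theorem exists_norm_gegenbauerCauchy_le {m : ℕ} (hm : 1 ≤ m) {κ : ℝ} (hκ : 0 < κ) :
    ∃ C, ∀ ζ : ℂ, 0 < ζ.re → |ζ.im| ≤ 1 - κ → ‖gegenbauerCauchy m m ζ‖ ≤ C := by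
  set D := (m : ℝ) * (gegenbauerMass m * κ ^ (-(((m : ℝ) + 1) / 2))) with hD
  have hD0 : 0 ≤ D := by
    have := gegenbauerMass_nonneg m
    positivity
  refine ⟨2 + D, fun ζ hζ h => ?_⟩
  have hlarge : ∀ z : ℂ, 1 ≤ z.re → ‖gegenbauerCauchy m m z‖ ≤ 2 := fun z hz => by
    simpa using norm_gegenbauerCauchy_le hm m one_pos hz
  rcases le_or_gt 1 ζ.re with h1 | h1
  · linarith [hlarge ζ h1]
  set S : Set ℂ := {z | 0 < z.re} ∩ {z | z.im = ζ.im} with hS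
  have hSc : Convex ℝ S := by
    refine (convex_halfSpace_re_gt 0).inter ?_
    exact convex_hyperplane (f := Complex.im) ⟨fun _ _ => rfl, fun _ _ => by simp⟩ _
  set w : ℂ := ⟨1, ζ.im⟩
  have hmv := hSc.norm_image_sub_le_of_norm_hasDerivWithin_le (f := gegenbauerCauchy m m) (C := D)
    (fun x hx => (hasDerivAt_gegenbauerCauchy hm m hx.1).hasDerivWithinAt) (fun x hx => by
      rw [norm_mul, norm_neg, Complex.norm_natCast]
      refine mul_le_mul_of_nonneg_left (norm_gegenbauerCauchy_succ_le hm hκ hx.1 ?_)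
        m.cast_nonneg
      rw [hx.2]; exact h) (x := w) (y := ζ) ⟨by simp [w], by simp [w]⟩ ⟨hζ, rfl⟩
  have hdist : ‖ζ - w‖ ≤ 1 := by
    have : ζ - w = ((ζ.re - 1 : ℝ) : ℂ) := by apply Complex.ext <;> simp [w]
    rw [this, Complex.norm_real, Real.norm_eq_abs, abs_le]
    constructor <;> linarith
  have h2 := hlarge w (by simp [w])
  have h3 := norm_sub_norm_le (gegenbauerCauchy m m ζ) (gegenbauerCauchy m m w)
  nlinarith

/-- For `η = tan φ` the closed form of `J_{m+1}` gives `d/dφ J_m(tan φ) = -c cos^{m-1} φ`, with `c =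
m` times the mass. So `J_m(tan φ) + c ∫₀^φ cos^{m-1}` is constant. As `φ → π/2` the first term
vanishes and the second tends to `π`; as `φ → 0` the integral vanishes. -/
theorem tendsto_gegenbauerCauchy_ofReal {m : ℕ} (hm : 1 ≤ m) :
    Filter.Tendsto (fun η : ℝ => gegenbauerCauchy m m η) (nhdsWithin 0 (Set.Ioi 0))
      (nhds (Real.pi : ℂ)) := by
  set c : ℝ := m * gegenbauerMass m with hc
  set Q : ℝ → ℂ := fun φ => gegenbauerCauchy m m (Real.tan φ : ℝ) +
    ((c * ∫ x in (0 : ℝ)..φ, Real.cos x ^ (m - 1) : ℝ) : ℂ) with hQ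
  set R := Set.Ioo 0 (Real.pi / 2)
  have hder : ∀ φ ∈ R, HasDerivAt Q 0 φ := by
    intro φ hφ
    have hcos : 0 < Real.cos φ := by
      have hφ' : φ ∈ Set.Ioo (-(Real.pi / 2)) (Real.pi / 2) :=
        ⟨by linarith [hφ.1, Real.pi_pos], hφ.2⟩
      exact Real.cos_pos_of_mem_Ioo hφ'
    have htan : 0 < Real.tan φ := Real.tan_pos_of_pos_of_lt_pi_div_two hφ.1 hφ.2
    have h1 := (hasDerivAt_gegenbauerCauchy hm m (ζ := (Real.tan φ : ℝ)) (by rwa [Complex.ofReal_re]))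
    have h2 := h1.comp φ (Real.hasDerivAt_tan hcos.ne').ofReal_comp
    have h3 : HasDerivAt (fun φ => c * ∫ x in (0 : ℝ)..φ, Real.cos x ^ (m - 1))
        (c * Real.cos φ ^ (m - 1)) φ := by
      refine HasDerivAt.const_mul c ?_
      exact intervalIntegral.integral_hasDerivAt_right
        ((Real.continuous_cos.pow _).intervalIntegrable _ _)
        (Continuous.stronglyMeasurableAtFilter (by fun_prop) _ _) (by fun_prop)
    refine (h2.add h3.ofReal_comp).congr_deriv ?_
    rw [gegenbauerCauchy_succ_eq hm (by rwa [Complex.ofReal_re]) (by simp)]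
    have h4 : 1 + ((Real.tan φ : ℝ) : ℂ) ^ 2 = (((Real.cos φ ^ 2)⁻¹ : ℝ) : ℂ) := by
      rw [Real.tan_eq_sin_div_cos]
      have := Real.sin_sq_add_cos_sq φ
      have h5 : 1 + (Real.sin φ / Real.cos φ) ^ 2 = (Real.cos φ ^ 2)⁻¹ := by
        field_simp; linarith
      rw [← h5]; push_cast; ring
    have h6 : ((Real.cos φ ^ 2)⁻¹) ^ (-(((m : ℝ) + 1) / 2)) = Real.cos φ ^ (m - 1) * Real.cos φ ^ 2 := by
      rw [Real.inv_rpow (by positivity), Real.rpow_neg (by positivity), inv_inv,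
        ← Real.rpow_natCast (Real.cos φ) 2, ← Real.rpow_mul hcos.le, Real.rpow_natCast, ← pow_add,
        ← Real.rpow_natCast]
      congr 1
      push_cast [Nat.cast_sub hm]
      ring
    have h7 : (1 + ((Real.tan φ : ℝ) : ℂ) ^ 2) ^ (-(((m : ℝ) + 1) / 2 : ℝ) : ℂ) =
        ((Real.cos φ ^ (m - 1) * Real.cos φ ^ 2 : ℝ) : ℂ) := by
      rw [h4, ← h6, Complex.ofReal_cpow (by positivity)]
      push_cast
      rfl
    rw [h7, hc]
    have : (Real.cos φ : ℂ) ≠ 0 := by exact_mod_cast hcos.ne'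
    push_cast at this ⊢
    field_simp
    ring
  have hconst : ∀ x ∈ R, ∀ y ∈ R, Q x = Q y := fun x hx y hy =>
    isOpen_Ioo.is_const_of_deriv_eq_zero isPreconnected_Ioo
      (fun x hx => (hder x hx).differentiableAt.differentiableWithinAt)
      (fun x hx => (hder x hx).deriv) hx hy
  have hcont : Continuous fun φ : ℝ => ((c * ∫ x in (0 : ℝ)..φ, Real.cos x ^ (m - 1) : ℝ) : ℂ) := by
    refine Complex.continuous_ofReal.comp (continuous_const.mul ?_)
    exact intervalIntegral.continuous_primitive
      (fun a b => (Real.continuous_cos.pow (m - 1)).intervalIntegrable a b) 0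
  have hright : Filter.Tendsto Q (nhdsWithin (Real.pi / 2) (Set.Iio (Real.pi / 2)))
      (nhds (Real.pi : ℂ)) := by
    have h1 : Filter.Tendsto (fun φ : ℝ => gegenbauerCauchy m m (Real.tan φ : ℝ))
        (nhdsWithin (Real.pi / 2) (Set.Iio (Real.pi / 2))) (nhds 0) := by
      have h2 : Filter.Tendsto (fun η : ℝ => gegenbauerCauchy m m η) Filter.atTop (nhds 0) := by
        refine squeeze_zero_norm' (a := fun η : ℝ => 2 * (η ^ m)⁻¹) ?_ ?_
        · filter_upwards [Filter.eventually_gt_atTop 0] with η hη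
          exact norm_gegenbauerCauchy_le hm m hη (by simp)
        · have := ((Filter.tendsto_pow_atTop (α := ℝ) (by omega : m ≠ 0)).inv_tendsto_atTop).const_mul 2
          simpa using this
      exact h2.comp Real.tendsto_tan_pi_div_two
    have h3 := h1.add (hcont.continuousWithinAt (s := Set.Iio (Real.pi / 2)) (x := Real.pi / 2))
    simp only [zero_add] at h3
    rw [hc, mul_gegenbauerMass_mul_integral_cos_pow hm] at h3
    exact h3
  have hQc : ∀ x ∈ R, Q x = Real.pi := by
    intro x hx
    refine tendsto_nhds_unique ?_ hright
    refine tendsto_const_nhds.congr' ?_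
    have : R ∈ nhdsWithin (Real.pi / 2) (Set.Iio (Real.pi / 2)) :=
      Ioo_mem_nhdsLT (by linarith [Real.pi_pos])
    filter_upwards [this] with y hy using hconst x hx y hy
  have hleft : Filter.Tendsto (fun φ : ℝ => gegenbauerCauchy m m (Real.tan φ : ℝ))
      (nhdsWithin 0 (Set.Ioi 0)) (nhds (Real.pi : ℂ)) := by
    have h1 := (hcont.continuousWithinAt (s := Set.Ioi 0) (x := 0)).tendsto.const_sub (Real.pi : ℂ)
    simp only [intervalIntegral.integral_same, mul_zero, Complex.ofReal_zero, sub_zero] at h1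
    refine h1.congr' ?_
    have : R ∈ nhdsWithin (0 : ℝ) (Set.Ioi 0) := Ioo_mem_nhdsGT (by linarith [Real.pi_pos])
    filter_upwards [this] with y hy
    rw [← hQc y hy, hQ]
    simp
  have harc : Filter.Tendsto Real.arctan (nhdsWithin 0 (Set.Ioi 0)) (nhdsWithin 0 (Set.Ioi 0)) := by
    refine tendsto_nhdsWithin_iff.2 ⟨?_, ?_⟩
    · simpa using (Real.continuous_arctan.continuousWithinAt (s := Set.Ioi 0) (x := 0)).tendsto
    · filter_upwards [self_mem_nhdsWithin] with x hx using Real.arctan_pos.2 hx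
  refine (hleft.comp harc).congr fun η => ?_
  rw [Function.comp_apply, Real.tan_arctan]

/-- On the segment `ζ = iσ`, `|σ| < 1`, the number `1 + ζ² = 1 - σ²` is positive, so the boundary
values of `J_{m+1}` are real. Since `∂_σ Re J_m(η + iσ) = m Im J_{m+1}(η + iσ)` tends to zero
boundedly, the limit does not depend on `s` and equals the one at `s = 0`. -/
theorem tendsto_gegenbauerCauchy_re {m : ℕ} (hm : 1 ≤ m) {s : ℝ} (hs : |s| < 1) :
    Filter.Tendsto (fun η : ℝ => (gegenbauerCauchy m m (η + s * Complex.I)).re)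
      (nhdsWithin 0 (Set.Ioi 0)) (nhds Real.pi) := by
  set κ := 1 - |s| with hκdef
  have hκ : 0 < κ := by linarith
  have him : ∀ σ ∈ Set.uIcc 0 s, |σ| ≤ 1 - κ := by
    intro σ hσ
    have := Set.abs_sub_left_of_mem_uIcc hσ
    simpa [hκdef] using this
  have hF : ∀ η : ℝ, 0 < η → ∫ σ in (0 : ℝ)..s, (m : ℝ) * (gegenbauerCauchy m (m + 1) (η + σ * Complex.I)).im
      = (gegenbauerCauchy m m (η + s * Complex.I)).re - (gegenbauerCauchy m m η).re := by
    intro η hη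
    have hd : ∀ σ : ℝ, HasDerivAt (fun σ : ℝ => (gegenbauerCauchy m m (η + σ * Complex.I)).re)
        (m * (gegenbauerCauchy m (m + 1) (η + σ * Complex.I)).im) σ := by
      intro σ
      have h1 := hasDerivAt_gegenbauerCauchy hm m (ζ := η + σ * Complex.I) (by simpa using hη)
      have h2 : HasDerivAt (fun σ : ℝ => (η : ℂ) + σ * Complex.I) Complex.I σ := by
        simpa using ((Complex.ofRealCLM.hasDerivAt (x := σ)).mul_const Complex.I).const_add (η : ℂ)
      have h3 := Complex.reCLM.hasFDerivAt.comp_hasDerivAt σ (h1.comp σ h2)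
      refine h3.congr_deriv ?_
      simp
    have hc : Continuous fun σ : ℝ => (m : ℝ) * (gegenbauerCauchy m (m + 1) (η + σ * Complex.I)).im := by
      refine continuous_const.mul (Complex.continuous_im.comp ?_)
      refine continuous_iff_continuousAt.2 fun σ => ?_
      have h1 := (hasDerivAt_gegenbauerCauchy hm (m + 1) (ζ := η + σ * Complex.I)
        (by simpa using hη)).continuousAt
      exact ContinuousAt.comp (f := fun σ : ℝ => (η : ℂ) + σ * Complex.I) h1 (by fun_prop)
    rw [intervalIntegral.integral_eq_sub_of_hasDerivAt (fun σ _ => hd σ) (hc.intervalIntegrable _ _)]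
    simp
  have hlim : Filter.Tendsto (fun η : ℝ => ∫ σ in (0 : ℝ)..s,
      (m : ℝ) * (gegenbauerCauchy m (m + 1) (η + σ * Complex.I)).im) (nhdsWithin 0 (Set.Ioi 0))
      (nhds (∫ σ in (0 : ℝ)..s, (0 : ℝ))) := by
    refine intervalIntegral.tendsto_integral_filter_of_dominated_convergence
      (fun _ => (m : ℝ) * (gegenbauerMass m * κ ^ (-(((m : ℝ) + 1) / 2)))) ?_ ?_
      intervalIntegrable_const ?_
    · filter_upwards [self_mem_nhdsWithin] with η hη
      refine Continuous.aestronglyMeasurable ?_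
      refine continuous_const.mul (Complex.continuous_im.comp ?_)
      refine continuous_iff_continuousAt.2 fun σ => ?_
      have h1 := (hasDerivAt_gegenbauerCauchy hm (m + 1) (ζ := η + σ * Complex.I)
        (by simpa using hη)).continuousAt
      exact ContinuousAt.comp (f := fun σ : ℝ => (η : ℂ) + σ * Complex.I) h1 (by fun_prop)
    · filter_upwards [self_mem_nhdsWithin] with η hη
      refine Filter.Eventually.of_forall fun σ hσ => ?_
      rw [norm_mul, Real.norm_natCast]
      refine mul_le_mul_of_nonneg_left ((Complex.abs_im_le_norm _).trans ?_) m.cast_nonneg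
      exact norm_gegenbauerCauchy_succ_le hm hκ (by simpa using hη)
        (by simpa using him σ (Set.uIoc_subset_uIcc hσ))
    · refine Filter.Eventually.of_forall fun σ hσ => ?_
      have hσ1 : |σ| < 1 := by linarith [him σ (Set.uIoc_subset_uIcc hσ)]
      have h1 : Filter.Tendsto (fun η : ℝ => ((gegenbauerMass m : ℂ) * (1 + ((η : ℂ) + σ * Complex.I) ^ 2) ^
          (-(((m : ℝ) + 1) / 2 : ℝ) : ℂ)).im) (nhdsWithin 0 (Set.Ioi 0))
          (nhds (((gegenbauerMass m : ℂ) * (1 + (((0 : ℝ) : ℂ) + σ * Complex.I) ^ 2) ^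
          (-(((m : ℝ) + 1) / 2 : ℝ) : ℂ)).im)) := by
        refine (ContinuousAt.tendsto ?_).mono_left nhdsWithin_le_nhds
        refine Complex.continuous_im.continuousAt.comp (continuousAt_const.mul ?_)
        refine ContinuousAt.cpow (by fun_prop) continuousAt_const ?_
        exact one_add_sq_mem_slitPlane (by simpa using hσ1)
      have h2 : ((gegenbauerMass m : ℂ) * (1 + (((0 : ℝ) : ℂ) + σ * Complex.I) ^ 2) ^
          (-(((m : ℝ) + 1) / 2 : ℝ) : ℂ)).im = 0 := by
        have h3 : 0 ≤ 1 - σ ^ 2 := by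
          have := (sq_lt_one_iff_abs_lt_one σ).2 hσ1
          linarith
        rw [show 1 + (((0 : ℝ) : ℂ) + σ * Complex.I) ^ 2 = ((1 - σ ^ 2 : ℝ) : ℂ) by
          push_cast; linear_combination (σ : ℂ) ^ 2 * Complex.I_sq, ← Complex.ofReal_neg,
          ← Complex.ofReal_cpow h3, ← Complex.ofReal_mul, Complex.ofReal_im]
      rw [h2] at h1
      have h4 := h1.const_mul (m : ℝ)
      rw [mul_zero] at h4
      refine h4.congr' ?_
      filter_upwards [self_mem_nhdsWithin] with η hη
      rw [gegenbauerCauchy_succ_eq hm (by simpa using hη) (by simpa using hσ1)]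
  have h0 : Filter.Tendsto (fun η : ℝ => (gegenbauerCauchy m m η).re) (nhdsWithin 0 (Set.Ioi 0))
      (nhds Real.pi) := by
    exact (Complex.continuous_re.tendsto _).comp (tendsto_gegenbauerCauchy_ofReal hm)
  have h5 := hlim.add h0
  rw [intervalIntegral.integral_zero, zero_add] at h5
  refine h5.congr' ?_
  filter_upwards [self_mem_nhdsWithin] with η hη
  rw [hF η hη]
  ring

/-! ### The Newton potential and Poisson's equation -/

section NewtonPotential

open Set Metric Filter Topology

variable {E : Type*} [NormedAddCommGroup E] [InnerProductSpace ℝ E]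

/-- The derivative in the direction `v`. -/
noncomputable def dirDeriv (v : E) (f : E → ℝ) (x : E) : ℝ := fderiv ℝ f x v

theorem ContDiff.dirDeriv {f : E → ℝ} (hf : ContDiff ℝ ∞ f) (v : E) :
    ContDiff ℝ ∞ (dirDeriv v f) :=
  (hf.fderiv_right (m := ∞) (by simp)).clm_apply contDiff_const

theorem tsupport_dirDeriv_subset (f : E → ℝ) (v : E) : tsupport (dirDeriv v f) ⊆ tsupport f := by
  refine closure_minimal (fun x hx => ?_) (isClosed_tsupport f)
  refine support_fderiv_subset ℝ (f := f) ?_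
  rw [Function.mem_support] at hx ⊢
  rintro h
  exact hx (by simp [dirDeriv, h])

theorem HasCompactSupport.dirDeriv {f : E → ℝ} (hf : HasCompactSupport f) (v : E) :
    HasCompactSupport (dirDeriv v f) :=
  hf.isCompact.of_isClosed_subset (isClosed_tsupport _) (tsupport_dirDeriv_subset f v)

theorem hasCompactSupport_sum_dirDeriv {ι : Type*} [Fintype ι] (b : ι → E) {f : E → ℝ}
    (hf : HasCompactSupport f) :
    HasCompactSupport fun y => ∑ i, _root_.dirDeriv (b i) (_root_.dirDeriv (b i) f) y := by
  refine HasCompactSupport.intro hf.isCompact fun x hx => Finset.sum_eq_zero fun i _ => ?_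
  refine image_eq_zero_of_notMem_tsupport fun h => hx ?_
  exact tsupport_dirDeriv_subset _ _ (tsupport_dirDeriv_subset _ _ h)

theorem hasFDerivAt_norm_sq_add_rpow {ε : ℝ} (hε : 0 < ε) (a : ℝ) (y : E) :
    HasFDerivAt (fun y : E => (‖y‖ ^ 2 + ε) ^ a)
      ((a * (‖y‖ ^ 2 + ε) ^ (a - 1)) • (2 • (innerSL ℝ y))) y := by
  have h1 : HasFDerivAt (fun y : E => ‖y‖ ^ 2 + ε) (2 • (innerSL ℝ y)) y :=
    (hasStrictFDerivAt_norm_sq y).hasFDerivAt.add_const _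
  exact h1.rpow_const (Or.inl (by positivity))

variable [FiniteDimensional ℝ E] [MeasurableSpace E] [BorelSpace E]

theorem locallyIntegrable_inv_norm_pow {k : ℕ} (hk : k < Module.finrank ℝ E) :
    LocallyIntegrable (fun y : E => (‖y‖ ^ k)⁻¹) volume := by
  have : Nontrivial E := Module.nontrivial_of_finrank_pos (R := ℝ) (by omega)
  intro x
  refine ⟨ball 0 (‖x‖ + 1), isOpen_ball.mem_nhds (by simp), ?_⟩
  rw [integrableOn_fun_norm_addHaar volume (f := fun r : ℝ => (r ^ k)⁻¹)]
  have h1 : IntegrableOn (fun r : ℝ => r ^ (Module.finrank ℝ E - 1 - k)) (Ioo 0 (‖x‖ + 1)) :=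
    (((continuous_pow (M := ℝ) _).integrableOn_Icc (a := (0 : ℝ)) (b := ‖x‖ + 1))).mono_set
      Ioo_subset_Icc_self
  refine h1.congr_fun (fun r hr => ?_) measurableSet_Ioo
  have hr0 : r ≠ 0 := hr.1.ne'
  have : Module.finrank ℝ E - 1 = (Module.finrank ℝ E - 1 - k) + k := by omega
  simp only [smul_eq_mul]
  nth_rw 2 [this]
  rw [pow_add, mul_assoc, mul_inv_cancel₀ (pow_ne_zero _ hr0), mul_one]

theorem integral_dirDeriv_eq_neg {f g : E → ℝ} (hf : ContDiff ℝ ∞ f) (hg : ContDiff ℝ ∞ g)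
    (hgc : HasCompactSupport g) (v : E) :
    ∫ x, f x * dirDeriv v g x = - ∫ x, dirDeriv v f x * g x := by
  refine integral_mul_fderiv_eq_neg_fderiv_mul_of_integrable (f := f) (g := g) ?_ ?_ ?_ ?_ ?_
  · exact Continuous.integrable_of_hasCompactSupport ((hf.dirDeriv v).continuous.mul hg.continuous)
      hgc.mul_left
  · exact Continuous.integrable_of_hasCompactSupport (hf.continuous.mul (hg.dirDeriv v).continuous)
      (hgc.dirDeriv v).mul_left
  · exact Continuous.integrable_of_hasCompactSupport (hf.continuous.mul hg.continuous)
      hgc.mul_left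
  · exact fun x _ => (hf.differentiable (by simp)).differentiableAt
  · exact fun x _ => (hg.differentiable (by simp)).differentiableAt

/-- One integration by parts in each basis direction. The regularized kernel has the radial gradient
`-2a (‖y‖² + ε)^{-a-1} y`, so the sum over the basis is the Euler derivative of `G`. -/
theorem integral_sum_dirDeriv_mul_regularized {ι : Type*} [Fintype ι] (b : OrthonormalBasis ι ℝ E) {G : E → ℝ}
    (hG : ContDiff ℝ ∞ G) (hGc : HasCompactSupport G) {ε : ℝ} (hε : 0 < ε) (a : ℝ) :
    ∫ y, (∑ i, dirDeriv (b i) (dirDeriv (b i) G) y) * (‖y‖ ^ 2 + ε) ^ (-a) =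
      2 * a * ∫ y, fderiv ℝ G y y * (‖y‖ ^ 2 + ε) ^ (-a - 1) := by
  set Γ : E → ℝ := fun y => (‖y‖ ^ 2 + ε) ^ (-a) with hΓ
  have hpos : ∀ y : E, ‖y‖ ^ 2 + ε ≠ 0 := fun y => by positivity
  have hsm : ∀ c : ℝ, ContDiff ℝ ∞ fun y : E => (‖y‖ ^ 2 + ε) ^ c := fun c =>
    ((contDiff_norm_sq ℝ).add contDiff_const).rpow_const_of_ne hpos
  have hΓs : ContDiff ℝ ∞ Γ := hsm _
  have hd : ∀ v y, dirDeriv v Γ y = -(2 * a) * (‖y‖ ^ 2 + ε) ^ (-a - 1) * inner ℝ y v := by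
    intro v y
    rw [dirDeriv, (hasFDerivAt_norm_sq_add_rpow hε (-a) y).fderiv]
    simp
    ring
  have hi : ∀ i, Integrable fun y => Γ y * dirDeriv (b i) (dirDeriv (b i) G) y := fun i =>
    Continuous.integrable_of_hasCompactSupport
      (hΓs.continuous.mul ((hG.dirDeriv _).dirDeriv _).continuous) ((hGc.dirDeriv _).dirDeriv _).mul_left
  have hi2 : ∀ i, Integrable fun y => dirDeriv (b i) Γ y * dirDeriv (b i) G y := fun i =>
    Continuous.integrable_of_hasCompactSupport
      ((hΓs.dirDeriv _).continuous.mul (hG.dirDeriv _).continuous) (hGc.dirDeriv _).mul_left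
  calc ∫ y, (∑ i, dirDeriv (b i) (dirDeriv (b i) G) y) * (‖y‖ ^ 2 + ε) ^ (-a)
      = ∫ y, ∑ i, Γ y * dirDeriv (b i) (dirDeriv (b i) G) y := by
        refine integral_congr_ae (Eventually.of_forall fun y => ?_)
        exact (mul_comm _ _).trans (Finset.mul_sum _ _ _)
    _ = ∑ i, - ∫ y, dirDeriv (b i) Γ y * dirDeriv (b i) G y := by
        rw [integral_finsetSum _ fun i _ => hi i]
        exact Finset.sum_congr rfl fun i _ =>
          integral_dirDeriv_eq_neg hΓs (hG.dirDeriv _) (hGc.dirDeriv _) _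
    _ = ∫ y, (2 * a) * (fderiv ℝ G y y * (‖y‖ ^ 2 + ε) ^ (-a - 1)) := by
        rw [Finset.sum_neg_distrib, ← integral_finsetSum _ fun i _ => hi2 i, ← integral_neg]
        refine integral_congr_ae (Eventually.of_forall fun y => ?_)
        have : fderiv ℝ G y y = ∑ i, inner ℝ y (b i) * dirDeriv (b i) G y := by
          conv_lhs => rw [← b.sum_repr' y]
          simp only [map_sum, map_smul, smul_eq_mul, dirDeriv]
          rw [b.sum_repr' y]
          exact Finset.sum_congr rfl fun i _ => by rw [real_inner_comm]
        simp only [hd]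
        rw [this, Finset.sum_mul, Finset.mul_sum, ← Finset.sum_neg_distrib]
        exact Finset.sum_congr rfl fun i _ => by ring
    _ = _ := integral_const_mul _ _

/-- The regularized kernel increases to the singular one, so the limit integrand itself dominates.
-/
theorem tendsto_integral_regularized [Nontrivial E] {n : ℕ} {H : E → ℝ} (hH : Continuous H)
    (hi : Integrable fun y => H y * (‖y‖ ^ n)⁻¹) :
    Tendsto (fun ε : ℝ => ∫ y, H y * (‖y‖ ^ 2 + ε) ^ (-((n : ℝ) / 2))) (𝓝[>] 0)
      (𝓝 (∫ y, H y * (‖y‖ ^ n)⁻¹)) := by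
  have hp : ∀ y : E, (‖y‖ ^ n)⁻¹ = (‖y‖ ^ 2) ^ (-((n : ℝ) / 2)) := fun y => by
    rw [Real.rpow_neg (by positivity), ← Real.rpow_natCast ‖y‖ 2, ← Real.rpow_mul (norm_nonneg _),
      ← Real.rpow_natCast]
    congr 2
    push_cast; ring
  have hne : ∀ᵐ y : E, y ≠ 0 := by
    rw [ae_iff]; simp
  refine tendsto_integral_filter_of_dominated_convergence (fun y => ‖H y * (‖y‖ ^ n)⁻¹‖) ?_ ?_ hi.norm ?_
  · filter_upwards [self_mem_nhdsWithin] with ε hε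
    refine Continuous.aestronglyMeasurable (hH.mul (Continuous.rpow_const (by fun_prop) fun y => ?_))
    left
    have : 0 < ε := hε
    positivity
  · filter_upwards [self_mem_nhdsWithin] with ε hε
    filter_upwards [hne] with y hy
    have : 0 < ε := hε
    have hy' : 0 < ‖y‖ := norm_pos_iff.2 hy
    rw [norm_mul, norm_mul, Real.norm_of_nonneg (r := _ ^ _) (by positivity),
      Real.norm_of_nonneg (r := (_)⁻¹) (by positivity), hp]
    refine mul_le_mul_of_nonneg_left ?_ (norm_nonneg _)
    refine Real.rpow_le_rpow_of_nonpos (by positivity) (by linarith) ?_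
    have : (0 : ℝ) ≤ n := n.cast_nonneg
    linarith
  · filter_upwards [hne] with y hy
    have hy' : 0 < ‖y‖ := norm_pos_iff.2 hy
    rw [hp]
    refine Tendsto.const_mul _ ?_
    have h1 : Tendsto (fun ε : ℝ => ‖y‖ ^ 2 + ε) (𝓝[>] 0) (𝓝 (‖y‖ ^ 2)) := by
      have : Tendsto (fun ε : ℝ => ‖y‖ ^ 2 + ε) (𝓝 0) (𝓝 (‖y‖ ^ 2 + 0)) :=
        (continuous_const.add continuous_id).tendsto 0
      rw [add_zero] at this
      exact this.mono_left nhdsWithin_le_nhds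
    exact h1.rpow_const (Or.inl (by positivity))

/-- In polar coordinates all powers of `r` cancel, and the integral along each ray is that of `d/dr
G(ru)` over `(0, ∞)`, which is `-G 0`. -/
theorem integral_fderiv_self_mul_inv_norm_pow {G : E → ℝ} (hn : 1 ≤ Module.finrank ℝ E)
    (hG : ContDiff ℝ ∞ G) (hGc : HasCompactSupport G)
    (hi : Integrable fun y => fderiv ℝ G y y * (‖y‖ ^ Module.finrank ℝ E)⁻¹) :
    ∫ y, fderiv ℝ G y y * (‖y‖ ^ Module.finrank ℝ E)⁻¹ =
      - (volume : Measure E).toSphere.real univ * G 0 := by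
  have : Nontrivial E := Module.nontrivial_of_finrank_pos (R := ℝ) (by omega)
  rw [integral_polar volume hi]
  have : ∀ u : sphere (0 : E) 1, ∫ r in Ioi (0 : ℝ), r ^ (Module.finrank ℝ E - 1) *
      (fderiv ℝ G (r • (u : E)) (r • (u : E)) * (‖r • (u : E)‖ ^ Module.finrank ℝ E)⁻¹) = - G 0 := by
    intro u
    have hu : ‖(u : E)‖ = 1 := norm_eq_of_mem_sphere u
    have hline : ContDiff ℝ 1 fun r : ℝ => G (r • (u : E)) :=
      (hG.of_le (by simp)).comp (contDiff_id.smul contDiff_const)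
    have hcs : HasCompactSupport fun r : ℝ => G (r • (u : E)) := by
      refine hGc.comp_isClosedEmbedding ?_
      exact isClosedEmbedding_smul_left (fun h => by rw [h, norm_zero] at hu; exact zero_ne_one hu)
    have h1 := hcs.integral_Ioi_deriv_eq hline 0
    rw [zero_smul] at h1
    rw [← h1]
    refine setIntegral_congr_fun measurableSet_Ioi fun r hr => ?_
    have hr' : 0 < r := hr
    have hd : HasDerivAt (fun r : ℝ => G (r • (u : E))) (fderiv ℝ G (r • (u : E)) u) r := by
      have h2 := (hG.differentiable (by simp)).differentiableAt (x := r • (u : E)) |>.hasFDerivAt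
      have h3 : HasDerivAt (fun r : ℝ => r • (u : E)) (u : E) r := by
        simpa using (hasDerivAt_id r).smul_const (u : E)
      exact h2.comp_hasDerivAt r h3
    rw [hd.deriv, map_smul, norm_smul, hu, mul_one, Real.norm_of_nonneg hr'.le, smul_eq_mul]
    obtain ⟨k, hk⟩ : ∃ k, Module.finrank ℝ E = k + 1 := ⟨Module.finrank ℝ E - 1, by omega⟩
    rw [hk, Nat.add_sub_cancel]
    field_simp
    ring
  simp only [this, integral_const, smul_eq_mul]
  ring

/-- Limit `ε → 0` of the regularized identity with `a = (n - 2)/2`, so that `2a = n - 2` and the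
exponent on the right is `-n/2`. The Euler derivative supplies a factor `‖y‖`, which makes
`‖y‖^{-n}` integrable against it. -/
theorem integral_sum_dirDeriv_mul_newton {ι : Type*} [Fintype ι] (b : OrthonormalBasis ι ℝ E)
    (hn : 3 ≤ Module.finrank ℝ E) {G : E → ℝ} (hG : ContDiff ℝ ∞ G) (hGc : HasCompactSupport G) :
    ∫ y, (∑ i, dirDeriv (b i) (dirDeriv (b i) G) y) * (‖y‖ ^ (Module.finrank ℝ E - 2))⁻¹ =
      -((Module.finrank ℝ E : ℝ) - 2) * (volume : Measure E).toSphere.real univ * G 0 := by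
  have : Nontrivial E := Module.nontrivial_of_finrank_pos (R := ℝ) (by omega)
  set n := Module.finrank ℝ E with hndef
  have hcs : HasCompactSupport fun y => ∑ i, dirDeriv (b i) (dirDeriv (b i) G) y :=
    hasCompactSupport_sum_dirDeriv b hGc
  have hc : Continuous fun y => ∑ i, dirDeriv (b i) (dirDeriv (b i) G) y :=
    continuous_finsetSum _ fun i _ => ((hG.dirDeriv _).dirDeriv _).continuous
  have hcd : Continuous fun y => fderiv ℝ G y :=
    (hG.fderiv_right (m := ∞) (by simp)).continuous
  have hi1 : Integrable fun y => (∑ i, dirDeriv (b i) (dirDeriv (b i) G) y) * (‖y‖ ^ (n - 2))⁻¹ := by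
    have := (locallyIntegrable_inv_norm_pow (E := E) (k := n - 2) (by omega)).integrable_smul_left_of_hasCompactSupport hc hcs
    simpa using this
  have hi2 : Integrable fun y => fderiv ℝ G y y * (‖y‖ ^ n)⁻¹ := by
    have h1 := (locallyIntegrable_inv_norm_pow (E := E) (k := n - 1) (by omega)).integrable_smul_left_of_hasCompactSupport
      hcd.norm (hGc.fderiv (𝕜 := ℝ)).norm
    refine h1.mono' ?_ (Eventually.of_forall fun y => ?_)
    · refine ((hcd.clm_apply continuous_id).measurable.mul ?_).aestronglyMeasurable
      exact (measurable_norm.pow_const _).inv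
    · rw [norm_mul, smul_eq_mul, norm_inv, norm_pow, norm_norm]
      rcases eq_or_ne y 0 with rfl | hy
      · simp
        positivity
      · have hy' : 0 < ‖y‖ := norm_pos_iff.2 hy
        calc ‖fderiv ℝ G y y‖ * (‖y‖ ^ n)⁻¹ ≤ ‖fderiv ℝ G y‖ * ‖y‖ * (‖y‖ ^ n)⁻¹ := by
              gcongr
              exact (fderiv ℝ G y).le_opNorm y
          _ = ‖fderiv ℝ G y‖ * (‖y‖ ^ (n - 1))⁻¹ := by
              obtain ⟨k, hk⟩ : ∃ k, n = k + 1 := ⟨n - 1, by omega⟩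
              rw [hk, Nat.add_sub_cancel]
              field_simp
              ring
  have l1 := tendsto_integral_regularized hc hi1
  have l2 := (tendsto_integral_regularized (hcd.clm_apply continuous_id) hi2).const_mul ((n : ℝ) - 2)
  have he : ∀ᶠ ε : ℝ in 𝓝[>] 0, ((n : ℝ) - 2) * ∫ y, fderiv ℝ G y y * (‖y‖ ^ 2 + ε) ^ (-((n : ℝ) / 2)) =
      ∫ y, (∑ i, dirDeriv (b i) (dirDeriv (b i) G) y) * (‖y‖ ^ 2 + ε) ^ (-(((n - 2 : ℕ) : ℝ) / 2)) := by
    filter_upwards [self_mem_nhdsWithin] with ε hε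
    rw [integral_sum_dirDeriv_mul_regularized b hG hGc hε]
    rw [Nat.cast_sub (by omega), Nat.cast_ofNat]
    rw [show -(((n : ℝ) - 2) / 2) - 1 = -((n : ℝ) / 2) by ring]
    ring
  have := tendsto_nhds_unique l1 (l2.congr' he)
  rw [this]
  have h4 := integral_fderiv_self_mul_inv_norm_pow (by omega) hG hGc hi2
  simp only [id]
  rw [h4]
  ring

/-- The Newton potential `z ↦ ∫ g(t) |z - t|^{2-n} dt`, where `n` is the dimension. -/
noncomputable def newtonPotential (g : E → ℝ) (z : E) : ℝ :=
  ∫ t, g t * (‖z - t‖ ^ (Module.finrank ℝ E - 2))⁻¹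

theorem newtonPotential_eq_convolution (g : E → ℝ) :
    newtonPotential g = convolution g (fun y : E => (‖y‖ ^ (Module.finrank ℝ E - 2))⁻¹)
      (ContinuousLinearMap.mul ℝ ℝ) volume := rfl

theorem contDiff_newtonPotential (hn : 3 ≤ Module.finrank ℝ E) {g : E → ℝ} (hg : ContDiff ℝ ∞ g)
    (hgc : HasCompactSupport g) : ContDiff ℝ ∞ (newtonPotential g) := by
  rw [newtonPotential_eq_convolution]
  exact hgc.contDiff_convolution_left _ hg (locallyIntegrable_inv_norm_pow (by omega))

theorem dirDeriv_newtonPotential (hn : 3 ≤ Module.finrank ℝ E) {g : E → ℝ} (hg : ContDiff ℝ ∞ g)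
    (hgc : HasCompactSupport g) (v : E) :
    dirDeriv v (newtonPotential g) = newtonPotential (dirDeriv v g) := by
  have hl := locallyIntegrable_inv_norm_pow (E := E) (k := Module.finrank ℝ E - 2) (by omega)
  ext z
  have h1 := hgc.hasFDerivAt_convolution_left (ContinuousLinearMap.mul ℝ ℝ)
    (hg.of_le (by simp)) hl z
  rw [dirDeriv, newtonPotential_eq_convolution, h1.fderiv, convolution_def,
    ContinuousLinearMap.integral_apply]
  · rfl
  · exact (hgc.fderiv (𝕜 := ℝ)).convolutionExists_left _
      (hg.fderiv_right (m := ∞) (by simp)).continuous hl z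

omit [MeasurableSpace E] [BorelSpace E] in
theorem laplacian_eq_sum_dirDeriv {ι : Type*} [Fintype ι] (b : OrthonormalBasis ι ℝ E) {f : E → ℝ}
    (hf : ContDiff ℝ ∞ f) (x : E) :
    Laplacian.laplacian f x = ∑ i, dirDeriv (b i) (dirDeriv (b i) f) x := by
  rw [InnerProductSpace.laplacian_eq_iteratedFDeriv_orthonormalBasis f b]
  refine Finset.sum_congr rfl fun i _ => ?_
  rw [iteratedFDeriv_two_apply]
  have h1 : DifferentiableAt ℝ (fderiv ℝ f) x :=
    ((hf.fderiv_right (m := ∞) (by simp)).differentiable (by simp)).differentiableAt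
  have h2 : dirDeriv (b i) f = fun y => fderiv ℝ f y (b i) := rfl
  rw [dirDeriv, h2, fderiv_clm_apply h1 (differentiableAt_const _)]
  simp

omit [FiniteDimensional ℝ E] [MeasurableSpace E] [BorelSpace E] in
theorem dirDeriv_comp_const_sub {f : E → ℝ} (hf : Differentiable ℝ f) (v z : E) :
    dirDeriv v (fun y => f (z - y)) = fun y => - dirDeriv v f (z - y) := by
  ext y
  have h : HasFDerivAt (fun y => f (z - y)) ((fderiv ℝ f (z - y)).comp (-ContinuousLinearMap.id ℝ E)) y :=
    (hf (z - y)).hasFDerivAt.comp y ((hasFDerivAt_id y).const_sub z)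
  rw [dirDeriv, h.fderiv]
  simp [dirDeriv]

/-- The Newton potential solves the Poisson equation. -/
theorem laplacian_newtonPotential (hn : 3 ≤ Module.finrank ℝ E) {g : E → ℝ} (hg : ContDiff ℝ ∞ g)
    (hgc : HasCompactSupport g) (z : E) :
    Laplacian.laplacian (newtonPotential g) z =
      -((Module.finrank ℝ E : ℝ) - 2) * (volume : Measure E).toSphere.real univ * g z := by
  set b := stdOrthonormalBasis ℝ E
  have hl := locallyIntegrable_inv_norm_pow (E := E) (k := Module.finrank ℝ E - 2) (by omega)
  rw [laplacian_eq_sum_dirDeriv b (contDiff_newtonPotential hn hg hgc)]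
  have h1 : ∀ i, dirDeriv (b i) (dirDeriv (b i) (newtonPotential g)) z =
      ∫ y, dirDeriv (b i) (dirDeriv (b i) g) (z - y) * (‖y‖ ^ (Module.finrank ℝ E - 2))⁻¹ := by
    intro i
    rw [dirDeriv_newtonPotential hn hg hgc, dirDeriv_newtonPotential hn (hg.dirDeriv _) (hgc.dirDeriv _),
      newtonPotential, ← integral_sub_left_eq_self _ _ z]
    simp
  have hG : ContDiff ℝ ∞ fun y => g (z - y) := hg.comp (contDiff_const.sub contDiff_id)
  have hGc : HasCompactSupport fun y => g (z - y) :=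
    hgc.comp_homeomorph (Homeomorph.subLeft z)
  -- Applied to the reflected translate `y ↦ g (z - y)`, whose value at `0` is `g z`; the reflection
  -- changes the sign of each first derivative, hence not of the second ones.
  have h2 := integral_sum_dirDeriv_mul_newton b hn hG hGc
  rw [sub_zero] at h2
  rw [← h2]
  simp only [h1]
  have h3 : ∀ i y, dirDeriv (b i) (dirDeriv (b i) fun y => g (z - y)) y =
      dirDeriv (b i) (dirDeriv (b i) g) (z - y) := by
    intro i y
    have h4 : dirDeriv (b i) (fun y => g (z - y)) = fun y => -(dirDeriv (b i) g (z - y)) :=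
      dirDeriv_comp_const_sub (hg.differentiable (by simp)) (b i) z
    rw [h4, dirDeriv, fderiv_fun_neg]
    have h5 := congrFun (dirDeriv_comp_const_sub ((hg.dirDeriv (b i)).differentiable (by simp)) (b i) z) y
    rw [dirDeriv] at h5
    rw [_root_.neg_apply, h5, neg_neg]
  rw [← integral_finsetSum]
  · simp only [h3, Finset.sum_mul]
  · intro i _
    have h5 : Continuous fun y => dirDeriv (b i) (dirDeriv (b i) g) (z - y) :=
      ((hg.dirDeriv _).dirDeriv _).continuous.comp (continuous_const.sub continuous_id)
    have h6 : HasCompactSupport fun y => dirDeriv (b i) (dirDeriv (b i) g) (z - y) :=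
      ((hgc.dirDeriv _).dirDeriv _).comp_homeomorph (Homeomorph.subLeft z)
    exact hl.integrable_smul_left_of_hasCompactSupport h5 h6

end NewtonPotential

/-! ### Section measures and the spherical mean as a density -/

section SectionIntegrals

open Set Metric

variable {n : ℕ}

theorem norm_coe_sph (x : Sph n) : ‖(x : EuclideanSpace ℝ (Fin (n + 1)))‖ = 1 :=
  norm_eq_of_mem_sphere x

theorem inner_perp (x : Sph n) (u : perp x) :
    inner ℝ (x : EuclideanSpace ℝ (Fin (n + 1))) (u : EuclideanSpace ℝ (Fin (n + 1))) = 0 :=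
  Submodule.mem_orthogonal_singleton_iff_inner_right.1 u.2

theorem finrank_perp (x : Sph n) : Module.finrank ℝ (perp x) = n := by
  have := finrank_span_orthogonal (norm_coe_sph x)
  rw [finrank_euclideanSpace, Fintype.card_fin] at this
  exact Nat.succ_injective this

theorem norm_smul_add_sqrt_smul {V : Type*} [NormedAddCommGroup V] [InnerProductSpace ℝ V]
    {e w : V} (he : ‖e‖ = 1) (hw : ‖w‖ = 1) (h : inner ℝ e w = 0) {t : ℝ} (ht : t ^ 2 ≤ 1) :
    ‖t • e + Real.sqrt (1 - t ^ 2) • w‖ = 1 := by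
  have h0 : inner ℝ (t • e) (Real.sqrt (1 - t ^ 2) • w) = 0 := by
    rw [inner_smul_left, inner_smul_right, h, mul_zero, mul_zero]
  have h1 := norm_add_sq_eq_norm_sq_add_norm_sq_of_inner_eq_zero _ _ h0
  rw [norm_smul, norm_smul, he, hw, mul_one, mul_one, Real.norm_eq_abs, Real.norm_eq_abs,
    abs_mul_abs_self, abs_mul_abs_self, Real.mul_self_sqrt (by linarith)] at h1
  nlinarith [norm_nonneg (t • e + Real.sqrt (1 - t ^ 2) • w)]

theorem norm_sectionPoint (x : Sph n) {t : ℝ} (ht : t ^ 2 ≤ 1) (u : sphere (0 : perp x) 1) :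
    ‖sectionPoint x t u‖ = 1 :=
  norm_smul_add_sqrt_smul (norm_coe_sph x) (norm_eq_of_mem_sphere u) (inner_perp x u) ht

theorem inner_sectionPoint (x : Sph n) (t : ℝ) (u : sphere (0 : perp x) 1) :
    inner ℝ (x : EuclideanSpace ℝ (Fin (n + 1))) (sectionPoint x t u) = t := by
  rw [sectionPoint, inner_add_right, inner_smul_right, inner_smul_right, inner_perp,
    real_inner_self_eq_norm_sq, norm_coe_sph]
  ring

theorem continuous_sectionPoint (x : Sph n) (t : ℝ) : Continuous (sectionPoint x t) := by
  unfold sectionPoint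
  fun_prop

/-- The section point as a point of the sphere. -/
noncomputable def sectionSph (x : Sph n) {t : ℝ} (ht : t ^ 2 ≤ 1) (u : sphere (0 : perp x) 1) :
    Sph n := ⟨sectionPoint x t u, by simpa using norm_sectionPoint x ht u⟩

theorem continuous_sectionSph (x : Sph n) {t : ℝ} (ht : t ^ 2 ≤ 1) :
    Continuous (sectionSph x ht) := (continuous_sectionPoint x t).subtype_mk _

/-- For `t² ≤ 1` the map `sectionPoint` takes values in the sphere, so the `comap` merely undoes the
inclusion. -/
theorem sectionMeasure_eq (x : Sph n) {t : ℝ} (ht : t ^ 2 ≤ 1) :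
    sectionMeasure x t = ENNReal.ofReal (Real.sqrt (1 - t ^ 2) ^ (n - 1)) •
      (volume : Measure (perp x)).toSphere.map (sectionSph x ht) := by
  have hs := (continuous_sectionSph x ht).measurable
  rw [sectionMeasure, Measure.comap_smul]
  congr 1
  have h1 : (volume : Measure (perp x)).toSphere.map (sectionPoint x t) =
      ((volume : Measure (perp x)).toSphere.map (sectionSph x ht)).map Subtype.val := by
    rw [Measure.map_map measurable_subtype_coe hs]
    rfl
  rw [h1, (MeasurableEmbedding.subtype_coe isClosed_sphere.measurableSet).comap_map]

theorem sectionMeasure_eq_zero (hn : 2 ≤ n) (x : Sph n) {t : ℝ} (ht : 1 ≤ t ^ 2) :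
    sectionMeasure x t = 0 := by
  rw [sectionMeasure, Real.sqrt_eq_zero_of_nonpos (by linarith), zero_pow (by omega),
    ENNReal.ofReal_zero, zero_smul]
  exact Measure.comap_zero _

theorem integral_sectionMeasure (x : Sph n) {t : ℝ} (ht : t ^ 2 ≤ 1) {F : Sph n → ℝ}
    (hF : Measurable F) :
    ∫ y, F y ∂(sectionMeasure x t) = Real.sqrt (1 - t ^ 2) ^ (n - 1) *
      ∫ u, F (sectionSph x ht u) ∂(volume : Measure (perp x)).toSphere := by
  rw [sectionMeasure_eq x ht, integral_smul_measure, integral_map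
    (continuous_sectionSph x ht).measurable.aemeasurable hF.aestronglyMeasurable,
    ENNReal.toReal_ofReal (by positivity), smul_eq_mul]

/-- The extension of a function on the sphere that is constant along rays (and zero at the
origin). -/
noncomputable def radialExtension (f : Sph n → ℝ) (v : EuclideanSpace ℝ (Fin (n + 1))) : ℝ :=
  Function.extend Subtype.val f 0 (‖v‖⁻¹ • v)

theorem radialExtension_of_norm_eq_one (f : Sph n → ℝ) {v : EuclideanSpace ℝ (Fin (n + 1))}
    (hv : ‖v‖ = 1) : radialExtension f v = f ⟨v, by simpa using hv⟩ := by
  have h1 : ‖v‖⁻¹ • v = v := by rw [hv, inv_one, one_smul]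
  rw [radialExtension, h1]
  exact Subtype.val_injective.extend_apply f 0 ⟨v, by simpa using hv⟩

theorem radialExtension_coe (f : Sph n → ℝ) (x : Sph n) : radialExtension f x = f x :=
  radialExtension_of_norm_eq_one f (norm_coe_sph x)

theorem measurable_radialExtension {f : Sph n → ℝ} (hf : Measurable f) :
    Measurable (radialExtension f) := by
  have h := (MeasurableEmbedding.subtype_coe (isClosed_sphere (x :=
    (0 : EuclideanSpace ℝ (Fin (n + 1)))) (ε := 1)).measurableSet).measurable_extend hf
    (g' := 0) measurable_zero
  exact h.comp (measurable_norm.inv.smul measurable_id)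

/-- Composition of `f` with the smooth retraction `v ↦ v / ‖v‖`. It turns smoothness on the manifold
into ordinary smoothness on an open set of `ℝ^{n+1}`. -/
theorem contDiffOn_radialExtension {f : Sph n → ℝ} (hf : ContMDiff (𝓡 n) 𝓘(ℝ, ℝ) ∞ f) :
    ContDiffOn ℝ ∞ (radialExtension f) {0}ᶜ := by
  have := Fact.mk (@finrank_euclideanSpace_fin ℝ _ (n + 1))
  let U : TopologicalSpace.Opens (EuclideanSpace ℝ (Fin (n + 1))) := ⟨{0}ᶜ, isOpen_compl_singleton⟩
  have hne : ∀ v : U, (v : EuclideanSpace ℝ (Fin (n + 1))) ≠ 0 := fun v => v.2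
  have hmem : ∀ v : U, ‖(v : EuclideanSpace ℝ (Fin (n + 1)))‖⁻¹ • (v : EuclideanSpace ℝ (Fin (n + 1))) ∈
      sphere (0 : EuclideanSpace ℝ (Fin (n + 1))) 1 := fun v => by
    rw [mem_sphere_zero_iff_norm, norm_smul, norm_inv, norm_norm,
      inv_mul_cancel₀ (norm_ne_zero_iff.2 (hne v))]
  have h1 : ContMDiff 𝓘(ℝ, EuclideanSpace ℝ (Fin (n + 1))) 𝓘(ℝ, EuclideanSpace ℝ (Fin (n + 1))) ∞
      (fun v : U => ‖(v : EuclideanSpace ℝ (Fin (n + 1)))‖⁻¹ • (v : EuclideanSpace ℝ (Fin (n + 1)))) := by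
    intro v
    have h2 : ContDiffAt ℝ ∞ (fun v : EuclideanSpace ℝ (Fin (n + 1)) => ‖v‖⁻¹ • v) v :=
      ((contDiffAt_norm ℝ (hne v)).inv (norm_ne_zero_iff.2 (hne v))).smul contDiffAt_id
    exact contMDiffAt_subtype_iff.2 h2.contMDiffAt
  have h3 := hf.comp (ContMDiff.codRestrict_sphere (n := n) h1 hmem)
  intro v hv
  have h4 : ContMDiffAt 𝓘(ℝ, EuclideanSpace ℝ (Fin (n + 1))) 𝓘(ℝ, ℝ) ∞ (radialExtension f) v := by
    refine contMDiffAt_subtype_iff (U := U) (x := ⟨v, hv⟩) |>.1 ?_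
    refine (h3 ⟨v, hv⟩).congr_of_eventuallyEq (Filter.Eventually.of_forall fun w => ?_)
    exact Subtype.val_injective.extend_apply f 0 ⟨_, hmem w⟩
  exact h4.contDiffAt.contDiffWithinAt

theorem sphereArea_pos (hn : 1 ≤ n) : 0 < sphereArea n := by
  have : (0 : ℝ) < n := by exact_mod_cast hn
  have := Real.Gamma_pos_of_pos (s := (n : ℝ) / 2) (by positivity)
  rw [sphereArea]
  positivity

theorem toSphere_real_univ {V : Type*} [NormedAddCommGroup V] [InnerProductSpace ℝ V]
    [MeasurableSpace V] [BorelSpace V] [FiniteDimensional ℝ V] (hn : 1 ≤ n)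
    (h : Module.finrank ℝ V = n) :
    (volume : Measure V).toSphere.real univ = sphereArea n := by
  have : Nontrivial V := Module.nontrivial_of_finrank_pos (R := ℝ) (by omega)
  have hn' : (0 : ℝ) < n := by exact_mod_cast hn
  rw [Measure.toSphere_real_apply_univ, measureReal_def, InnerProductSpace.volume_ball, h, sphereArea]
  rw [ENNReal.ofReal_one, one_pow, one_mul, ENNReal.toReal_ofReal]
  · rw [Real.Gamma_add_one (by positivity), Real.sqrt_eq_rpow, ← Real.rpow_natCast,
      ← Real.rpow_mul Real.pi_pos.le]
    have := (Real.Gamma_pos_of_pos (s := (n : ℝ) / 2) (by positivity)).ne'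
    rw [show 1 / 2 * (n : ℝ) = n / 2 by ring]
    field_simp
  · have := Real.Gamma_pos_of_pos (s := (n : ℝ) / 2 + 1) (by positivity)
    positivity

/-- The normalization `(1 - t²)^{(1-n)/2}` cancels the radius power in the section measure. -/
theorem weighted_sphericalMean_eq {f : Sph n → ℝ} (hn : 1 ≤ n) (hf : Measurable f) (ξ : Sph n) {t : ℝ}
    (ht : t ^ 2 < 1) :
    weighted (sphericalMean f) ξ t = (sphereArea n)⁻¹ * ((1 - t ^ 2) ^ ((n : ℝ) / 2 - 1) *
      ∫ u, radialExtension f (sectionPoint ξ t u) ∂(volume : Measure (perp ξ)).toSphere) := by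
  have hpos : 0 < 1 - t ^ 2 := by linarith
  rw [weighted, sphericalMean, integral_sectionMeasure ξ ht.le hf]
  have h1 : ∀ u, radialExtension f (sectionPoint ξ t u) = f (sectionSph ξ ht.le u) := fun u =>
    radialExtension_coe f (sectionSph ξ ht.le u)
  simp only [h1]
  have h2 : (1 - t ^ 2) ^ ((1 - (n : ℝ)) / 2) * Real.sqrt (1 - t ^ 2) ^ (n - 1) = 1 := by
    rw [Real.sqrt_eq_rpow, ← Real.rpow_natCast _ (n - 1), ← Real.rpow_mul hpos.le, ← Real.rpow_add hpos,
      Nat.cast_sub hn]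
    rw [show (1 - (n : ℝ)) / 2 + 1 / 2 * ((n : ℝ) - (1 : ℕ)) = 0 by push_cast; ring, Real.rpow_zero]
  linear_combination ((sphereArea n)⁻¹ * (1 - t ^ 2) ^ ((n : ℝ) / 2 - 1) *
    ∫ u, f (sectionSph ξ ht.le u) ∂(volume : Measure (perp ξ)).toSphere) * h2

theorem weighted_sphericalMean_eq_zero (hn : 2 ≤ n) (f : Sph n → ℝ) (ξ : Sph n) {t : ℝ}
    (ht : 1 ≤ t ^ 2) : weighted (sphericalMean f) ξ t = 0 := by
  rw [weighted, sphericalMean, sectionMeasure_eq_zero hn ξ ht]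
  simp

/-- The weighted spherical mean is, up to `σ_{n-1}`, the density of the image of `f dσ` under
`y ↦ ξ · y`. -/
theorem integral_weighted_sphericalMean_mul {f : Sph n → ℝ} (hn : 2 ≤ n) (hf : Continuous f) (ξ : Sph n)
    {φ : ℝ → ℝ} (hφ : Continuous φ) :
    ∫ t, weighted (sphericalMean f) ξ t * φ t = (sphereArea n)⁻¹ *
      ∫ v : Sph n, f v * φ (inner ℝ (ξ : EuclideanSpace ℝ (Fin (n + 1))) (v : EuclideanSpace ℝ (Fin (n + 1))))
        ∂(volume : Measure (EuclideanSpace ℝ (Fin (n + 1)))).toSphere := by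
  obtain ⟨d, rfl⟩ : ∃ d, n = d + 1 := ⟨n - 1, by omega⟩
  have hs := integral_toSphere_slice (norm_coe_sph ξ) (d := d) (by simp)
    (G := fun v => radialExtension f v * φ (inner ℝ (ξ : EuclideanSpace ℝ (Fin (d + 1 + 1))) v))
    ((measurable_radialExtension hf.measurable).mul (by fun_prop)) (by
      refine Continuous.integrable_of_hasCompactSupport ?_ (HasCompactSupport.of_compactSpace _)
      simp only [radialExtension_coe]
      fun_prop)
  simp only [radialExtension_coe] at hs
  rw [hs, ← integral_const_mul]
  have h0 : ∫ t, weighted (sphericalMean f) ξ t * φ t =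
      ∫ t in Ioo (-1 : ℝ) 1, weighted (sphericalMean f) ξ t * φ t := by
    refine (setIntegral_eq_integral_of_forall_compl_eq_zero fun t ht => ?_).symm
    rw [weighted_sphericalMean_eq_zero hn, zero_mul]
    by_contra hh
    have := (sq_lt_one_iff_abs_lt_one t).1 (not_le.1 hh)
    exact ht (abs_lt.1 this)
  rw [h0]
  refine setIntegral_congr_fun measurableSet_Ioo fun t ht => ?_
  have ht2 : t ^ 2 < 1 := (sq_lt_one_iff_abs_lt_one t).2 (abs_lt.2 ht)
  rw [weighted_sphericalMean_eq (by omega) hf.measurable ξ ht2]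
  have h1 : ∀ u : sphere (0 : perp ξ) 1, inner ℝ (ξ : EuclideanSpace ℝ (Fin (d + 1 + 1)))
      (t • (ξ : EuclideanSpace ℝ (Fin (d + 1 + 1))) + Real.sqrt (1 - t ^ 2) •
        ((u : perp ξ) : EuclideanSpace ℝ (Fin (d + 1 + 1)))) = t := inner_sectionPoint ξ t
  simp only [h1]
  -- The weight exponent `n/2 - 1` is exactly the exponent `(d - 1)/2` of the slice density, as `n =
  -- d + 1`.
  rw [integral_mul_const, show (((d + 1 : ℕ) : ℝ) / 2 - 1) = ((d : ℝ) - 1) / 2 by push_cast; ring]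
  simp only [sectionPoint]
  ring

end SectionIntegrals

/-! ### Differentiation of integrals over a compact space, with uniform bounds -/

section ParametricIntegrals

open Set Metric Filter Topology

variable {X U K : Type*} [NormedAddCommGroup X] [NormedSpace ℝ X] [NormedAddCommGroup U]
  [NormedSpace ℝ U]

/-- The partial derivative in the middle variable. -/
noncomputable def partialMid (Ψ : X × ℝ × U → ℝ) (p : X × ℝ × U) : ℝ := fderiv ℝ Ψ p (0, 1, 0)

theorem ContDiffOn.partialMid {Ψ : X × ℝ × U → ℝ} {Ω : Set (X × ℝ × U)} (hΩ : IsOpen Ω)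
    (h : ContDiffOn ℝ ∞ Ψ Ω) : ContDiffOn ℝ ∞ (partialMid Ψ) Ω :=
  (h.fderiv_of_isOpen hΩ (m := ∞) (by simp)).clm_apply contDiffOn_const

theorem ContDiffOn.iterate_partialMid {Ψ : X × ℝ × U → ℝ} {Ω : Set (X × ℝ × U)} (hΩ : IsOpen Ω)
    (h : ContDiffOn ℝ ∞ Ψ Ω) (j : ℕ) : ContDiffOn ℝ ∞ (_root_.partialMid^[j] Ψ) Ω := by
  induction j generalizing Ψ with
  | zero => exact h
  | succ j ih => exact ih (h.partialMid hΩ)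

variable [TopologicalSpace K] [CompactSpace K] [MeasurableSpace K] [OpensMeasurableSpace K]
  (μ : Measure K) [IsFiniteMeasure μ] {κ : K → U} (hκ : Continuous κ)
  {Ω : Set (X × ℝ × U)} (hΩ : IsOpen Ω) {P : Set X} {I : Set ℝ} (hI : IsOpen I)
  (hsub : ∀ x ∈ P, ∀ t ∈ I, ∀ k, (x, t, κ k) ∈ Ω)

include hκ hΩ hI hsub

/-- A closed ball around `t` times `K` is compact, so the partial derivative is bounded there. The
variable `x` is only a parameter, carried along so that later bounds are uniform over a compact `P`.
-/
theorem hasDerivAt_integral_partialMid {Ψ : X × ℝ × U → ℝ} (h : ContDiffOn ℝ ∞ Ψ Ω) {x : X}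
    (hx : x ∈ P) {t : ℝ} (ht : t ∈ I) :
    HasDerivAt (fun t => ∫ k, Ψ (x, t, κ k) ∂μ) (∫ k, partialMid Ψ (x, t, κ k) ∂μ) t := by
  obtain ⟨δ, hδ, hball⟩ := nhds_basis_closedBall.mem_iff.1 (hI.mem_nhds ht)
  have hc : ∀ {Φ : X × ℝ × U → ℝ}, ContDiffOn ℝ ∞ Φ Ω → ∀ t ∈ I, Continuous fun k => Φ (x, t, κ k) :=
    fun hΦ t ht => hΦ.continuousOn.comp_continuous (by fun_prop) fun k => hsub x hx t ht k
  have hd := h.partialMid hΩ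
  have hc2 : ContinuousOn (fun p : ℝ × K => partialMid Ψ (x, p.1, κ p.2)) (closedBall t δ ×ˢ univ) :=
    hd.continuousOn.comp (by fun_prop) fun p hp => hsub x hx p.1 (hball hp.1) p.2
  obtain ⟨C, hC⟩ := ((isCompact_closedBall t δ).prod isCompact_univ).exists_bound_of_continuousOn hc2
  refine (hasDerivAt_integral_of_dominated_loc_of_deriv_le (bound := fun _ => C)
    (F := fun t k => Ψ (x, t, κ k)) (F' := fun t k => partialMid Ψ (x, t, κ k))
    (closedBall_mem_nhds t hδ) ?_ ?_ ?_ ?_ ?_ ?_).2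
  · filter_upwards [closedBall_mem_nhds t hδ] with s hs
    exact (hc h s (hball hs)).aestronglyMeasurable
  · exact (hc h t ht).integrable_of_hasCompactSupport (HasCompactSupport.of_compactSpace _)
  · exact (hc hd t ht).aestronglyMeasurable
  · exact Eventually.of_forall fun k s hs => hC (s, k) ⟨hs, mem_univ _⟩
  · exact integrable_const _
  · refine Eventually.of_forall fun k s hs => ?_
    have h1 : HasFDerivAt Ψ (fderiv ℝ Ψ (x, s, κ k)) (x, s, κ k) :=
      ((h.contDiffAt (hΩ.mem_nhds (hsub x hx s (hball hs) k))).differentiableAt (by simp)).hasFDerivAt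
    have h2 : HasDerivAt (fun s : ℝ => (x, s, κ k)) ((0 : X), (1 : ℝ), (0 : U)) s :=
      (hasDerivAt_const s x).prodMk ((hasDerivAt_id s).prodMk (hasDerivAt_const s (κ k)))
    exact h1.comp_hasDerivAt s h2

theorem iteratedDeriv_integral_partialMid {Ψ : X × ℝ × U → ℝ} (h : ContDiffOn ℝ ∞ Ψ Ω) {x : X}
    (hx : x ∈ P) (j : ℕ) : EqOn (iteratedDeriv j fun t => ∫ k, Ψ (x, t, κ k) ∂μ)
      (fun t => ∫ k, partialMid^[j] Ψ (x, t, κ k) ∂μ) I := by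
  induction j generalizing Ψ with
  | zero => intro t _; simp
  | succ j ih =>
    intro t ht
    rw [iteratedDeriv_succ', Function.iterate_succ]
    have h1 : deriv (fun t => ∫ k, Ψ (x, t, κ k) ∂μ) =ᶠ[𝓝 t]
        fun t => ∫ k, partialMid Ψ (x, t, κ k) ∂μ := by
      filter_upwards [hI.mem_nhds ht] with s hs
      exact (hasDerivAt_integral_partialMid μ hκ hΩ hI hsub h hx hs).deriv
    rw [h1.iteratedDeriv_eq]
    exact ih (h.partialMid hΩ) ht

theorem contDiffOn_integral_partialMid {Ψ : X × ℝ × U → ℝ} (h : ContDiffOn ℝ ∞ Ψ Ω) {x : X}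
    (hx : x ∈ P) : ContDiffOn ℝ ∞ (fun t => ∫ k, Ψ (x, t, κ k) ∂μ) I := by
  rw [contDiffOn_infty]
  intro j
  induction j generalizing Ψ with
  | zero =>
    rw [Nat.cast_zero, contDiffOn_zero]
    exact fun t ht => (hasDerivAt_integral_partialMid μ hκ hΩ hI hsub h hx ht).continuousAt.continuousWithinAt
  | succ j ih =>
    rw [Nat.cast_succ, contDiffOn_succ_iff_deriv_of_isOpen hI]
    refine ⟨fun t ht => (hasDerivAt_integral_partialMid μ hκ hΩ hI hsub h hx
      ht).differentiableAt.differentiableWithinAt, by simp, ?_⟩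
    exact (ih (h.partialMid hΩ)).congr fun t ht =>
      (hasDerivAt_integral_partialMid μ hκ hΩ hI hsub h hx ht).deriv

/-- The derivative is the integral of a function jointly continuous on the compact set `P × [a, b] ×
K`. -/
theorem exists_abs_iteratedDeriv_integral_le {Ψ : X × ℝ × U → ℝ} (h : ContDiffOn ℝ ∞ Ψ Ω)
    (hP : IsCompact P) {a b : ℝ} (hab : Icc a b ⊆ I) (j : ℕ) :
    ∃ C, ∀ x ∈ P, ∀ t ∈ Icc a b, |iteratedDeriv j (fun t => ∫ k, Ψ (x, t, κ k) ∂μ) t| ≤ C := by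
  have hc : ContinuousOn (fun p : X × ℝ × K => partialMid^[j] Ψ (p.1, p.2.1, κ p.2.2))
      (P ×ˢ Icc a b ×ˢ univ) :=
    (h.iterate_partialMid hΩ j).continuousOn.comp (by fun_prop)
      fun p hp => hsub p.1 hp.1 p.2.1 (hab hp.2.1) p.2.2
  obtain ⟨C, hC⟩ := (hP.prod (isCompact_Icc.prod isCompact_univ)).exists_bound_of_continuousOn hc
  refine ⟨C * μ.real univ, fun x hx t ht => ?_⟩
  rw [iteratedDeriv_integral_partialMid μ hκ hΩ hI hsub h hx j (hab ht)]
  exact norm_integral_le_of_norm_le_const (Eventually.of_forall fun k => hC (x, t, k) ⟨hx, ht, mem_univ _⟩)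

end ParametricIntegrals

/-! ### Smoothness of the weighted mean, uniformly in the centre -/

section WeightedMeanSmooth

open Set Metric Filter Topology

variable {n : ℕ}

/-- The isometry `x^⊥ ≃ ξ^⊥` induced by the reflection that exchanges `x` and `-ξ`. -/
noncomputable def perpIsometry (x ξ : Sph n) (h : dot x ξ ≠ -1) : perp x ≃ₗᵢ[ℝ] perp ξ :=
  LinearIsometry.toLinearIsometryEquiv
    { toLinearMap := LinearMap.codRestrict (perp ξ)
        ((perp x).subtype - ((1 + dot x ξ)⁻¹ • ((innerₛₗ ℝ (ξ : EuclideanSpace ℝ (Fin (n + 1)))).comp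
          (perp x).subtype)).smulRight ((x : EuclideanSpace ℝ (Fin (n + 1))) + ξ)) (by
          intro u
          have hne : 1 + dot x ξ ≠ 0 := fun hh => h (by linarith)
          rw [Submodule.mem_orthogonal_singleton_iff_inner_right]
          simp only [LinearMap.sub_apply, LinearMap.smulRight_apply, LinearMap.smul_apply,
            LinearMap.comp_apply, Submodule.subtype_apply, innerₛₗ_apply_apply, smul_eq_mul]
          have h1 : inner ℝ (ξ : EuclideanSpace ℝ (Fin (n + 1))) (x : EuclideanSpace ℝ (Fin (n + 1))) =
              dot x ξ := real_inner_comm _ _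
          rw [inner_sub_right, inner_smul_right, inner_add_right, real_inner_self_eq_norm_sq,
            norm_coe_sph, h1]
          field_simp
          ring)
      norm_map' := by
        intro u
        have hne : 1 + dot x ξ ≠ 0 := fun hh => h (by linarith)
        have h1 : ‖(u : EuclideanSpace ℝ (Fin (n + 1))) - ((1 + dot x ξ)⁻¹ *
            inner ℝ (ξ : EuclideanSpace ℝ (Fin (n + 1))) (u : EuclideanSpace ℝ (Fin (n + 1)))) •
            ((x : EuclideanSpace ℝ (Fin (n + 1))) + ξ)‖ ^ 2 = ‖u‖ ^ 2 := by
          rw [norm_sub_sq_real, norm_smul, mul_pow, norm_add_sq_real, norm_coe_sph, norm_coe_sph,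
            inner_smul_right, inner_add_right, real_inner_comm _ (u : EuclideanSpace ℝ (Fin (n + 1))),
            inner_perp, real_inner_comm _ (u : EuclideanSpace ℝ (Fin (n + 1))), Real.norm_eq_abs, sq_abs]
          change _ - _ + _ * (1 ^ 2 + 2 * dot x ξ + 1 ^ 2) = ‖u‖ ^ 2
          rw [Submodule.coe_norm]
          field_simp
          ring
        exact (sq_eq_sq₀ (norm_nonneg _) (norm_nonneg _)).1 h1 }
    (by rw [finrank_perp, finrank_perp])

theorem coe_perpIsometry (x ξ : Sph n) (h : dot x ξ ≠ -1) (u : perp x) :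
    (perpIsometry x ξ h u : EuclideanSpace ℝ (Fin (n + 1))) = u - ((1 + dot x ξ)⁻¹ *
      inner ℝ (ξ : EuclideanSpace ℝ (Fin (n + 1))) (u : EuclideanSpace ℝ (Fin (n + 1)))) •
        ((x : EuclideanSpace ℝ (Fin (n + 1))) + ξ) := rfl

theorem isCompact_capBoundary (n : ℕ) (θ : ℝ) : IsCompact (capBoundary n θ) := by
  refine IsClosed.isCompact ?_
  exact isClosed_eq (by unfold dot; fun_prop) continuous_const

theorem cos_nonneg_of_le {θ : ℝ} (hθ₀ : 0 < θ) (hθ : θ ≤ Real.pi / 2) : 0 ≤ Real.cos θ :=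
  Real.cos_nonneg_of_neg_pi_div_two_le_of_le (by linarith) hθ

/-- The argument of `f` in the spherical mean, parametrized by the unit sphere of `N^⊥`. -/
noncomputable def meanArg (n : ℕ) (c : ℝ)
    (p : EuclideanSpace ℝ (Fin (n + 1)) × ℝ × EuclideanSpace ℝ (Fin (n + 1))) :
    EuclideanSpace ℝ (Fin (n + 1)) :=
  p.2.1 • p.1 + Real.sqrt (1 - p.2.1 ^ 2) • (p.2.2 - ((1 + c)⁻¹ * inner ℝ p.1 p.2.2) •
    ((north n : EuclideanSpace ℝ (Fin (n + 1))) + p.1))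

theorem continuous_meanArg (n : ℕ) (c : ℝ) : Continuous (meanArg n c) := by
  unfold meanArg
  fun_prop

theorem contDiffOn_meanArg (n : ℕ) (c : ℝ) :
    ContDiffOn ℝ ∞ (meanArg n c) {p | p.2.1 ^ 2 < 1} := by
  unfold meanArg
  have h1 : ContDiff ℝ ∞ fun p : EuclideanSpace ℝ (Fin (n + 1)) × ℝ × EuclideanSpace ℝ (Fin (n + 1)) =>
      1 - p.2.1 ^ 2 := by fun_prop
  have h2 : ContDiffOn ℝ ∞ (fun p : EuclideanSpace ℝ (Fin (n + 1)) × ℝ × EuclideanSpace ℝ (Fin (n + 1)) =>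
      Real.sqrt (1 - p.2.1 ^ 2)) {p | p.2.1 ^ 2 < 1} :=
    h1.contDiffOn.sqrt fun p hp => by
      have : p.2.1 ^ 2 < 1 := hp
      exact (by linarith : (0 : ℝ) < 1 - p.2.1 ^ 2).ne'
  have h3 : ContDiff ℝ ∞ fun p : EuclideanSpace ℝ (Fin (n + 1)) × ℝ × EuclideanSpace ℝ (Fin (n + 1)) =>
      p.2.2 - ((1 + c)⁻¹ * inner ℝ p.1 p.2.2) •
    ((north n : EuclideanSpace ℝ (Fin (n + 1))) + p.1) :=
    contDiff_snd.snd.sub ((contDiff_const.mul (contDiff_fst.inner ℝ contDiff_snd.snd)).smul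
      (contDiff_const.add contDiff_fst))
  have h4 : ContDiff ℝ ∞ fun p : EuclideanSpace ℝ (Fin (n + 1)) × ℝ × EuclideanSpace ℝ (Fin (n + 1)) =>
      p.2.1 • p.1 := by fun_prop
  exact h4.contDiffOn.add (h2.smul h3.contDiffOn)

/-- The integrand of the weighted spherical mean over the unit sphere of `N^⊥`. -/
noncomputable def meanIntegrand (f : Sph n → ℝ) (c : ℝ)
    (p : EuclideanSpace ℝ (Fin (n + 1)) × ℝ × EuclideanSpace ℝ (Fin (n + 1))) : ℝ :=
  (sphereArea n)⁻¹ * ((1 - p.2.1 ^ 2) ^ ((n : ℝ) / 2 - 1) * radialExtension f (meanArg n c p))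

theorem isOpen_meanDomain (n : ℕ) (c : ℝ) :
    IsOpen ({p | p.2.1 ^ 2 < 1} ∩ {p | meanArg n c p ≠ 0}) :=
  (isOpen_lt (by fun_prop) continuous_const).inter
    (isOpen_ne_fun (continuous_meanArg n c) continuous_const)

theorem contDiffOn_meanIntegrand {f : Sph n → ℝ} (hf : ContMDiff (𝓡 n) 𝓘(ℝ, ℝ) ∞ f) (c : ℝ) :
    ContDiffOn ℝ ∞ (meanIntegrand f c) ({p | p.2.1 ^ 2 < 1} ∩ {p | meanArg n c p ≠ 0}) := by
  have h1 : ContDiffOn ℝ ∞ (fun p : EuclideanSpace ℝ (Fin (n + 1)) × ℝ × EuclideanSpace ℝ (Fin (n + 1)) =>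
      (1 - p.2.1 ^ 2) ^ ((n : ℝ) / 2 - 1)) ({p | p.2.1 ^ 2 < 1} ∩ {p | meanArg n c p ≠ 0}) := by
    refine ContDiffOn.rpow_const_of_ne (by fun_prop) fun p hp => ?_
    have : p.2.1 ^ 2 < 1 := hp.1
    exact (by linarith : (0 : ℝ) < 1 - p.2.1 ^ 2).ne'
  refine contDiffOn_const.mul (h1.mul ?_)
  exact (contDiffOn_radialExtension hf).comp ((contDiffOn_meanArg n c).mono inter_subset_left)
    fun p hp => hp.2

theorem meanArg_eq {θ : ℝ} {ξ : Sph n} (hξ : ξ ∈ capBoundary n θ) (h : dot (north n) ξ ≠ -1)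
    (t : ℝ) (u : sphere (0 : perp (north n)) 1) :
    meanArg n (Real.cos θ) (ξ, t, ((u : perp (north n)) : EuclideanSpace ℝ (Fin (n + 1)))) =
      t • (ξ : EuclideanSpace ℝ (Fin (n + 1))) + Real.sqrt (1 - t ^ 2) •
        (perpIsometry (north n) ξ h u : EuclideanSpace ℝ (Fin (n + 1))) := by
  have h1 : dot (north n) ξ = Real.cos θ := by
    rw [← hξ, dot, dot, real_inner_comm]
  rw [coe_perpIsometry, h1]
  rfl

theorem dot_north_ne {θ : ℝ} (hθ₀ : 0 < θ) (hθ : θ ≤ Real.pi / 2) {ξ : Sph n}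
    (hξ : ξ ∈ capBoundary n θ) : dot (north n) ξ ≠ -1 := by
  have h1 : dot (north n) ξ = Real.cos θ := by
    rw [← hξ, dot, dot, real_inner_comm]
  rw [h1]
  linarith [cos_nonneg_of_le hθ₀ hθ]

/-- For `x` on the cap boundary the argument is a unit vector, hence nonzero; this is where the
radial extension is smooth. -/
theorem meanArg_mem {θ : ℝ} (hθ₀ : 0 < θ) (hθ : θ ≤ Real.pi / 2)
    (x : EuclideanSpace ℝ (Fin (n + 1))) (hx : x ∈ Subtype.val '' capBoundary n θ) (t : ℝ)
    (ht : t ∈ Ioo (-1 : ℝ) 1) (u : sphere (0 : perp (north n)) 1) :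
    (x, t, ((u : perp (north n)) : EuclideanSpace ℝ (Fin (n + 1)))) ∈
      ({p | p.2.1 ^ 2 < 1} ∩ {p | meanArg n (Real.cos θ) p ≠ 0}) := by
  obtain ⟨ξ, hξ, rfl⟩ := hx
  have ht2 : t ^ 2 < 1 := (sq_lt_one_iff_abs_lt_one t).2 (abs_lt.2 ht)
  refine ⟨ht2, fun h0 => ?_⟩
  rw [meanArg_eq hξ (dot_north_ne hθ₀ hθ hξ)] at h0
  have h1 := norm_smul_add_sqrt_smul (norm_coe_sph ξ)
    (w := (perpIsometry (north n) ξ (dot_north_ne hθ₀ hθ hξ) u : EuclideanSpace ℝ (Fin (n + 1))))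
    (by
      have h2 : ‖perpIsometry (north n) ξ (dot_north_ne hθ₀ hθ hξ) u‖ = 1 := by
        rw [LinearIsometryEquiv.norm_map]
        exact norm_eq_of_mem_sphere u
      exact h2) (inner_perp ξ _) ht2.le
  rw [h0, norm_zero] at h1
  exact zero_ne_one h1

/-- The reflection isometry transports the unit sphere of `ξ^⊥` to that of the orthogonal complement
of the pole, so the domain of integration no longer depends on `ξ`, which enters only through a
smooth integrand. -/
theorem weighted_eq_integral_meanIntegrand {θ : ℝ} (hθ₀ : 0 < θ) (hθ : θ ≤ Real.pi / 2) (hn : 1 ≤ n)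
    {f : Sph n → ℝ} (hf : Measurable f) {ξ : Sph n} (hξ : ξ ∈ capBoundary n θ) {t : ℝ}
    (ht : t ∈ Ioo (-1 : ℝ) 1) :
    weighted (sphericalMean f) ξ t = ∫ u : sphere (0 : perp (north n)) 1,
      meanIntegrand f (Real.cos θ) (ξ, t, ((u : perp (north n)) : EuclideanSpace ℝ (Fin (n + 1))))
        ∂(volume : Measure (perp (north n))).toSphere := by
  have ht2 : t ^ 2 < 1 := (sq_lt_one_iff_abs_lt_one t).2 (abs_lt.2 ht)
  have hne := dot_north_ne hθ₀ hθ hξ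
  rw [weighted_sphericalMean_eq hn hf ξ ht2]
  simp only [meanIntegrand, meanArg_eq hξ hne]
  rw [integral_const_mul, integral_const_mul]
  congr 2
  exact (integral_toSphere_isometry (perpIsometry (north n) ξ hne) (fun u : perp ξ =>
    radialExtension f (t • (ξ : EuclideanSpace ℝ (Fin (n + 1))) + Real.sqrt (1 - t ^ 2) •
        (u : EuclideanSpace ℝ (Fin (n + 1)))))).symm

theorem contDiffOn_weighted {θ : ℝ} (hθ₀ : 0 < θ) (hθ : θ ≤ Real.pi / 2) (hn : 1 ≤ n)
    {f : Sph n → ℝ} (hf : ContMDiff (𝓡 n) 𝓘(ℝ, ℝ) ∞ f) {ξ : Sph n} (hξ : ξ ∈ capBoundary n θ) :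
    ContDiffOn ℝ ∞ (weighted (sphericalMean f) ξ) (Ioo (-1) 1) :=
  (contDiffOn_integral_partialMid (volume : Measure (perp (north n))).toSphere
    (κ := fun u : sphere (0 : perp (north n)) 1 => ((u : perp (north n)) : EuclideanSpace ℝ (Fin (n + 1))))
    (by fun_prop) (isOpen_meanDomain n (Real.cos θ)) isOpen_Ioo (meanArg_mem hθ₀ hθ)
    (contDiffOn_meanIntegrand hf _) (mem_image_of_mem _ hξ)).congr fun _ ht =>
      weighted_eq_integral_meanIntegrand hθ₀ hθ hn hf.continuous.measurable hξ ht

theorem exists_abs_iteratedDeriv_weighted_le {θ : ℝ} (hθ₀ : 0 < θ) (hθ : θ ≤ Real.pi / 2) (hn : 1 ≤ n)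
    {f : Sph n → ℝ} (hf : ContMDiff (𝓡 n) 𝓘(ℝ, ℝ) ∞ f) {a b : ℝ} (hab : Icc a b ⊆ Ioo (-1) 1)
    (j : ℕ) : ∃ C, ∀ ξ ∈ capBoundary n θ, ∀ t ∈ Icc a b,
      |iteratedDeriv j (weighted (sphericalMean f) ξ) t| ≤ C := by
  obtain ⟨C, hC⟩ := exists_abs_iteratedDeriv_integral_le (volume : Measure (perp (north n))).toSphere
    (κ := fun u : sphere (0 : perp (north n)) 1 => ((u : perp (north n)) : EuclideanSpace ℝ (Fin (n + 1))))
    (by fun_prop) (isOpen_meanDomain n (Real.cos θ)) isOpen_Ioo (meanArg_mem hθ₀ hθ)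
    (contDiffOn_meanIntegrand hf _) ((isCompact_capBoundary n θ).image continuous_subtype_val) hab j
  refine ⟨C, fun ξ hξ t ht => ?_⟩
  rw [Filter.EventuallyEq.iteratedDeriv_eq j (g := fun t => ∫ u : sphere (0 : perp (north n)) 1,
      meanIntegrand f (Real.cos θ) (ξ, t, ((u : perp (north n)) : EuclideanSpace ℝ (Fin (n + 1))))
        ∂(volume : Measure (perp (north n))).toSphere)]
  · exact hC _ (mem_image_of_mem _ hξ) t ht
  · filter_upwards [isOpen_Ioo.mem_nhds (hab ht)] with s hs
    exact weighted_eq_integral_meanIntegrand hθ₀ hθ hn hf.continuous.measurable hξ hs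

end WeightedMeanSmooth

/-! ### The upper hemisphere as a graph, and supports -/

section Graph

open Set Metric Filter Topology

variable {n : ℕ}

/-- The isometry of `ℝ^n` with the hyperplane orthogonal to the north pole. -/
noncomputable def northIsometry (n : ℕ) : EuclideanSpace ℝ (Fin n) ≃ₗᵢ[ℝ] perp (north n) :=
  LinearIsometry.toLinearIsometryEquiv
    { toFun := fun z => ⟨WithLp.toLp 2 (Fin.snoc (α := fun _ => ℝ) z 0), by
        rw [Submodule.mem_orthogonal_singleton_iff_inner_right, north, EuclideanSpace.inner_single_left]
        simp⟩
      map_add' := fun z w => by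
        refine Subtype.ext ?_
        ext i
        refine Fin.lastCases ?_ (fun i => ?_) i <;> simp
      map_smul' := fun c z => by
        refine Subtype.ext ?_
        ext i
        refine Fin.lastCases ?_ (fun i => ?_) i <;> simp
      norm_map' := fun z => by
        refine (sq_eq_sq₀ (norm_nonneg _) (norm_nonneg _)).1 ?_
        change ‖(WithLp.toLp 2 (Fin.snoc (α := fun _ => ℝ) z 0) : EuclideanSpace ℝ (Fin (n + 1)))‖ ^ 2 = _
        rw [EuclideanSpace.norm_sq_eq, EuclideanSpace.norm_sq_eq, Fin.sum_univ_castSucc]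
        simp }
    (by rw [finrank_perp, finrank_euclideanSpace_fin])

theorem coe_northIsometry_castSucc (z : EuclideanSpace ℝ (Fin n)) (i : Fin n) :
    (northIsometry n z : EuclideanSpace ℝ (Fin (n + 1))) i.castSucc = z i := by
  change Fin.snoc (α := fun _ => ℝ) z 0 i.castSucc = z i
  simp

theorem coe_northIsometry_last (z : EuclideanSpace ℝ (Fin n)) :
    (northIsometry n z : EuclideanSpace ℝ (Fin (n + 1))) (Fin.last n) = 0 := by
  change Fin.snoc (α := fun _ => ℝ) z 0 (Fin.last n) = 0
  simp

theorem north_last : (north n : EuclideanSpace ℝ (Fin (n + 1))) (Fin.last n) = 1 := by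
  simp [north]

theorem north_castSucc (i : Fin n) : (north n : EuclideanSpace ℝ (Fin (n + 1))) i.castSucc = 0 := by
  simp [north]

theorem lift_eq (z : EuclideanSpace ℝ (Fin n)) :
    lift z = Real.sqrt (1 - ‖z‖ ^ 2) • (north n : EuclideanSpace ℝ (Fin (n + 1))) + northIsometry n z := by
  ext i
  refine Fin.lastCases ?_ (fun i => ?_) i
  · simp [coe_northIsometry_last, lift, north_last]
  · simp [coe_northIsometry_castSucc, lift, north_castSucc]

theorem dot_north (x : Sph n) : dot x (north n) = (x : EuclideanSpace ℝ (Fin (n + 1))) (Fin.last n) := by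
  rw [dot, north, EuclideanSpace.inner_single_right]
  simp

theorem coe_eq_smul_north_add (x : Sph n) : (x : EuclideanSpace ℝ (Fin (n + 1))) =
    dot x (north n) • (north n : EuclideanSpace ℝ (Fin (n + 1))) + northIsometry n (proj x) := by
  rw [dot_north]
  ext i
  refine Fin.lastCases ?_ (fun i => ?_) i
  · simp [coe_northIsometry_last, north_last]
  · simp [coe_northIsometry_castSucc, proj, north_castSucc]

theorem norm_sq_smul_north_add (a : ℝ) (p : perp (north n)) :
    ‖a • (north n : EuclideanSpace ℝ (Fin (n + 1))) + p‖ ^ 2 = a ^ 2 + ‖p‖ ^ 2 := by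
  rw [norm_add_sq_real, inner_smul_left, inner_perp, norm_smul, norm_coe_sph, mul_one, Real.norm_eq_abs,
    sq_abs, Submodule.coe_norm]
  ring

theorem inner_smul_north_add (a b : ℝ) (p q : perp (north n)) :
    inner ℝ (a • (north n : EuclideanSpace ℝ (Fin (n + 1))) + p)
      (b • (north n : EuclideanSpace ℝ (Fin (n + 1))) + q) = a * b + inner ℝ p q := by
  rw [inner_add_left, inner_add_right, inner_add_right, inner_smul_left, inner_smul_right,
    inner_smul_left, inner_perp, inner_smul_right,
    real_inner_comm _ (p : EuclideanSpace ℝ (Fin (n + 1))), inner_perp,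
    real_inner_self_eq_norm_sq, norm_coe_sph, Submodule.coe_inner]
  simp

theorem norm_sq_proj (x : Sph n) : ‖proj x‖ ^ 2 = 1 - dot x (north n) ^ 2 := by
  have := norm_sq_smul_north_add (dot x (north n)) (northIsometry n (proj x))
  rw [← coe_eq_smul_north_add, norm_coe_sph, LinearIsometryEquiv.norm_map] at this
  linarith

theorem continuous_proj : Continuous (proj : Sph n → EuclideanSpace ℝ (Fin n)) := by
  unfold proj
  fun_prop

theorem norm_lift {z : EuclideanSpace ℝ (Fin n)} (hz : ‖z‖ ≤ 1) : ‖lift z‖ = 1 := by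
  have h1 : (0 : ℝ) ≤ 1 - ‖z‖ ^ 2 := by nlinarith [norm_nonneg z]
  have := norm_sq_smul_north_add (Real.sqrt (1 - ‖z‖ ^ 2)) (northIsometry n z)
  rw [← lift_eq, Real.sq_sqrt h1, LinearIsometryEquiv.norm_map, sub_add_cancel] at this
  nlinarith [norm_nonneg (lift z)]

/-- The point of the upper hemisphere above a point of the closed unit ball. -/
noncomputable def liftSph (z : EuclideanSpace ℝ (Fin n)) (hz : ‖z‖ ≤ 1) : Sph n :=
  ⟨lift z, by simpa using norm_lift hz⟩

theorem dot_liftSph {z : EuclideanSpace ℝ (Fin n)} (hz : ‖z‖ ≤ 1) :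
    dot (liftSph z hz) (north n) = Real.sqrt (1 - ‖z‖ ^ 2) := by
  rw [dot_north]
  simp [liftSph, lift]

theorem proj_liftSph {z : EuclideanSpace ℝ (Fin n)} (hz : ‖z‖ ≤ 1) : proj (liftSph z hz) = z := by
  ext i
  simp [liftSph, lift, proj]

theorem lift_proj {x : Sph n} (hx : 0 ≤ dot x (north n)) : lift (proj x) = x := by
  rw [lift_eq, norm_sq_proj, sub_sub_cancel, Real.sqrt_sq hx, ← coe_eq_smul_north_add]

theorem continuous_lift : Continuous (lift : EuclideanSpace ℝ (Fin n) → _) := by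
  have : (lift : EuclideanSpace ℝ (Fin n) → _) = fun z => Real.sqrt (1 - ‖z‖ ^ 2) •
    (north n : EuclideanSpace ℝ (Fin (n + 1))) + northIsometry n z := funext lift_eq
  rw [this]
  fun_prop

theorem contDiffOn_sqrt_one_sub_norm_sq {E : Type*} [NormedAddCommGroup E] [InnerProductSpace ℝ E] :
    ContDiffOn ℝ ∞ (fun z : E => Real.sqrt (1 - ‖z‖ ^ 2)) (ball 0 1) :=
  (contDiff_const.sub (contDiff_norm_sq ℝ)).contDiffOn.sqrt fun z hz => by
    have : ‖z‖ < 1 := mem_ball_zero_iff.1 hz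
    nlinarith [norm_nonneg z]

theorem contDiffOn_lift : ContDiffOn ℝ ∞ (lift : EuclideanSpace ℝ (Fin n) → _) (ball 0 1) := by
  have : (lift : EuclideanSpace ℝ (Fin n) → _) = fun z => Real.sqrt (1 - ‖z‖ ^ 2) •
    (north n : EuclideanSpace ℝ (Fin (n + 1))) + northIsometry n z := funext lift_eq
  rw [this]
  refine (contDiffOn_sqrt_one_sub_norm_sq.smul contDiffOn_const).add ?_
  exact ((perp (north n)).subtypeL.contDiff.comp (northIsometry n).contDiff).contDiffOn

variable {θ : ℝ} (hθ₀ : 0 < θ) (hθ : θ ≤ Real.pi / 2)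

include hθ₀ hθ

theorem sin_pos_of_le : 0 < Real.sin θ := Real.sin_pos_of_pos_of_lt_pi hθ₀ (by linarith)

theorem norm_proj_lt {x : Sph n} (hx : x ∈ cap n θ) : ‖proj x‖ < Real.sin θ := by
  have h1 : Real.cos θ < dot x (north n) := hx
  have h2 := norm_sq_proj x
  have h3 := Real.sin_sq_add_cos_sq θ
  have h4 := cos_nonneg_of_le hθ₀ hθ
  have h5 := sin_pos_of_le hθ₀ hθ
  nlinarith [norm_nonneg (proj x)]

theorem dot_pos_of_mem_cap {x : Sph n} (hx : x ∈ cap n θ) : 0 < dot x (north n) :=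
  (cos_nonneg_of_le hθ₀ hθ).trans_lt hx

omit hθ₀ hθ in
theorem liftSph_mem_cap {z : EuclideanSpace ℝ (Fin n)} (hz : ‖z‖ < Real.sin θ) :
    liftSph z (hz.le.trans (Real.sin_le_one θ)) ∈ cap n θ := by
  change Real.cos θ < _
  rw [dot_liftSph]
  refine Real.lt_sqrt_of_sq_lt ?_
  have h3 := Real.sin_sq_add_cos_sq θ
  nlinarith [norm_nonneg z]

theorem norm_proj_of_mem_capBoundary {ξ : Sph n} (hξ : ξ ∈ capBoundary n θ) : ‖proj ξ‖ = Real.sin θ := by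
  have h1 := norm_sq_proj ξ
  have h2 : dot ξ (north n) = Real.cos θ := hξ
  have h5 := sin_pos_of_le hθ₀ hθ
  rw [h2, ← Real.sin_sq] at h1
  exact (sq_eq_sq₀ (norm_nonneg _) h5.le).1 h1

/-- By Cauchy–Schwarz, `ξ · x ≥ cos θ x_{n+1} - sin θ |x'| > cos² θ - sin² θ`. Strictness comes from
`|x'| < sin θ`, so it survives `cos θ = 0`. -/
theorem cos_two_mul_lt_dot {ξ x : Sph n} (hξ : ξ ∈ capBoundary n θ) (hx : x ∈ cap n θ) :
    Real.cos (2 * θ) < dot ξ x := by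
  have h1 := norm_proj_of_mem_capBoundary hθ₀ hθ hξ
  have h2 : dot ξ (north n) = Real.cos θ := hξ
  have h3 : dot ξ x = dot ξ (north n) * dot x (north n) +
      inner ℝ (northIsometry n (proj ξ)) (northIsometry n (proj x)) := by
    rw [← inner_smul_north_add, ← coe_eq_smul_north_add, ← coe_eq_smul_north_add, dot]
  have h4 := abs_le.1 (abs_real_inner_le_norm (northIsometry n (proj ξ)) (northIsometry n (proj x)))
  rw [LinearIsometryEquiv.norm_map, LinearIsometryEquiv.norm_map, h1] at h4
  have h5 := norm_proj_lt hθ₀ hθ hx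
  have h6 : Real.cos θ < dot x (north n) := hx
  have h7 := sin_pos_of_le hθ₀ hθ
  have h8 := cos_nonneg_of_le hθ₀ hθ
  rw [Real.cos_two_mul, h3, h2]
  nlinarith [Real.sin_sq_add_cos_sq θ, h4.1]

omit hθ₀ hθ in
theorem dot_lt_one {ξ x : Sph n} (hξ : ξ ∈ capBoundary n θ) (hx : x ∈ cap n θ) : dot ξ x < 1 := by
  have h1 : dot ξ x ≤ 1 := by
    have := real_inner_le_norm (ξ : EuclideanSpace ℝ (Fin (n + 1))) x
    rwa [norm_coe_sph, norm_coe_sph, one_mul] at this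
  refine lt_of_le_of_ne h1 fun h => ?_
  have h2 : ξ = x := Subtype.ext ((inner_eq_one_iff_of_norm_eq_one (norm_coe_sph ξ) (norm_coe_sph x)).1 h)
  have h3 : Real.cos θ < dot x (north n) := hx
  have h4 : dot ξ (north n) = Real.cos θ := hξ
  rw [h2] at h4
  linarith

omit hθ₀ hθ in
theorem IsCompact.exists_subset_Icc {S : Set ℝ} (hS : IsCompact S) {a b : ℝ} (hab : a < b)
    (h : S ⊆ Ioo a b) : ∃ c d, a < c ∧ c ≤ d ∧ d < b ∧ S ⊆ Icc c d := by
  rcases S.eq_empty_or_nonempty with rfl | hne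
  -- The empty case occurs when `f` vanishes identically; any degenerate interval inside `(a, b)`
  -- serves.
  · exact ⟨(a + b) / 2, (a + b) / 2, by linarith, le_rfl, by linarith, empty_subset _⟩
  · exact ⟨sInf S, sSup S, (h (hS.sInf_mem hne)).1, csInf_le_csSup hne hS.bddBelow hS.bddAbove,
      (h (hS.sSup_mem hne)).2, fun s hs => ⟨csInf_le hS.bddBelow hs, le_csSup hS.bddAbove hs⟩⟩

/-- The products `ξ · y` with `ξ` on the cap boundary and `y` in the support of `f` form a compact
subset of `(cos 2θ, 1)`. So one interval `[c, d]` serves all centres, and boundary terms at `cos 2θ`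
and `1` never arise. -/
theorem exists_weighted_eq_zero (hn : 2 ≤ n) {f : Sph n → ℝ} (hf : Continuous f)
    (hsupp : tsupport f ⊆ cap n θ) :
    ∃ c d, Real.cos (2 * θ) < c ∧ c ≤ d ∧ d < 1 ∧ ∀ ξ ∈ capBoundary n θ, ∀ t ∉ Icc c d,
      weighted (sphericalMean f) ξ t = 0 := by
  have hK : IsCompact (tsupport f) := (isClosed_tsupport f).isCompact
  have hc : Continuous fun p : Sph n × Sph n => dot p.1 p.2 := by
    unfold dot
    fun_prop
  have hcos : Real.cos (2 * θ) < 1 := by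
    rw [Real.cos_two_mul]
    nlinarith [Real.sin_sq_add_cos_sq θ, sin_pos_of_le hθ₀ hθ]
  obtain ⟨c, d, hc1, hcd, hd1, hsub⟩ := (((isCompact_capBoundary n θ).prod hK).image hc).exists_subset_Icc
    hcos (by
      rintro _ ⟨⟨ξ, x⟩, ⟨hξ, hx⟩, rfl⟩
      exact ⟨cos_two_mul_lt_dot hθ₀ hθ hξ (hsupp hx), dot_lt_one hξ (hsupp hx)⟩)
  refine ⟨c, d, hc1, hcd, hd1, fun ξ hξ t ht => ?_⟩
  rcases le_or_gt 1 (t ^ 2) with h1 | h1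
  · exact weighted_sphericalMean_eq_zero hn f ξ h1
  · rw [weighted_sphericalMean_eq (by omega) hf.measurable ξ h1]
    have h2 : ∀ u, radialExtension f (sectionPoint ξ t u) = 0 := fun u => by
      rw [show sectionPoint ξ t u = sectionSph ξ h1.le u from rfl, radialExtension_coe]
      by_contra hne
      refine ht ?_
      have h3 := hsub (mem_image_of_mem _ (mk_mem_prod hξ (subset_tsupport f (Function.mem_support.2 hne))))
      have h4 : dot ξ (sectionSph ξ h1.le u) = t := inner_sectionPoint ξ t u
      rwa [h4] at h3
    simp [h2]

omit hθ₀ hθ in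
theorem iteratedDeriv_eq_zero_of_notMem {w : ℝ → ℝ} {c d : ℝ} (hw : ∀ t ∉ Icc c d, w t = 0) (j : ℕ)
    {t : ℝ} (ht : t ∉ Icc c d) : iteratedDeriv j w t = 0 := by
  have h1 : w =ᶠ[𝓝 t] fun _ => 0 := by
    filter_upwards [isClosed_Icc.isOpen_compl.mem_nhds ht] with s hs using hw s hs
  rw [h1.iteratedDeriv_eq]
  simp

omit hθ₀ hθ in
theorem neg_one_le_of_cos_two_mul_lt {c : ℝ} (hc : Real.cos (2 * θ) < c) : -1 < c :=
  (Real.neg_one_le_cos _).trans_lt hc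

/-- Vanishing near both ends of `(-1, 1)` lets smoothness on this interval extend to the whole line,
so that one can integrate by parts over `ℝ`. -/
theorem contDiff_weighted (hn : 1 ≤ n) {f : Sph n → ℝ} (hf : ContMDiff (𝓡 n) 𝓘(ℝ, ℝ) ∞ f) {ξ : Sph n}
    (hξ : ξ ∈ capBoundary n θ) {c d : ℝ} (hc : Real.cos (2 * θ) < c) (hd : d < 1)
    (hw : ∀ t ∉ Icc c d, weighted (sphericalMean f) ξ t = 0) :
    ContDiff ℝ ∞ (weighted (sphericalMean f) ξ) := by
  rw [contDiff_iff_contDiffAt]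
  intro t
  by_cases ht : t ∈ Icc c d
  · refine (contDiffOn_weighted hθ₀ hθ hn hf hξ).contDiffAt (isOpen_Ioo.mem_nhds ⟨?_, ?_⟩)
    · exact (neg_one_le_of_cos_two_mul_lt hc).trans_le ht.1
    · exact ht.2.trans_lt hd
  · refine (contDiffAt_const (c := (0 : ℝ))).congr_of_eventuallyEq ?_
    filter_upwards [isClosed_Icc.isOpen_compl.mem_nhds ht] with s hs using hw s hs

theorem exists_abs_iteratedDeriv_weighted_le_univ (hn : 1 ≤ n) {f : Sph n → ℝ}
    (hf : ContMDiff (𝓡 n) 𝓘(ℝ, ℝ) ∞ f) {c d : ℝ} (hc : Real.cos (2 * θ) < c) (hd : d < 1)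
    (hw : ∀ ξ ∈ capBoundary n θ, ∀ t ∉ Icc c d, weighted (sphericalMean f) ξ t = 0) (j : ℕ) :
    ∃ C, ∀ ξ ∈ capBoundary n θ, ∀ t, |iteratedDeriv j (weighted (sphericalMean f) ξ) t| ≤ C := by
  obtain ⟨C, hC⟩ := exists_abs_iteratedDeriv_weighted_le hθ₀ hθ hn hf (a := c) (b := d)
    (fun t ht => ⟨(neg_one_le_of_cos_two_mul_lt hc).trans_le ht.1, ht.2.trans_lt hd⟩) j
  refine ⟨max C 0, fun ξ hξ t => ?_⟩
  by_cases ht : t ∈ Icc c d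
  · exact (hC ξ hξ t ht).trans (le_max_left _ _)
  · rw [iteratedDeriv_eq_zero_of_notMem (hw ξ hξ) j ht, abs_zero]
    exact le_max_right _ _

omit hθ₀ hθ

/-- The density of `f dσ` over the equatorial hyperplane. -/
noncomputable def graphDensity (f : Sph n → ℝ) (z : EuclideanSpace ℝ (Fin n)) : ℝ :=
  (Real.sqrt (1 - ‖z‖ ^ 2))⁻¹ * radialExtension f (lift z)

theorem graphDensity_proj {f : Sph n → ℝ} {x : Sph n} (hx : 0 ≤ dot x (north n)) :
    graphDensity f (proj x) = (dot x (north n))⁻¹ * f x := by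
  rw [graphDensity, lift_proj hx, radialExtension_coe, norm_sq_proj, sub_sub_cancel, Real.sqrt_sq hx]

theorem graphDensity_eq_zero {f : Sph n → ℝ} {z : EuclideanSpace ℝ (Fin n)}
    (hz : z ∉ proj '' tsupport f) : graphDensity f z = 0 := by
  rcases lt_or_ge ‖z‖ 1 with h1 | h1
  · rw [graphDensity, show lift z = liftSph z h1.le from rfl, radialExtension_coe]
    by_cases h : f (liftSph z h1.le) = 0
    · rw [h, mul_zero]
    · exact (hz ⟨_, subset_tsupport f h, proj_liftSph h1.le⟩).elim
  · rw [graphDensity, Real.sqrt_eq_zero_of_nonpos (by nlinarith), inv_zero, zero_mul]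

theorem isCompact_proj_tsupport (f : Sph n → ℝ) : IsCompact (proj '' tsupport f) :=
  (isClosed_tsupport f).isCompact.image continuous_proj

theorem hasCompactSupport_graphDensity (f : Sph n → ℝ) : HasCompactSupport (graphDensity f) :=
  HasCompactSupport.intro (isCompact_proj_tsupport f) fun _ => graphDensity_eq_zero

-- The support of `f` projects to a compact subset of the open unit ball, so the singularity of `1 /
-- √(1 - ‖z‖²)` at the equator is never met.
include hθ₀ hθ in
theorem contDiff_graphDensity {f : Sph n → ℝ} (hf : ContMDiff (𝓡 n) 𝓘(ℝ, ℝ) ∞ f)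
    (hsupp : tsupport f ⊆ cap n θ) : ContDiff ℝ ∞ (graphDensity f) := by
  rw [contDiff_iff_contDiffAt]
  intro z
  by_cases hz : z ∈ proj '' tsupport f
  · have hz1 : ‖z‖ < 1 := by
      obtain ⟨x, hx, rfl⟩ := hz
      exact (norm_proj_lt hθ₀ hθ (hsupp hx)).trans_le (Real.sin_le_one θ)
    have hb : ball (0 : EuclideanSpace ℝ (Fin n)) 1 ∈ 𝓝 z := isOpen_ball.mem_nhds (by simpa using hz1)
    refine ContDiffOn.contDiffAt (s := ball 0 1) ?_ hb
    refine (contDiffOn_sqrt_one_sub_norm_sq.inv fun w hw => ?_).mul ?_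
    · have : ‖w‖ < 1 := mem_ball_zero_iff.1 hw
      exact (Real.sqrt_pos.2 (by nlinarith [norm_nonneg w])).ne'
    · refine (contDiffOn_radialExtension hf).comp contDiffOn_lift fun w hw => ?_
      have h1 := norm_lift (mem_ball_zero_iff.1 hw).le
      intro h0
      rw [mem_singleton_iff.1 h0, norm_zero] at h1
      exact zero_ne_one h1
  · refine (contDiffAt_const (c := (0 : ℝ))).congr_of_eventuallyEq ?_
    filter_upwards [(isCompact_proj_tsupport f).isClosed.isOpen_compl.mem_nhds hz] with s hs using
      graphDensity_eq_zero hs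

theorem radialExtension_eq_zero {f : Sph n → ℝ} (hf : ∀ x : Sph n, dot x (north n) ≤ 0 → f x = 0)
    {v : EuclideanSpace ℝ (Fin (n + 1))}
    (hv : inner ℝ (north n : EuclideanSpace ℝ (Fin (n + 1))) v ≤ 0) : radialExtension f v = 0 := by
  rw [radialExtension]
  by_cases h : ∃ x : Sph n, (x : EuclideanSpace ℝ (Fin (n + 1))) = ‖v‖⁻¹ • v
  · obtain ⟨x, hx⟩ := h
    rw [← hx, Subtype.val_injective.extend_apply]
    refine hf x ?_
    rw [dot, hx, real_inner_comm, inner_smul_right]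
    exact mul_nonpos_of_nonneg_of_nonpos (by positivity) hv
  · rw [Function.extend_apply' _ _ _ h]
    rfl

-- Both sides are the same surface integral, sliced on the left by hyperplanes orthogonal to `ξ` and
-- projected on the right along the pole. The right side is the form in which the dependence on `ξ`
-- can be integrated out.
include hθ₀ hθ in
theorem integral_weighted_mul_eq_graph (hn : 2 ≤ n) {f : Sph n → ℝ} (hf : Continuous f)
    (hsupp : tsupport f ⊆ cap n θ) (ξ : Sph n) {φ : ℝ → ℝ} (hφ : Continuous φ) :
    ∫ t, weighted (sphericalMean f) ξ t * φ t = (sphereArea n)⁻¹ *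
      ∫ z, graphDensity f z * φ (inner ℝ (ξ : EuclideanSpace ℝ (Fin (n + 1))) (lift z)) := by
  rw [integral_weighted_sphericalMean_mul hn hf ξ hφ]
  congr 1
  have h0 : ∀ x : Sph n, dot x (north n) ≤ 0 → f x = 0 := fun x hx =>
    image_eq_zero_of_notMem_tsupport fun h => (dot_pos_of_mem_cap hθ₀ hθ (hsupp h)).not_ge hx
  have h1 := integral_toSphere_graph (norm_coe_sph (north n)) (by simp; omega)
    (G := fun v => radialExtension f v * φ (inner ℝ (ξ : EuclideanSpace ℝ (Fin (n + 1))) v))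
    ((measurable_radialExtension hf.measurable).mul (by fun_prop))
    (fun v hv => by rw [radialExtension_eq_zero h0 hv, zero_mul])
  simp only [radialExtension_coe] at h1
  rw [h1, setIntegral_eq_integral_of_forall_compl_eq_zero]
  · rw [← (northIsometry n).measurePreserving.integral_comp
      (northIsometry n).toHomeomorph.measurableEmbedding]
    refine integral_congr_ae (Eventually.of_forall fun z => ?_)
    simp only [graphDensity, LinearIsometryEquiv.norm_map, lift_eq]
    ring
  · intro p hp
    have : 1 ≤ ‖p‖ := by simpa using hp
    rw [Real.sqrt_eq_zero_of_nonpos (by nlinarith), inv_zero, zero_mul]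

end Graph

/-! ### The kernels `(ε + is)^{-k}` and their logarithmic primitive -/

section CauchyKernel

open Set Filter Topology Complex

/-- `ε + i s`. -/
noncomputable def halfPlanePoint (ε s : ℝ) : ℂ := ε + s * I

theorem re_halfPlanePoint (ε s : ℝ) : (halfPlanePoint ε s).re = ε := by simp [halfPlanePoint]

theorem im_halfPlanePoint (ε s : ℝ) : (halfPlanePoint ε s).im = s := by simp [halfPlanePoint]

theorem halfPlanePoint_mem_slitPlane {ε : ℝ} (hε : 0 < ε) (s : ℝ) : halfPlanePoint ε s ∈ slitPlane :=
  Or.inl (by rwa [re_halfPlanePoint])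

theorem halfPlanePoint_ne_zero {ε : ℝ} (hε : 0 < ε) (s : ℝ) : halfPlanePoint ε s ≠ 0 :=
  slitPlane_ne_zero (halfPlanePoint_mem_slitPlane hε s)

theorem hasDerivAt_halfPlanePoint (ε τ t : ℝ) :
    HasDerivAt (fun t : ℝ => halfPlanePoint ε (t - τ)) I t := by
  have h := (((hasDerivAt_id t).sub_const τ).ofReal_comp.mul_const I).const_add (ε : ℂ)
  simpa [halfPlanePoint] using h

theorem hasDerivAt_log_halfPlanePoint {ε : ℝ} (hε : 0 < ε) (τ t : ℝ) :
    HasDerivAt (fun t : ℝ => log (halfPlanePoint ε (t - τ))) (I * (halfPlanePoint ε (t - τ) ^ 1)⁻¹) t := by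
  have h := (hasDerivAt_halfPlanePoint ε τ t).clog_real (halfPlanePoint_mem_slitPlane hε _)
  simpa [div_eq_mul_inv] using h

theorem hasDerivAt_inv_pow_halfPlanePoint {ε : ℝ} (hε : 0 < ε) (τ : ℝ) (k : ℕ) (t : ℝ) :
    HasDerivAt (fun t : ℝ => (halfPlanePoint ε (t - τ) ^ (k + 1))⁻¹)
      (-((k + 1) * I * (halfPlanePoint ε (t - τ) ^ (k + 2))⁻¹)) t := by
  have hne := halfPlanePoint_ne_zero hε (t - τ)
  have h := ((hasDerivAt_halfPlanePoint ε τ t).pow (k + 1)).inv (pow_ne_zero _ hne)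
  refine h.congr_deriv ?_
  simp only [Pi.pow_apply, Nat.add_sub_cancel]
  push_cast
  field_simp
  ring

theorem continuous_inv_pow_halfPlanePoint {ε : ℝ} (hε : 0 < ε) (τ : ℝ) (k : ℕ) :
    Continuous fun t : ℝ => (halfPlanePoint ε (t - τ) ^ k)⁻¹ :=
  Continuous.inv₀ (by unfold halfPlanePoint; fun_prop) fun t => pow_ne_zero _ (halfPlanePoint_ne_zero hε _)

theorem continuous_log_halfPlanePoint {ε : ℝ} (hε : 0 < ε) (τ : ℝ) :
    Continuous fun t : ℝ => log (halfPlanePoint ε (t - τ)) :=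
  Continuous.clog (by unfold halfPlanePoint; fun_prop) fun t => halfPlanePoint_mem_slitPlane hε _

theorem integral_deriv_mul_eq {w : ℝ → ℝ} (hw : ContDiff ℝ ∞ w) (hwc : HasCompactSupport w) {v v' : ℝ → ℂ}
    (hv : ∀ t, HasDerivAt v (v' t) t) (hv' : Continuous v') :
    ∫ t, ((deriv w t : ℝ) : ℂ) * v t = - ∫ t, (w t : ℂ) * v' t := by
  have hvc : Continuous v := continuous_iff_continuousAt.2 fun t => (hv t).continuousAt
  have hc1 : HasCompactSupport fun t => (w t : ℂ) := hwc.comp_left (g := ofReal) ofReal_zero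
  have hc2 : HasCompactSupport fun t => ((deriv w t : ℝ) : ℂ) := hwc.deriv.comp_left (g := ofReal) ofReal_zero
  have k1 : Continuous fun t => (w t : ℂ) := continuous_ofReal.comp hw.continuous
  have k2 : Continuous fun t => ((deriv w t : ℝ) : ℂ) :=
    continuous_ofReal.comp (hw.continuous_deriv (by simp))
  have h := integral_mul_deriv_eq_deriv_mul_of_integrable (u := fun t => (w t : ℂ))
    (u' := fun t => ((deriv w t : ℝ) : ℂ)) (v := v) (v' := v')
    (fun t _ => ((hw.differentiable (by simp)) t).hasDerivAt.ofReal_comp) (fun t _ => hv t)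
    ((k1.mul hv').integrable_of_hasCompactSupport hc1.mul_right)
    ((k2.mul hvc).integrable_of_hasCompactSupport hc2.mul_right)
    ((k1.mul hvc).integrable_of_hasCompactSupport hc1.mul_right)
  rw [h, neg_neg]

theorem ContDiff.deriv_infty {w : ℝ → ℝ} (hw : ContDiff ℝ ∞ w) : ContDiff ℝ ∞ (deriv w) :=
  (contDiff_infty_iff_deriv.1 hw).2

/-- Each integration by parts costs a minus sign, and differentiating the `j`-th inverse power gives
`-ij`; the product of these factors is `i^k k!`. -/
theorem integral_iteratedDeriv_mul_inv {ε : ℝ} (hε : 0 < ε) (τ : ℝ) (k : ℕ) {w : ℝ → ℝ}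
    (hw : ContDiff ℝ ∞ w) (hwc : HasCompactSupport w) :
    ∫ t, ((iteratedDeriv k w t : ℝ) : ℂ) * (halfPlanePoint ε (t - τ) ^ 1)⁻¹ =
      I ^ k * k.factorial * ∫ t, (w t : ℂ) * (halfPlanePoint ε (t - τ) ^ (k + 1))⁻¹ := by
  induction k generalizing w with
  | zero => simp
  | succ k ih =>
    rw [iteratedDeriv_succ', ih hw.deriv_infty hwc.deriv, integral_deriv_mul_eq hw hwc
      (hasDerivAt_inv_pow_halfPlanePoint hε τ k)
      (continuous_const.mul (continuous_inv_pow_halfPlanePoint hε τ (k + 2))).neg, ← integral_neg,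
      Nat.factorial_succ, pow_succ, ← integral_const_mul, ← integral_const_mul]
    refine integral_congr_ae (Eventually.of_forall fun t => ?_)
    push_cast
    ring

theorem integral_iteratedDeriv_mul_log {ε : ℝ} (hε : 0 < ε) (τ : ℝ) {m : ℕ} (hm : 1 ≤ m) {w : ℝ → ℝ}
    (hw : ContDiff ℝ ∞ w) (hwc : HasCompactSupport w) :
    ∫ t, ((iteratedDeriv m w t : ℝ) : ℂ) * log (halfPlanePoint ε (t - τ)) =
      -(I ^ m * (m - 1).factorial * ∫ t, (w t : ℂ) * (halfPlanePoint ε (t - τ) ^ m)⁻¹) := by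
  obtain ⟨k, rfl⟩ : ∃ k, m = k + 1 := ⟨m - 1, by omega⟩
  have hs : ContDiff ℝ ∞ (iteratedDeriv k w) := hw.iterate_deriv k |> fun h => by
    rwa [iteratedDeriv_eq_iterate]
  have hc : HasCompactSupport (iteratedDeriv k w) := by
    clear hw hs
    induction k with
    | zero => simpa using hwc
    | succ k ih => rw [iteratedDeriv_succ]; exact (ih (by omega)).deriv
  rw [iteratedDeriv_succ, integral_deriv_mul_eq hs hc (hasDerivAt_log_halfPlanePoint hε τ)
    (continuous_const.mul (continuous_inv_pow_halfPlanePoint hε τ 1)), Nat.add_sub_cancel]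
  have h := integral_iteratedDeriv_mul_inv hε τ k hw hwc
  rw [pow_succ I k]
  have h2 : ∫ t, ((iteratedDeriv k w t : ℝ) : ℂ) * (I * (halfPlanePoint ε (t - τ) ^ 1)⁻¹) =
      I * ∫ t, ((iteratedDeriv k w t : ℝ) : ℂ) * (halfPlanePoint ε (t - τ) ^ 1)⁻¹ := by
    rw [← integral_const_mul]
    refine integral_congr_ae (Eventually.of_forall fun t => ?_)
    ring
  rw [h2, h]
  ring

/-- From `|s| ≤ |ε + is| ≤ 3`, a bound on the logarithm uniform in `ε ∈ [0, 1]`, with an integrable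
singularity at `s = 0`. -/
theorem abs_log_norm_halfPlanePoint_le {ε s : ℝ} (hε : 0 ≤ ε) (hε1 : ε ≤ 1) (hs : |s| ≤ 2) (hs0 : s ≠ 0) :
    |Real.log ‖halfPlanePoint ε s‖| ≤ |Real.log s| + Real.log 3 := by
  have h1 : |s| ≤ ‖halfPlanePoint ε s‖ := by
    have := abs_im_le_norm (halfPlanePoint ε s)
    rwa [im_halfPlanePoint] at this
  have h2 : ‖halfPlanePoint ε s‖ ≤ 3 := by
    have := norm_le_abs_re_add_abs_im (halfPlanePoint ε s)
    rw [im_halfPlanePoint, re_halfPlanePoint, abs_of_nonneg hε] at this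
    linarith
  have hs1 := abs_pos.2 hs0
  have h3 := Real.log_le_log hs1 h1
  have h4 := Real.log_le_log (hs1.trans_le h1) h2
  have h5 : 0 ≤ Real.log 3 := Real.log_nonneg (by norm_num)
  rw [Real.log_abs] at h3
  rw [abs_le]
  constructor
  · linarith [neg_abs_le (Real.log s)]
  · linarith [abs_nonneg (Real.log s)]

theorem norm_log_halfPlanePoint_le {ε s : ℝ} (hε : 0 ≤ ε) (hε1 : ε ≤ 1) (hs : |s| ≤ 2) (hs0 : s ≠ 0) :
    ‖log (halfPlanePoint ε s)‖ ≤ |Real.log s| + (Real.log 3 + Real.pi) := by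
  have h := norm_le_abs_re_add_abs_im (log (halfPlanePoint ε s))
  rw [log_re, log_im] at h
  linarith [abs_log_norm_halfPlanePoint_le hε hε1 hs hs0, abs_arg_le_pi (halfPlanePoint ε s)]

theorem tendsto_log_halfPlanePoint {s : ℝ} (hs : s ≠ 0) :
    Tendsto (fun ε => log (halfPlanePoint ε s)) (𝓝[>] 0) (𝓝 (log (halfPlanePoint 0 s))) := by
  have h1 : ContinuousAt log (halfPlanePoint 0 s) :=
    continuousAt_clog (Or.inr (by rwa [im_halfPlanePoint]))
  have h2 : Continuous fun ε : ℝ => halfPlanePoint ε s := by unfold halfPlanePoint; fun_prop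
  exact (h1.tendsto.comp h2.continuousAt.tendsto).mono_left nhdsWithin_le_nhds

theorem intervalIntegrable_abs_log_sub_add (τ K a b : ℝ) :
    IntervalIntegrable (fun t => |Real.log (t - τ)| + K) volume a b := by
  have h : IntervalIntegrable Real.log volume (a - τ) (b - τ) := intervalIntegral.intervalIntegrable_log'
  have h2 := h.comp_sub_right τ
  rw [sub_add_cancel, sub_add_cancel] at h2
  exact h2.abs.add intervalIntegrable_const

variable {w : ℝ → ℝ} {c d : ℝ}

theorem integral_eq_setIntegral_Icc {E : Type*} [NormedAddCommGroup E] [NormedSpace ℝ E] {F : ℝ → E}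
    (h : ∀ t ∉ Icc c d, F t = 0) : ∫ t, F t = ∫ t in Icc c d, F t :=
  (setIntegral_eq_integral_of_forall_compl_eq_zero h).symm

theorem abs_sub_le_two {τ t : ℝ} (hτ : τ ∈ Icc (-1 : ℝ) 1) (ht : t ∈ Icc (-1 : ℝ) 1) : |t - τ| ≤ 2 := by
  rw [abs_le]
  constructor <;> linarith [hτ.1, hτ.2, ht.1, ht.2]

theorem ae_ne (τ : ℝ) (s : Set ℝ) : ∀ᵐ t ∂(volume.restrict s), t ≠ τ :=
  ae_restrict_of_ae (Measure.ae_ne volume τ)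

theorem norm_ofReal_mul_log_le {a C τ t ε : ℝ} (ha : |a| ≤ C) (hε : 0 ≤ ε) (hε1 : ε ≤ 1)
    (hτ : τ ∈ Icc (-1 : ℝ) 1) (ht : t ∈ Icc (-1 : ℝ) 1) (hne : t ≠ τ) :
    ‖(a : ℂ) * log (halfPlanePoint ε (t - τ))‖ ≤ C * (|Real.log (t - τ)| + (Real.log 3 + Real.pi)) := by
  rw [norm_mul, norm_real, Real.norm_eq_abs]
  exact mul_le_mul ha (norm_log_halfPlanePoint_le hε hε1 (abs_sub_le_two hτ ht) (sub_ne_zero.2 hne))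
    (norm_nonneg _) ((abs_nonneg a).trans ha)

theorem tendsto_integral_mul_log {q : ℝ → ℝ} (hq : Continuous q) (hcd : c ≤ d) (hc : -1 ≤ c) (hd : d ≤ 1)
    (hq0 : ∀ t ∉ Icc c d, q t = 0) {τ : ℝ} (hτ : τ ∈ Icc (-1 : ℝ) 1) :
    Tendsto (fun ε => ∫ t, (q t : ℂ) * log (halfPlanePoint ε (t - τ))) (𝓝[>] 0)
      (𝓝 (∫ t, (q t : ℂ) * log (halfPlanePoint 0 (t - τ)))) := by
  have h0 : ∀ ε, ∫ t, (q t : ℂ) * log (halfPlanePoint ε (t - τ)) =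
      ∫ t in Icc c d, (q t : ℂ) * log (halfPlanePoint ε (t - τ)) := fun ε =>
    integral_eq_setIntegral_Icc fun t ht => by rw [hq0 t ht, ofReal_zero, zero_mul]
  simp only [h0]
  obtain ⟨C, hC⟩ := (isCompact_Icc (a := c) (b := d)).exists_bound_of_continuousOn hq.continuousOn
  refine tendsto_integral_filter_of_dominated_convergence
    (fun t => C * (|Real.log (t - τ)| + (Real.log 3 + Real.pi))) ?_ ?_ ?_ ?_
  · filter_upwards [self_mem_nhdsWithin] with ε hε
    exact ((continuous_ofReal.comp hq).mul (continuous_log_halfPlanePoint hε τ)).aestronglyMeasurable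
  · filter_upwards [Ioc_mem_nhdsGT (zero_lt_one' ℝ)] with ε hε
    filter_upwards [ae_ne τ _, ae_restrict_mem measurableSet_Icc] with t hne ht
    exact norm_ofReal_mul_log_le (hC t ht) hε.1.le hε.2 hτ ⟨hc.trans ht.1, ht.2.trans hd⟩ hne
  · exact (((intervalIntegrable_iff_integrableOn_Icc_of_le hcd).1
      (intervalIntegrable_abs_log_sub_add τ _ c d)).const_mul C)
  · filter_upwards [ae_ne τ _] with t hne
    exact tendsto_const_nhds.mul (tendsto_log_halfPlanePoint (sub_ne_zero.2 hne))

/-- Enlarging `[c, d]` to `[τ - 2, τ + 2]` and translating makes the bound independent of `τ` as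
well as of `ε`. This is needed because `τ = ξ · x` moves when one integrates over `ξ`. -/
theorem norm_integral_mul_log_le {q : ℝ → ℝ} (hc : -1 ≤ c) (hd : d ≤ 1)
    (hq0 : ∀ t ∉ Icc c d, q t = 0) {C : ℝ} (hC : ∀ t, |q t| ≤ C) {τ : ℝ} (hτ : τ ∈ Icc (-1 : ℝ) 1)
    {ε : ℝ} (hε : 0 < ε) (hε1 : ε ≤ 1) :
    ‖∫ t, (q t : ℂ) * log (halfPlanePoint ε (t - τ))‖ ≤
      C * ∫ s in (-2 : ℝ)..2, (|Real.log s| + (Real.log 3 + Real.pi)) := by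
  have hC0 : 0 ≤ C := (abs_nonneg _).trans (hC 0)
  have hK : 0 ≤ Real.log 3 + Real.pi := add_nonneg (Real.log_nonneg (by norm_num)) Real.pi_pos.le
  rw [integral_eq_setIntegral_Icc (c := c) (d := d)
    fun t ht => by rw [hq0 t ht, ofReal_zero, zero_mul]]
  have hI := (intervalIntegrable_iff_integrableOn_Icc_of_le (by linarith : τ - 2 ≤ τ + 2)).1
    (intervalIntegrable_abs_log_sub_add τ (Real.log 3 + Real.pi) (τ - 2) (τ + 2))
  have hsub : Icc c d ⊆ Icc (τ - 2) (τ + 2) := Icc_subset_Icc (by linarith [hτ.2]) (by linarith [hτ.1])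
  have h1 : ‖∫ t in Icc c d, (q t : ℂ) * log (halfPlanePoint ε (t - τ))‖ ≤
      ∫ t in Icc c d, C * (|Real.log (t - τ)| + (Real.log 3 + Real.pi)) := by
    refine norm_integral_le_of_norm_le ((hI.mono_set hsub).const_mul C) ?_
    filter_upwards [ae_ne τ _, ae_restrict_mem measurableSet_Icc] with t hne ht
    exact norm_ofReal_mul_log_le (hC t) hε.le hε1 hτ ⟨hc.trans ht.1, ht.2.trans hd⟩ hne
  refine h1.trans ?_
  rw [integral_const_mul]
  refine mul_le_mul_of_nonneg_left ?_ hC0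
  have h2 := setIntegral_mono_set hI (Eventually.of_forall fun t => by positivity) hsub.eventuallyLE
  refine h2.trans_eq ?_
  rw [integral_Icc_eq_integral_Ioc, ← intervalIntegral.integral_of_le (by linarith),
    intervalIntegral.integral_comp_sub_right (fun s => |Real.log s| + (Real.log 3 + Real.pi)) τ]
  congr 1 <;> ring

theorem log_halfPlanePoint_zero_re (s : ℝ) : (log (halfPlanePoint 0 s)).re = Real.log |s| := by
  rw [log_re, halfPlanePoint]
  simp

theorem log_halfPlanePoint_zero_im_of_pos {s : ℝ} (hs : 0 < s) :
    (log (halfPlanePoint 0 s)).im = Real.pi / 2 := by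
  rw [log_im, halfPlanePoint, ofReal_zero, zero_add, arg_real_mul _ hs, arg_I]

theorem log_halfPlanePoint_zero_im_of_neg {s : ℝ} (hs : s < 0) :
    (log (halfPlanePoint 0 s)).im = -(Real.pi / 2) := by
  have h : (s : ℂ) * I = ((-s : ℝ) : ℂ) * (-I) := by push_cast; ring
  rw [log_im, halfPlanePoint, ofReal_zero, zero_add, h, arg_real_mul _ (neg_pos.2 hs), arg_neg_I]

end CauchyKernel

/-! ### The regularized kernel and its limits for odd and even order -/

section BackprojectionKernel

open Set Filter Topology Complex

variable {w : ℝ → ℝ} {c d : ℝ}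

theorem integrable_mul_log {q : ℝ → ℝ} (hq : Continuous q) (hcd : c ≤ d) (hc : -1 ≤ c) (hd : d ≤ 1)
    (hq0 : ∀ t ∉ Icc c d, q t = 0) {τ : ℝ} (hτ : τ ∈ Icc (-1 : ℝ) 1) {ε : ℝ} (hε : 0 ≤ ε) (hε1 : ε ≤ 1) :
    Integrable fun t => (q t : ℂ) * log (halfPlanePoint ε (t - τ)) := by
  obtain ⟨C, hC⟩ := (isCompact_Icc (a := c) (b := d)).exists_bound_of_continuousOn hq.continuousOn
  refine IntegrableOn.integrable_of_forall_notMem_eq_zero (s := Icc c d) ?_ fun t ht => by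
    rw [hq0 t ht, ofReal_zero, zero_mul]
  refine Integrable.mono' (((intervalIntegrable_iff_integrableOn_Icc_of_le hcd).1
      (intervalIntegrable_abs_log_sub_add τ (Real.log 3 + Real.pi) c d)).const_mul C) ?_ ?_
  · refine ((continuous_ofReal.comp hq).measurable.mul ?_).aestronglyMeasurable
    exact measurable_log.comp (by unfold halfPlanePoint; fun_prop)
  · filter_upwards [ae_ne τ _, ae_restrict_mem measurableSet_Icc] with t hne ht
    exact norm_ofReal_mul_log_le (hC t ht) hε hε1 hτ ⟨hc.trans ht.1, ht.2.trans hd⟩ hne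

/-- The regularized kernel of the filtered backprojection. -/
noncomputable def backKernel (m : ℕ) (ε s : ℝ) : ℝ :=
  -(1 / Real.pi) * (-1) ^ (m / 2) * (m - 1).factorial * ((halfPlanePoint ε s ^ m)⁻¹).re

theorem continuous_backKernel (m : ℕ) {ε : ℝ} (hε : 0 < ε) : Continuous (backKernel m ε) := by
  have h := continuous_inv_pow_halfPlanePoint hε 0 m
  simp only [sub_zero] at h
  exact continuous_const.mul (continuous_re.comp h)

theorem integral_mul_re_inv {ε : ℝ} (hε : 0 < ε) (τ : ℝ) (m : ℕ) (hw : ContDiff ℝ ∞ w)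
    (hwc : HasCompactSupport w) :
    (∫ t, (w t : ℂ) * (halfPlanePoint ε (t - τ) ^ m)⁻¹).re =
      ∫ t, w t * ((halfPlanePoint ε (t - τ) ^ m)⁻¹).re := by
  have hi : Integrable fun t => (w t : ℂ) * (halfPlanePoint ε (t - τ) ^ m)⁻¹ :=
    ((continuous_ofReal.comp hw.continuous).mul
      (continuous_inv_pow_halfPlanePoint hε τ m)).integrable_of_hasCompactSupport
      (hwc.comp_left (g := ofReal) ofReal_zero).mul_right
  have h := reCLM.integral_comp_comm hi
  simp only [reCLM_apply, re_ofReal_mul] at h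
  exact h.symm

theorem integral_mul_backKernel {ε : ℝ} (τ : ℝ) (m : ℕ) :
    ∫ t, w t * backKernel m ε (t - τ) = -(1 / Real.pi) * (-1) ^ (m / 2) * (m - 1).factorial *
      ∫ t, w t * ((halfPlanePoint ε (t - τ) ^ m)⁻¹).re := by
  rw [← integral_const_mul]
  refine integral_congr_ae (Eventually.of_forall fun t => ?_)
  simp only [backKernel]
  ring

/-- For odd `m`, `i^m = (-1)^{(m-1)/2} i`: the extra `i` exchanges real and imaginary parts, and the
sign is the one built into the kernel, since `m / 2` rounds down. -/
theorem integral_mul_backKernel_of_odd {ε : ℝ} (hε : 0 < ε) (τ : ℝ) {m : ℕ} (hm : Odd m)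
    (hw : ContDiff ℝ ∞ w) (hwc : HasCompactSupport w) :
    ∫ t, w t * backKernel m ε (t - τ) = 1 / Real.pi *
      (∫ t, ((iteratedDeriv m w t : ℝ) : ℂ) * log (halfPlanePoint ε (t - τ))).im := by
  rw [integral_iteratedDeriv_mul_log hε τ hm.pos hw hwc, integral_mul_backKernel,
    ← integral_mul_re_inv hε τ m hw hwc]
  obtain ⟨k, rfl⟩ := hm
  have h1 : I ^ (2 * k + 1) = ((-1 : ℝ) ^ k : ℝ) * I := by
    rw [pow_succ, pow_mul, I_sq]
    push_cast
    rfl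
  have h2 : ∀ (r : ℝ) (N : ℕ) (z : ℂ), ((r : ℂ) * I * N * z).im = r * N * z.re := fun r N z => by
    rw [show (r : ℂ) * I * N * z = ((r * N : ℝ) : ℂ) * (I * z) by push_cast; ring, im_ofReal_mul, I_mul_im]
  rw [h1, show (2 * k + 1) / 2 = k by omega, neg_im, h2]
  ring

theorem integral_mul_backKernel_of_even {ε : ℝ} (hε : 0 < ε) (τ : ℝ) {m : ℕ} (hm : Even m) (hm0 : 1 ≤ m)
    (hw : ContDiff ℝ ∞ w) (hwc : HasCompactSupport w) :
    ∫ t, w t * backKernel m ε (t - τ) = 1 / Real.pi *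
      (∫ t, ((iteratedDeriv m w t : ℝ) : ℂ) * log (halfPlanePoint ε (t - τ))).re := by
  rw [integral_iteratedDeriv_mul_log hε τ hm0 hw hwc, integral_mul_backKernel,
    ← integral_mul_re_inv hε τ m hw hwc]
  have h1 : I ^ m = ((-1 : ℝ) ^ (m / 2) : ℝ) := by
    conv_lhs => rw [← Nat.two_mul_div_two_of_even hm, pow_mul, I_sq]
    push_cast
    rfl
  have h2 : ∀ (r : ℝ) (N : ℕ) (z : ℂ), ((r : ℂ) * N * z).re = r * N * z.re := fun r N z => by
    rw [show (r : ℂ) * N * z = ((r * N : ℝ) : ℂ) * z by push_cast; ring, re_ofReal_mul]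
  rw [h1, neg_re, h2]
  ring

theorem continuous_iteratedDeriv (hw : ContDiff ℝ ∞ w) (m : ℕ) : Continuous (iteratedDeriv m w) :=
  hw.continuous_iteratedDeriv m (by exact_mod_cast le_top)

theorem hasCompactSupport_of_Icc (hw0 : ∀ t ∉ Icc c d, w t = 0) : HasCompactSupport w :=
  HasCompactSupport.intro isCompact_Icc hw0

/-- The imaginary part of `log (is)` is `±π/2` according to the sign of `s`. On each half line the
integrand is thus a constant times a derivative, and each half contributes `-(π/2) w^{(m-1)}(τ)`. -/
theorem integral_iteratedDeriv_mul_log_im (hw : ContDiff ℝ ∞ w) (hcd : c ≤ d) (hc : -1 ≤ c) (hd : d ≤ 1)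
    (hw0 : ∀ t ∉ Icc c d, w t = 0) {τ : ℝ} (hτ : τ ∈ Icc (-1 : ℝ) 1) {m : ℕ} (hm : 1 ≤ m) :
    (∫ t, ((iteratedDeriv m w t : ℝ) : ℂ) * log (halfPlanePoint 0 (t - τ))).im =
      -Real.pi * iteratedDeriv (m - 1) w τ := by
  have hi := integrable_mul_log (continuous_iteratedDeriv hw m) hcd hc hd
    (fun t ht => iteratedDeriv_eq_zero_of_notMem hw0 m ht) hτ le_rfl zero_le_one
  rw [← imCLM_apply, ← imCLM.integral_comp_comm hi]
  have hii := imCLM.integrable_comp hi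
  obtain ⟨k, rfl⟩ : ∃ k, m = k + 1 := ⟨m - 1, by omega⟩
  have hkc : HasCompactSupport (iteratedDeriv k w) :=
    hasCompactSupport_of_Icc (c := c) (d := d) fun t ht => iteratedDeriv_eq_zero_of_notMem hw0 k ht
  have hk1 : ContDiff ℝ 1 (iteratedDeriv k w) := by
    have := hw.iterate_deriv k
    rw [← iteratedDeriv_eq_iterate] at this
    exact this.of_le (by simp)
  rw [← integral_add_compl (measurableSet_Iic (a := τ)) hii, compl_Iic]
  have h1 : ∫ t in Iic τ, imCLM (((iteratedDeriv (k + 1) w t : ℝ) : ℂ) * log (halfPlanePoint 0 (t - τ))) =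
      -(Real.pi / 2) * iteratedDeriv k w τ := by
    rw [← hkc.integral_Iic_deriv_eq hk1 τ, ← integral_const_mul]
    refine integral_congr_ae ?_
    filter_upwards [ae_ne τ _, ae_restrict_mem measurableSet_Iic] with t hne ht
    rw [imCLM_apply, im_ofReal_mul, log_halfPlanePoint_zero_im_of_neg (sub_neg.2 (lt_of_le_of_ne ht hne)),
      iteratedDeriv_succ]
    ring
  have h2 : ∫ t in Ioi τ, imCLM (((iteratedDeriv (k + 1) w t : ℝ) : ℂ) * log (halfPlanePoint 0 (t - τ))) =
      -(Real.pi / 2) * iteratedDeriv k w τ := by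
    rw [show -(Real.pi / 2) * iteratedDeriv k w τ = (Real.pi / 2) * -iteratedDeriv k w τ by ring,
      ← hkc.integral_Ioi_deriv_eq hk1 τ, ← integral_const_mul]
    refine setIntegral_congr_fun measurableSet_Ioi fun t ht => ?_
    simp only [imCLM_apply]
    rw [im_ofReal_mul, log_halfPlanePoint_zero_im_of_pos (sub_pos.2 ht), iteratedDeriv_succ]
    ring
  rw [h1, h2, Nat.add_sub_cancel]
  ring

theorem integral_iteratedDeriv_mul_log_re (hw : ContDiff ℝ ∞ w) (hcd : c ≤ d) (hc : -1 ≤ c) (hd : d ≤ 1)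
    (hw0 : ∀ t ∉ Icc c d, w t = 0) {τ : ℝ} (hτ : τ ∈ Icc (-1 : ℝ) 1) (m : ℕ) {a : ℝ} (ha : a < c) :
    (∫ t, ((iteratedDeriv m w t : ℝ) : ℂ) * log (halfPlanePoint 0 (t - τ))).re =
      ∫ t in a..1, iteratedDeriv m w t * Real.log |t - τ| := by
  have hi := integrable_mul_log (continuous_iteratedDeriv hw m) hcd hc hd
    (fun t ht => iteratedDeriv_eq_zero_of_notMem hw0 m ht) hτ le_rfl zero_le_one
  have h := reCLM.integral_comp_comm hi
  simp only [reCLM_apply] at h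
  rw [← h, intervalIntegral.integral_of_le (by linarith), setIntegral_eq_integral_of_forall_compl_eq_zero]
  · refine integral_congr_ae (Eventually.of_forall fun t => ?_)
    simp only
    rw [re_ofReal_mul, log_halfPlanePoint_zero_re]
  · intro t ht
    rw [iteratedDeriv_eq_zero_of_notMem hw0, zero_mul]
    exact fun h => ht ⟨ha.trans_le h.1, h.2.trans hd⟩

theorem tendsto_integral_mul_backKernel_of_odd (hw : ContDiff ℝ ∞ w) (hcd : c ≤ d) (hc : -1 ≤ c)
    (hd : d ≤ 1) (hw0 : ∀ t ∉ Icc c d, w t = 0) {τ : ℝ} (hτ : τ ∈ Icc (-1 : ℝ) 1) {m : ℕ} (hm : Odd m) :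
    Tendsto (fun ε => ∫ t, w t * backKernel m ε (t - τ)) (𝓝[>] 0) (𝓝 (-iteratedDeriv (m - 1) w τ)) := by
  have h := ((continuous_im.tendsto _).comp (tendsto_integral_mul_log (continuous_iteratedDeriv hw m)
    hcd hc hd (fun t ht => iteratedDeriv_eq_zero_of_notMem hw0 m ht) hτ)).const_mul (1 / Real.pi)
  rw [integral_iteratedDeriv_mul_log_im hw hcd hc hd hw0 hτ hm.pos] at h
  have he : 1 / Real.pi * (-Real.pi * iteratedDeriv (m - 1) w τ) = -iteratedDeriv (m - 1) w τ := by
    field_simp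
  rw [he] at h
  refine h.congr' ?_
  filter_upwards [self_mem_nhdsWithin] with ε hε
  exact (integral_mul_backKernel_of_odd hε τ hm hw (hasCompactSupport_of_Icc hw0)).symm

theorem tendsto_integral_mul_backKernel_of_even (hw : ContDiff ℝ ∞ w) (hcd : c ≤ d) (hc : -1 ≤ c)
    (hd : d ≤ 1) (hw0 : ∀ t ∉ Icc c d, w t = 0) {τ : ℝ} (hτ : τ ∈ Icc (-1 : ℝ) 1) {m : ℕ} (hm : Even m)
    (hm0 : 1 ≤ m) {a : ℝ} (ha : a < c) :
    Tendsto (fun ε => ∫ t, w t * backKernel m ε (t - τ)) (𝓝[>] 0)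
      (𝓝 (1 / Real.pi * ∫ t in a..1, iteratedDeriv m w t * Real.log |t - τ|)) := by
  have h := ((continuous_re.tendsto _).comp (tendsto_integral_mul_log (continuous_iteratedDeriv hw m)
    hcd hc hd (fun t ht => iteratedDeriv_eq_zero_of_notMem hw0 m ht) hτ)).const_mul (1 / Real.pi)
  rw [integral_iteratedDeriv_mul_log_re hw hcd hc hd hw0 hτ m ha] at h
  refine h.congr' ?_
  filter_upwards [self_mem_nhdsWithin] with ε hε
  exact (integral_mul_backKernel_of_even hε τ hm hm0 hw (hasCompactSupport_of_Icc hw0)).symm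

theorem abs_integral_mul_backKernel_le (hw : ContDiff ℝ ∞ w) (hc : -1 ≤ c) (hd : d ≤ 1)
    (hw0 : ∀ t ∉ Icc c d, w t = 0) {τ : ℝ} (hτ : τ ∈ Icc (-1 : ℝ) 1) {m : ℕ} (hm : 1 ≤ m) {C : ℝ}
    (hC : ∀ t, |iteratedDeriv m w t| ≤ C) {ε : ℝ} (hε : 0 < ε) (hε1 : ε ≤ 1) :
    |∫ t, w t * backKernel m ε (t - τ)| ≤
      1 / Real.pi * (C * ∫ s in (-2 : ℝ)..2, (|Real.log s| + (Real.log 3 + Real.pi))) := by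
  have h := norm_integral_mul_log_le hc hd (fun t ht => iteratedDeriv_eq_zero_of_notMem hw0 m ht) hC hτ hε hε1
  have hwc := hasCompactSupport_of_Icc hw0
  have hpi : 0 ≤ 1 / Real.pi := by positivity
  rcases Nat.even_or_odd m with hp | hp
  · rw [integral_mul_backKernel_of_even hε τ hp hm hw hwc, abs_mul, abs_of_nonneg hpi]
    exact mul_le_mul_of_nonneg_left ((abs_re_le_norm _).trans h) hpi
  · rw [integral_mul_backKernel_of_odd hε τ hp hw hwc, abs_mul, abs_of_nonneg hpi]
    exact mul_le_mul_of_nonneg_left ((abs_im_le_norm _).trans h) hpi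

end BackprojectionKernel

/-! ### The Funk–Hecke formula, the slope estimate and the constant -/

section SphereKernel

open Set Metric Filter Topology

theorem gegenbauerWeight_neg (m : ℕ) (s : ℝ) : gegenbauerWeight m (-s) = gegenbauerWeight m s := by
  rw [gegenbauerWeight, gegenbauerWeight, neg_sq]

/-- The Funk–Hecke formula for the kernel `(ε + i s)^{-m}` on the unit sphere of a space of dimension
`m + 2`. -/
theorem integral_toSphere_re_inv_pow {V : Type*} [NormedAddCommGroup V] [InnerProductSpace ℝ V]
    [MeasurableSpace V] [BorelSpace V] [FiniteDimensional ℝ V] {m : ℕ} (hm : 1 ≤ m)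
    (hd : Module.finrank ℝ V = m + 2) {v : V} (hv : v ≠ 0) {ε : ℝ} (hε : 0 < ε) (c : ℝ) :
    ∫ u : sphere (0 : V) 1, ((halfPlanePoint ε (c + inner ℝ v (u : V)) ^ m)⁻¹).re
        ∂(volume : Measure V).toSphere =
      sphereArea (m + 1) * (‖v‖ ^ m)⁻¹ *
        (gegenbauerCauchy m m ((ε / ‖v‖ : ℝ) + (c / ‖v‖ : ℝ) * Complex.I)).re := by
  have hv0 : 0 < ‖v‖ := norm_pos_iff.2 hv
  obtain ⟨e, he⟩ : ∃ e, e = ‖v‖⁻¹ • v := ⟨_, rfl⟩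
  have hen : ‖e‖ = 1 := by rw [he, norm_smul, norm_inv, norm_norm, inv_mul_cancel₀ hv0.ne']
  have hve : v = ‖v‖ • e := by rw [he, smul_smul, mul_inv_cancel₀ hv0.ne', one_smul]
  have hG : Continuous fun u : V => ((halfPlanePoint ε (c + inner ℝ v u) ^ m)⁻¹).re := by
    have h := Complex.continuous_re.comp (continuous_inv_pow_halfPlanePoint hε 0 m)
    simp only [sub_zero] at h
    exact h.comp (g := fun s => ((halfPlanePoint ε s ^ m)⁻¹).re) (by fun_prop)
  rw [integral_toSphere_slice hen hd hG.measurable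
    ((hG.comp continuous_subtype_val).integrable_of_hasCompactSupport (HasCompactSupport.of_compactSpace _))]
  have hfin : Module.finrank ℝ (Submodule.span ℝ {e})ᗮ = m + 1 := by
    have := finrank_span_orthogonal hen
    omega
  have h1 : ∀ (t : ℝ) (u : sphere (0 : (Submodule.span ℝ {e})ᗮ) 1),
      inner ℝ v (t • e + Real.sqrt (1 - t ^ 2) • ((u : (Submodule.span ℝ {e})ᗮ) : V)) = ‖v‖ * t := by
    intro t u
    have h2 : inner ℝ e ((u : (Submodule.span ℝ {e})ᗮ) : V) = 0 :=
      Submodule.mem_orthogonal_singleton_iff_inner_right.1 (u : (Submodule.span ℝ {e})ᗮ).2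
    rw [hve, norm_smul, norm_norm, hen, mul_one, inner_smul_left, inner_add_right, inner_smul_right,
      inner_smul_right, h2, real_inner_self_eq_norm_sq, hen]
    simp
  simp only [h1, integral_const, smul_eq_mul]
  rw [toSphere_real_univ (by omega) hfin, ← integral_Ioc_eq_integral_Ioo,
    ← intervalIntegral.integral_of_le (by norm_num)]
  set ζ : ℂ := (ε / ‖v‖ : ℝ) + (c / ‖v‖ : ℝ) * Complex.I with hζ
  have hζ0 : 0 < ζ.re := by
    have : ζ.re = ε / ‖v‖ := by simp [hζ]
    rw [this]
    positivity
  have hre : (gegenbauerCauchy m m ζ).re = ∫ s in (-1 : ℝ)..1,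
      gegenbauerWeight m s * (((ζ - Complex.I * s) ^ m)⁻¹).re := by
    have h := Complex.reCLM.intervalIntegral_comp_comm
      ((continuous_gegenbauerCauchy_integrand hm m hζ0).intervalIntegrable (μ := volume) (-1) 1)
    simp only [Complex.reCLM_apply, Complex.re_ofReal_mul] at h
    exact h.symm
  -- The slice variable enters as `+it` and the Cauchy kernel contains `-is`; the evenness of the
  -- weight allows `s = -t`.
  have hneg := intervalIntegral.integral_comp_neg (a := (-1 : ℝ)) (b := 1) fun s : ℝ =>
      gegenbauerWeight m s * (((ζ - Complex.I * s) ^ m)⁻¹).re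
  rw [neg_neg] at hneg
  rw [hre, ← hneg, ← intervalIntegral.integral_const_mul]
  refine intervalIntegral.integral_congr fun t _ => ?_
  rw [gegenbauerWeight_neg]
  have h3 : halfPlanePoint ε (c + ‖v‖ * t) = (‖v‖ : ℂ) * (ζ - Complex.I * ((-t : ℝ) : ℂ)) := by
    have : (‖v‖ : ℂ) ≠ 0 := by exact_mod_cast hv0.ne'
    rw [hζ, halfPlanePoint]
    push_cast
    field_simp
    ring
  rw [h3, mul_pow, mul_inv, ← Complex.ofReal_pow, ← Complex.ofReal_inv, Complex.re_ofReal_mul,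
    gegenbauerWeight]
  ring

theorem abs_sqrt_one_sub_sq_sub_le {a b r : ℝ} (ha : 0 ≤ a) (hb : 0 ≤ b) (har : a ≤ r) (hbr : b ≤ r)
    (hr : r < 1) : |Real.sqrt (1 - a ^ 2) - Real.sqrt (1 - b ^ 2)| ≤
      |a - b| * (r / Real.sqrt (1 - r ^ 2)) := by
  have hr0 : 0 ≤ r := ha.trans har
  have h0 : 0 < Real.sqrt (1 - r ^ 2) := Real.sqrt_pos.2 (by nlinarith)
  have h1 : Real.sqrt (1 - r ^ 2) ≤ Real.sqrt (1 - a ^ 2) := Real.sqrt_le_sqrt (by nlinarith)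
  have h2 : Real.sqrt (1 - r ^ 2) ≤ Real.sqrt (1 - b ^ 2) := Real.sqrt_le_sqrt (by nlinarith)
  have h3 : (Real.sqrt (1 - a ^ 2) - Real.sqrt (1 - b ^ 2)) *
      (Real.sqrt (1 - a ^ 2) + Real.sqrt (1 - b ^ 2)) = -((a - b) * (a + b)) := by
    have e1 := Real.sq_sqrt (show 0 ≤ 1 - a ^ 2 by nlinarith)
    have e2 := Real.sq_sqrt (show 0 ≤ 1 - b ^ 2 by nlinarith)
    linear_combination e1 - e2
  have h4 := congrArg abs h3
  rw [abs_neg, abs_mul, abs_mul, abs_of_nonneg (by linarith : 0 ≤ Real.sqrt (1 - a ^ 2) + Real.sqrt (1 - b ^ 2)),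
    abs_of_nonneg (by linarith : 0 ≤ a + b)] at h4
  rw [mul_div_assoc', le_div_iff₀ h0]
  nlinarith [abs_nonneg (a - b), abs_nonneg (Real.sqrt (1 - a ^ 2) - Real.sqrt (1 - b ^ 2))]

/-- With `r = sin α` this says `cos θ tan α < sin θ`; after squaring it reduces to `r² < sin² θ`. -/
theorem cos_mul_div_lt {θ r : ℝ} (hr0 : 0 ≤ r) (hs : r < Real.sin θ) :
    Real.cos θ * (r / Real.sqrt (1 - r ^ 2)) < Real.sin θ := by
  have hr1 : r < 1 := hs.trans_le (Real.sin_le_one θ)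
  have h0 : 0 < Real.sqrt (1 - r ^ 2) := Real.sqrt_pos.2 (by nlinarith)
  rw [mul_div_assoc', div_lt_iff₀ h0]
  have e1 := Real.sq_sqrt (show 0 ≤ 1 - r ^ 2 by nlinarith)
  refine lt_of_pow_lt_pow_left₀ 2 (mul_nonneg (hr0.trans hs.le) h0.le) ?_
  rw [mul_pow, mul_pow, e1]
  nlinarith [Real.sin_sq_add_cos_sq θ]

/-- Over the ball of radius `r` the height `√(1 - ‖z‖²)` is Lipschitz with constant `r / √(1 - r²)`,
and `cos θ` times this is less than `sin θ`. The gap `κ` keeps the argument of the Cauchy transform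
in the strip `|Im ζ| ≤ 1 - κ`. -/
theorem exists_abs_cos_mul_sub_le {n : ℕ} {θ r : ℝ} (hr0 : 0 ≤ r) (hs : r < Real.sin θ)
    (hc : 0 ≤ Real.cos θ) :
    ∃ κ, 0 < κ ∧ ∀ y z : EuclideanSpace ℝ (Fin n), ‖y‖ ≤ r → ‖z‖ ≤ r →
      |Real.cos θ * (Real.sqrt (1 - ‖z‖ ^ 2) - Real.sqrt (1 - ‖y‖ ^ 2))| ≤
        (1 - κ) * (Real.sin θ * ‖z - y‖) := by
  have hs0 : 0 < Real.sin θ := hr0.trans_lt hs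
  have h := cos_mul_div_lt hr0 hs
  refine ⟨1 - Real.cos θ * (r / Real.sqrt (1 - r ^ 2)) / Real.sin θ, ?_, fun y z hy hz => ?_⟩
  · rw [sub_pos, div_lt_one hs0]
    exact h
  · rw [abs_mul, abs_of_nonneg hc, sub_sub_cancel]
    have h1 := abs_sqrt_one_sub_sq_sub_le (norm_nonneg z) (norm_nonneg y) hz hy
      (hs.trans_le (Real.sin_le_one θ))
    have h2 := h1.trans (mul_le_mul_of_nonneg_right (abs_norm_sub_norm_le z y) (by positivity))
    refine (mul_le_mul_of_nonneg_left h2 hc).trans_eq ?_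
    field_simp

/-- Legendre's duplication formula for `Γ` at `(n - 1)/2`. -/
theorem factorial_mul_sphereArea {n : ℕ} (hn : 3 ≤ n) :
    ((n - 2).factorial : ℝ) * sphereArea (n - 1) =
      2 ^ (n - 1) * Real.pi ^ ((n : ℝ) / 2 - 1) * Real.Gamma ((n : ℝ) / 2) := by
  obtain ⟨k, rfl⟩ : ∃ k, n = k + 2 := ⟨n - 2, by omega⟩
  have hd := Real.Gamma_mul_Gamma_add_half (((k : ℝ) + 1) / 2)
  rw [show 2 * (((k : ℝ) + 1) / 2) = k + 1 by ring, Real.Gamma_nat_eq_factorial,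
    show ((k : ℝ) + 1) / 2 + 1 / 2 = ((k + 2 : ℕ) : ℝ) / 2 by push_cast; ring] at hd
  have hg : Real.Gamma (((k : ℝ) + 1) / 2) ≠ 0 := (Real.Gamma_pos_of_pos (by positivity)).ne'
  rw [sphereArea, show k + 2 - 1 = k + 1 by omega, show k + 2 - 2 = k by omega]
  push_cast at hd ⊢
  have h1 : Real.pi ^ (((k : ℝ) + 1) / 2) = Real.pi ^ (((k : ℝ) + 2) / 2 - 1) * Real.sqrt Real.pi := by
    rw [Real.sqrt_eq_rpow, ← Real.rpow_add Real.pi_pos]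
    congr 1
    ring
  have h2 : (2 : ℝ) ^ (1 - ((k : ℝ) + 1)) * 2 ^ k = 1 := by
    rw [← Real.rpow_natCast, ← Real.rpow_add two_pos]
    rw [show 1 - ((k : ℝ) + 1) + k = 0 by ring, Real.rpow_zero]
  rw [h1, mul_div_assoc', div_eq_iff hg]
  rw [pow_succ]
  linear_combination (-(2 ^ k * 2 * Real.pi ^ (((k : ℝ) + 2) / 2 - 1))) * hd -
    2 * Real.pi ^ (((k : ℝ) + 2) / 2 - 1) * Real.sqrt Real.pi * k.factorial * h2

/-- The integer part of `n/2 - 1` is the truncated quotient `(n - 2) / 2`, so the sign in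
`inversionConst` is the sign in the kernel and the two cancel. -/
theorem inversionConst_mul {n : ℕ} (hn : 3 ≤ n) :
    inversionConst n * ((-1) ^ ((n - 2) / 2) * (((n - 2).factorial : ℝ) * sphereArea (n - 1))) = 1 := by
  have hfl : ⌊(n : ℝ) / 2 - 1⌋ = (((n - 2) / 2 : ℕ) : ℤ) := by
    rw [Int.floor_eq_iff]
    obtain ⟨k, rfl⟩ : ∃ k, n = k + 2 := ⟨n - 2, by omega⟩
    rw [Nat.add_sub_cancel]
    have h1 : 2 * (k / 2) ≤ k := by omega
    have h2 : k < 2 * (k / 2) + 2 := by omega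
    have h1' : (2 : ℝ) * ((k / 2 : ℕ) : ℝ) ≤ k := by exact_mod_cast h1
    have h2' : (k : ℝ) < 2 * ((k / 2 : ℕ) : ℝ) + 2 := by exact_mod_cast h2
    rw [Int.cast_natCast, Nat.cast_add, Nat.cast_two]
    constructor <;> linarith
  have hn0 : (0 : ℝ) < (n : ℝ) / 2 := by
    have : (3 : ℝ) ≤ n := by exact_mod_cast hn
    linarith
  have hg := Real.Gamma_pos_of_pos hn0
  have hp : 0 < Real.pi ^ ((n : ℝ) / 2 - 1) := Real.rpow_pos_of_pos Real.pi_pos _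
  rw [factorial_mul_sphereArea hn, inversionConst, hfl, zpow_natCast]
  have hs : (-1 : ℝ) ^ ((n - 2) / 2) * (-1) ^ ((n - 2) / 2) = 1 := by
    rw [← mul_pow]
    simp
  field_simp
  linear_combination hs

end SphereKernel

/-! ### Integration of the kernel over the cap boundary -/

section Backprojection

open Set Metric Filter Topology

variable {n : ℕ} {θ : ℝ}

theorem ae_mem_capBoundary (n : ℕ) (θ : ℝ) :
    ∀ᵐ ξ ∂(capBoundaryMeasure n θ), ξ ∈ capBoundary n θ := by
  have hm : MeasurableSet {ξ : Sph n | ξ ∈ capBoundary n θ} :=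
    (isCompact_capBoundary n θ).isClosed.measurableSet
  rw [capBoundaryMeasure, sectionMeasure_eq _ (Real.cos_sq_le_one θ)]
  refine Measure.ae_smul_measure ?_ _
  rw [ae_map_iff (continuous_sectionSph _ _).measurable.aemeasurable hm]
  refine Eventually.of_forall fun u => ?_
  change inner ℝ (sectionPoint (north n) (Real.cos θ) u) _ = _
  rw [real_inner_comm]
  exact inner_sectionPoint (north n) (Real.cos θ) u

theorem isFiniteMeasure_capBoundaryMeasure (n : ℕ) (θ : ℝ) :
    IsFiniteMeasure (capBoundaryMeasure n θ) := by
  rw [capBoundaryMeasure, sectionMeasure_eq _ (Real.cos_sq_le_one θ)]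
  have : IsFiniteMeasure ((volume : Measure (perp (north n))).toSphere.map
    (sectionSph (north n) (Real.cos_sq_le_one θ))) := inferInstance
  exact Measure.smul_finite _ ENNReal.ofReal_ne_top

theorem dot_mem_Icc (ξ x : Sph n) : dot ξ x ∈ Icc (-1 : ℝ) 1 := by
  have h := abs_le.1 (abs_real_inner_le_norm (ξ : EuclideanSpace ℝ (Fin (n + 1))) x)
  rw [norm_coe_sph, norm_coe_sph, one_mul] at h
  exact h

/-- The regularized kernel integrated over the boundary of the cap. -/
noncomputable def capKernel (θ : ℝ) (x : Sph n) (ε : ℝ) (z : EuclideanSpace ℝ (Fin n)) : ℝ :=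
  ∫ ξ, backKernel (n - 2) ε (inner ℝ (ξ : EuclideanSpace ℝ (Fin (n + 1))) (lift z) - dot ξ x)
    ∂(capBoundaryMeasure n θ)

/-- For `ξ = cos θ e + sin θ u`, the difference of inner products is `cos θ (√(1 - ‖z‖²) - x_{n+1})
+ sin θ u · (z - x')`, so the Funk–Hecke formula applies with `v = sin θ (z - x')`. Of the factor
`sin^{n-1} θ` from the measure, one power remains after division by `‖v‖^{n-2}`. -/
theorem capKernel_eq (hn : 3 ≤ n) (hs : 0 < Real.sin θ) (x : Sph n) {ε : ℝ} (hε : 0 < ε)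
    {z : EuclideanSpace ℝ (Fin n)} (hz : z ≠ proj x) :
    capKernel θ x ε z = (-(1 / Real.pi) * (-1) ^ ((n - 2) / 2) * (n - 2 - 1).factorial *
      (Real.sin θ * sphereArea (n - 1))) * (‖proj x - z‖ ^ (n - 2))⁻¹ *
      (gegenbauerCauchy (n - 2) (n - 2) ((ε / (Real.sin θ * ‖z - proj x‖) : ℝ) +
        (Real.cos θ * (Real.sqrt (1 - ‖z‖ ^ 2) - dot x (north n)) /
          (Real.sin θ * ‖z - proj x‖) : ℝ) * Complex.I)).re := by
  have hsq : Real.sqrt (1 - Real.cos θ ^ 2) = Real.sin θ := by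
    rw [← Real.sin_sq, Real.sqrt_sq hs.le]
  have hm : Continuous fun ξ : Sph n => backKernel (n - 2) ε
      (inner ℝ (ξ : EuclideanSpace ℝ (Fin (n + 1))) (lift z) - dot ξ x) :=
    (continuous_backKernel (n - 2) hε).comp (by unfold dot; fun_prop)
  rw [capKernel, capBoundaryMeasure, integral_sectionMeasure _ (Real.cos_sq_le_one θ) hm.measurable, hsq]
  set v : perp (north n) := Real.sin θ • northIsometry n (z - proj x) with hv
  set c : ℝ := Real.cos θ * (Real.sqrt (1 - ‖z‖ ^ 2) - dot x (north n)) with hc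
  have hvn : ‖v‖ = Real.sin θ * ‖z - proj x‖ := by
    rw [hv, norm_smul, Real.norm_of_nonneg hs.le, LinearIsometryEquiv.norm_map]
  have hv0 : v ≠ 0 := by
    rw [← norm_pos_iff, hvn]
    exact mul_pos hs (norm_pos_iff.2 (sub_ne_zero.2 hz))
  have h1 : ∀ u : sphere (0 : perp (north n)) 1,
      inner ℝ (sectionSph (north n) (Real.cos_sq_le_one θ) u : EuclideanSpace ℝ (Fin (n + 1))) (lift z) -
        dot (sectionSph (north n) (Real.cos_sq_le_one θ) u) x =
      c + inner ℝ v (u : perp (north n)) := by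
    intro u
    rw [dot, ← inner_sub_right, lift_eq]
    nth_rewrite 1 [coe_eq_smul_north_add x]
    rw [show ((sectionSph (north n) (Real.cos_sq_le_one θ) u : Sph n) : EuclideanSpace ℝ (Fin (n + 1))) =
      Real.cos θ • (north n : EuclideanSpace ℝ (Fin (n + 1))) +
        ((Real.sin θ • (u : perp (north n)) : perp (north n)) : EuclideanSpace ℝ (Fin (n + 1))) by
      rw [← hsq]; rfl, inner_sub_right, inner_smul_north_add, inner_smul_north_add, hv,
      real_inner_smul_left, real_inner_smul_left, real_inner_smul_left, map_sub, inner_sub_left,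
      real_inner_comm (u : perp (north n)) (northIsometry n z),
      real_inner_comm (u : perp (north n)) (northIsometry n (proj x)), hc]
    ring
  have h2 := integral_toSphere_re_inv_pow (m := n - 2) (by omega)
    (by rw [finrank_perp]; omega) hv0 hε c
  simp only [h1, backKernel]
  rw [integral_const_mul, h2, hvn, show n - 2 + 1 = n - 1 by omega, mul_pow, norm_sub_rev (proj x) z]
  have h3 : Real.sin θ ^ (n - 1) = Real.sin θ * Real.sin θ ^ (n - 2) := by
    rw [← pow_succ']
    congr 1
    omega
  rw [h3]
  have h4 : Real.sin θ ^ (n - 2) ≠ 0 := pow_ne_zero _ hs.ne'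
  rw [mul_inv]
  field_simp

theorem continuous_backKernel_inner (x : Sph n) {ε : ℝ} (hε : 0 < ε) (m : ℕ) :
    Continuous fun p : Sph n × EuclideanSpace ℝ (Fin n) => backKernel m ε
      (inner ℝ (p.1 : EuclideanSpace ℝ (Fin (n + 1))) (lift p.2) - dot p.1 x) := by
  have := continuous_lift (n := n)
  exact (continuous_backKernel m hε).comp (by unfold dot; fun_prop)

theorem stronglyMeasurable_capKernel (θ : ℝ) (x : Sph n) {ε : ℝ} (hε : 0 < ε) :
    StronglyMeasurable (capKernel θ x ε) := by
  have := isFiniteMeasure_capBoundaryMeasure n θ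
  exact StronglyMeasurable.integral_prod_right
    (f := fun (z : EuclideanSpace ℝ (Fin n)) (ξ : Sph n) => backKernel (n - 2) ε
      (inner ℝ (ξ : EuclideanSpace ℝ (Fin (n + 1))) (lift z) - dot ξ x))
    ((continuous_backKernel_inner x hε (n - 2)).comp continuous_swap).stronglyMeasurable

theorem tendsto_ofReal_div {A : ℝ} (hA : 0 < A) :
    Tendsto (fun ε : ℝ => ε / A) (𝓝[>] 0) (𝓝[>] 0) := by
  refine tendsto_nhdsWithin_iff.2 ⟨?_, ?_⟩
  · have : Tendsto (fun ε : ℝ => ε / A) (𝓝 0) (𝓝 (0 / A)) := tendsto_id.div_const A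
    rw [zero_div] at this
    exact this.mono_left nhdsWithin_le_nhds
  · filter_upwards [self_mem_nhdsWithin] with ε hε
    exact div_pos hε hA

variable (hθ₀ : 0 < θ) (hθ : θ ≤ Real.pi / 2) (hn : 3 ≤ n) {f : Sph n → ℝ}
  (hf : ContMDiff (𝓡 n) 𝓘(ℝ, ℝ) ∞ f) (hsupp : tsupport f ⊆ cap n θ) {x : Sph n} (hx : x ∈ cap n θ)

include hθ₀ hθ

include hsupp hx in
theorem exists_norm_proj_le : ∃ r, 0 ≤ r ∧ r < Real.sin θ ∧ ‖proj x‖ ≤ r ∧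
    ∀ z ∈ proj '' tsupport f, ‖z‖ ≤ r := by
  -- Inserting `proj x` provides one radius for `x` and the support, and makes the compact set
  -- nonempty.
  obtain ⟨y, hy, hmax⟩ := ((isCompact_proj_tsupport f).insert (proj x)).exists_isMaxOn
    (insert_nonempty _ _) continuous_norm.continuousOn
  refine ⟨‖y‖, norm_nonneg y, ?_, hmax (mem_insert _ _), fun z hz => hmax (mem_insert_of_mem _ hz)⟩
  rcases hy with rfl | ⟨y, hy, rfl⟩
  · exact norm_proj_lt hθ₀ hθ hx
  · exact norm_proj_lt hθ₀ hθ (hsupp hy)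

-- Pointwise, the real part of the Cauchy transform tends to `π`, so all dependence on the heights
-- disappears and the Newton kernel is left. The uniform bound on the strip gives domination by a
-- multiple of `|g(z)| |x' - z|^{2-n}`, which is integrable.
include hn hf hsupp hx in
theorem tendsto_integral_graphDensity_mul_capKernel :
    Tendsto (fun ε => ∫ z, graphDensity f z * capKernel θ x ε z) (𝓝[>] 0)
      (𝓝 (-((-1) ^ ((n - 2) / 2) * (n - 3).factorial * Real.sin θ * sphereArea (n - 1)) *
        newtonPotential (graphDensity f) (proj x))) := by
  have hs := sin_pos_of_le hθ₀ hθ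
  set Q : ℝ := -(1 / Real.pi) * (-1) ^ ((n - 2) / 2) * (n - 2 - 1).factorial *
      (Real.sin θ * sphereArea (n - 1)) with hQ
  have hfin : Module.finrank ℝ (EuclideanSpace ℝ (Fin n)) = n := finrank_euclideanSpace_fin
  have : Nontrivial (EuclideanSpace ℝ (Fin n)) := Module.nontrivial_of_finrank_pos (R := ℝ) (by omega)
  have hg := contDiff_graphDensity hθ₀ hθ hf hsupp
  have hint : Integrable fun z => graphDensity f z * (‖proj x - z‖ ^ (n - 2))⁻¹ := by
    have hl := locallyIntegrable_inv_norm_pow (E := EuclideanSpace ℝ (Fin n)) (k := n - 2) (by omega)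
    exact (hasCompactSupport_graphDensity f).convolutionExists_left (ContinuousLinearMap.mul ℝ ℝ)
      hg.continuous hl (proj x)
  obtain ⟨r, hr0, hrs, hxr, hzr⟩ := exists_norm_proj_le hθ₀ hθ hsupp hx
  obtain ⟨κ, hκ, hκb⟩ := exists_abs_cos_mul_sub_le (n := n) hr0 hrs (cos_nonneg_of_le hθ₀ hθ)
  obtain ⟨B, hB⟩ := exists_norm_gegenbauerCauchy_le (m := n - 2) (by omega) hκ
  have hxN : dot x (north n) = Real.sqrt (1 - ‖proj x‖ ^ 2) := by
    rw [norm_sq_proj, sub_sub_cancel, Real.sqrt_sq (dot_pos_of_mem_cap hθ₀ hθ hx).le]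
  have hne : ∀ᵐ z : EuclideanSpace ℝ (Fin n), z ≠ proj x := Measure.ae_ne volume _
  have him : ∀ z ∈ proj '' tsupport f, z ≠ proj x →
      |Real.cos θ * (Real.sqrt (1 - ‖z‖ ^ 2) - dot x (north n)) / (Real.sin θ * ‖z - proj x‖)| ≤ 1 - κ := by
    intro z hz hzx
    have hA : 0 < Real.sin θ * ‖z - proj x‖ := mul_pos hs (norm_pos_iff.2 (sub_ne_zero.2 hzx))
    rw [abs_div, abs_of_pos hA, div_le_iff₀ hA, hxN]
    exact hκb _ _ hxr (hzr z hz)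
  have hlim : -((-1) ^ ((n - 2) / 2) * (n - 3).factorial * Real.sin θ * sphereArea (n - 1)) *
        newtonPotential (graphDensity f) (proj x) =
      ∫ z, graphDensity f z * (Q * (‖proj x - z‖ ^ (n - 2))⁻¹ * Real.pi) := by
    rw [newtonPotential, hfin, ← integral_const_mul]
    refine integral_congr_ae (Eventually.of_forall fun z => ?_)
    simp only [hQ, show n - 2 - 1 = n - 3 by omega]
    have := Real.pi_pos.ne'
    field_simp
  rw [hlim]
  refine tendsto_integral_filter_of_dominated_convergence
    (fun z => |Q| * |B| * ‖graphDensity f z * (‖proj x - z‖ ^ (n - 2))⁻¹‖) ?_ ?_ (hint.norm.const_mul _) ?_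
  · filter_upwards [self_mem_nhdsWithin] with ε hε
    exact hg.continuous.aestronglyMeasurable.mul (stronglyMeasurable_capKernel θ x hε).aestronglyMeasurable
  · filter_upwards [self_mem_nhdsWithin] with ε hε
    filter_upwards [hne] with z hzx
    -- The strip condition is available only over the support of `f`; elsewhere the density
    -- vanishes.
    by_cases hz : z ∈ proj '' tsupport f
    · have hA : 0 < Real.sin θ * ‖z - proj x‖ := mul_pos hs (norm_pos_iff.2 (sub_ne_zero.2 hzx))
      rw [capKernel_eq hn hs x hε hzx]
      set ζ : ℂ := (ε / (Real.sin θ * ‖z - proj x‖) : ℝ) +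
        (Real.cos θ * (Real.sqrt (1 - ‖z‖ ^ 2) - dot x (north n)) /
          (Real.sin θ * ‖z - proj x‖) : ℝ) * Complex.I with hζ
      have h1 : ζ.re = ε / (Real.sin θ * ‖z - proj x‖) := by
        rw [hζ, Complex.add_re, Complex.re_ofReal_mul, Complex.I_re, mul_zero, add_zero, Complex.ofReal_re]
      have h2 : ζ.im = Real.cos θ * (Real.sqrt (1 - ‖z‖ ^ 2) - dot x (north n)) /
          (Real.sin θ * ‖z - proj x‖) := by
        rw [hζ, Complex.add_im, Complex.im_ofReal_mul, Complex.I_im, mul_one, Complex.ofReal_im, zero_add]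
      have h3 : |(gegenbauerCauchy (n - 2) (n - 2) ζ).re| ≤ |B| :=
        (Complex.abs_re_le_norm _).trans ((hB ζ (by rw [h1]; exact div_pos hε hA)
          (by rw [h2]; exact him z hz hzx)).trans (le_abs_self B))
      rw [norm_mul, norm_mul, norm_mul, norm_mul (graphDensity f z) (‖proj x - z‖ ^ (n - 2))⁻¹,
        Real.norm_eq_abs Q, Real.norm_eq_abs (Complex.re _)]
      calc ‖graphDensity f z‖ * (|Q| * ‖(‖proj x - z‖ ^ (n - 2))⁻¹‖ *
            |(gegenbauerCauchy (n - 2) (n - 2) ζ).re|)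
          ≤ ‖graphDensity f z‖ * (|Q| * ‖(‖proj x - z‖ ^ (n - 2))⁻¹‖ * |B|) := by gcongr
        _ = _ := by ring
    · rw [graphDensity_eq_zero hz]
      simp
  · filter_upwards [hne] with z hzx
    by_cases hz : z ∈ proj '' tsupport f
    · have hA : 0 < Real.sin θ * ‖z - proj x‖ := mul_pos hs (norm_pos_iff.2 (sub_ne_zero.2 hzx))
      refine Tendsto.const_mul _ ?_
      have h1 := (tendsto_gegenbauerCauchy_re (m := n - 2) (by omega)
        (s := Real.cos θ * (Real.sqrt (1 - ‖z‖ ^ 2) - dot x (north n)) / (Real.sin θ * ‖z - proj x‖))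
        ((him z hz hzx).trans_lt (by linarith))).comp (tendsto_ofReal_div hA)
      refine (h1.const_mul (Q * (‖proj x - z‖ ^ (n - 2))⁻¹)).congr' ?_
      filter_upwards [self_mem_nhdsWithin] with ε hε
      rw [capKernel_eq hn hs x hε hzx]
      rfl
    · simp [graphDensity_eq_zero hz]

end Backprojection

/-! ### Identification of the backprojection and inversion -/

section Inversion

open Set Metric Filter Topology

variable {n : ℕ} {θ : ℝ} {f : Sph n → ℝ}

/-- The weighted spherical mean of `f` tested against the regularized kernel. -/
noncomputable def regularizedMean (f : Sph n → ℝ) (x : Sph n) (ε : ℝ) (ξ : Sph n) : ℝ :=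
  ∫ t, weighted (sphericalMean f) ξ t * backKernel (n - 2) ε (t - dot ξ x)

section Regularized

variable (hθ₀ : 0 < θ) (hθ : θ ≤ Real.pi / 2) (hn : 2 ≤ n)
  (hf : ContMDiff (𝓡 n) 𝓘(ℝ, ℝ) ∞ f) (hsupp : tsupport f ⊆ cap n θ) (x : Sph n) {ε : ℝ} (hε : 0 < ε)

include hθ₀ hθ hn hf hsupp hε

theorem regularizedMean_eq (ξ : Sph n) :
    regularizedMean f x ε ξ = (sphereArea n)⁻¹ * ∫ z, graphDensity f z * backKernel (n - 2) ε
      (inner ℝ (ξ : EuclideanSpace ℝ (Fin (n + 1))) (lift z) - dot ξ x) :=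
  integral_weighted_mul_eq_graph hθ₀ hθ hn hf.continuous hsupp ξ
    (φ := fun t => backKernel (n - 2) ε (t - dot ξ x)) ((continuous_backKernel _ hε).comp (by fun_prop))

omit hn in
theorem continuous_graphDensity_mul_backKernel :
    Continuous fun p : Sph n × EuclideanSpace ℝ (Fin n) => graphDensity f p.2 * backKernel (n - 2) ε
      (inner ℝ (p.1 : EuclideanSpace ℝ (Fin (n + 1))) (lift p.2) - dot p.1 x) := by
  exact ((contDiff_graphDensity hθ₀ hθ hf hsupp).continuous.comp continuous_snd).mul
    (continuous_backKernel_inner x hε _)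

theorem stronglyMeasurable_regularizedMean : StronglyMeasurable (regularizedMean f x ε) := by
  rw [funext (regularizedMean_eq hθ₀ hθ hn hf hsupp x hε)]
  exact (StronglyMeasurable.integral_prod_right
    (f := fun (ξ : Sph n) (z : EuclideanSpace ℝ (Fin n)) => graphDensity f z * backKernel (n - 2) ε
      (inner ℝ (ξ : EuclideanSpace ℝ (Fin (n + 1))) (lift z) - dot ξ x))
    (continuous_graphDensity_mul_backKernel hθ₀ hθ hf hsupp x hε).stronglyMeasurable).const_mul _

/-- Fubini is harmless while `ε > 0`, the integrand being continuous with compact support in both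
variables. -/
theorem integral_regularizedMean :
    ∫ ξ, regularizedMean f x ε ξ ∂(capBoundaryMeasure n θ) =
      (sphereArea n)⁻¹ * ∫ z, graphDensity f z * capKernel θ x ε z := by
  have := isFiniteMeasure_capBoundaryMeasure n θ
  simp only [regularizedMean_eq hθ₀ hθ hn hf hsupp x hε]
  rw [integral_const_mul, integral_integral_swap_of_hasCompactSupport
    (continuous_graphDensity_mul_backKernel hθ₀ hθ hf hsupp x hε)]
  · congr 1
    exact integral_congr_ae (Eventually.of_forall fun z => integral_const_mul _ _)
  · refine HasCompactSupport.intro (isCompact_univ.prod (hasCompactSupport_graphDensity f)) fun p hp => ?_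
    have h1 : p.2 ∉ tsupport (graphDensity f) := fun h => hp ⟨mem_univ _, h⟩
    change graphDensity f p.2 * _ = 0
    rw [image_eq_zero_of_notMem_tsupport h1, zero_mul]

end Regularized

variable (hθ₀ : 0 < θ) (hθ : θ ≤ Real.pi / 2) (hn : 3 ≤ n)
  (hf : ContMDiff (𝓡 n) 𝓘(ℝ, ℝ) ∞ f) (hsupp : tsupport f ⊆ cap n θ) {x : Sph n} (hx : x ∈ cap n θ)

include hθ₀ hθ hn hf hsupp

theorem exists_abs_regularizedMean_le (x : Sph n) :
    ∃ C, ∀ ξ ∈ capBoundary n θ, ∀ ε, 0 < ε → ε ≤ 1 → |regularizedMean f x ε ξ| ≤ C := by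
  obtain ⟨c, d, hc, hcd, hd, hw⟩ := exists_weighted_eq_zero hθ₀ hθ (by omega) hf.continuous hsupp
  obtain ⟨C, hC⟩ := exists_abs_iteratedDeriv_weighted_le_univ hθ₀ hθ (by omega) hf hc hd hw (n - 2)
  exact ⟨_, fun ξ hξ ε hε hε1 => abs_integral_mul_backKernel_le
    (contDiff_weighted hθ₀ hθ (by omega) hf hξ hc hd (hw ξ hξ)) (neg_one_le_of_cos_two_mul_lt hc).le hd.le
    (hw ξ hξ) (dot_mem_Icc ξ x) (by omega) (hC ξ hξ) hε hε1⟩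

-- Stated for an arbitrary pointwise limit `V`, so that both parities are covered at once. The bound
-- uniform in `ξ` and `ε` gives integrability of `V` and dominated convergence over the cap
-- boundary; the limit is then computed in the other order of integration.
include hx in
theorem integrable_and_integral_eq_of_tendsto {V : Sph n → ℝ}
    (hV : ∀ ξ ∈ capBoundary n θ, Tendsto (fun ε => regularizedMean f x ε ξ) (𝓝[>] 0) (𝓝 (V ξ))) :
    Integrable V (capBoundaryMeasure n θ) ∧ ∫ ξ, V ξ ∂(capBoundaryMeasure n θ) =
      (sphereArea n)⁻¹ * (-((-1) ^ ((n - 2) / 2) * (n - 3).factorial * Real.sin θ * sphereArea (n - 1)) *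
        newtonPotential (graphDensity f) (proj x)) := by
  have := isFiniteMeasure_capBoundaryMeasure n θ
  have hae := ae_mem_capBoundary n θ
  obtain ⟨C, hC⟩ := exists_abs_regularizedMean_le hθ₀ hθ hn hf hsupp x
  have hlt : ∀ᶠ ε : ℝ in 𝓝[>] 0, 0 < ε ∧ ε ≤ 1 := Ioc_mem_nhdsGT (zero_lt_one' ℝ)
  -- Measurability of `V` in `ξ` is obtained from a sequence of measurable functions converging to
  -- it, hence the discrete choice of `ε`.
  have hseq : Tendsto (fun k : ℕ => 1 / ((k : ℝ) + 1)) atTop (𝓝[>] 0) :=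
    tendsto_nhdsWithin_iff.2 ⟨tendsto_one_div_add_atTop_nhds_zero_nat,
      Eventually.of_forall fun k => (by positivity : (0 : ℝ) < 1 / ((k : ℝ) + 1))⟩
  have hmeas : AEStronglyMeasurable V (capBoundaryMeasure n θ) := by
    refine aestronglyMeasurable_of_tendsto_ae atTop
      (f := fun (k : ℕ) ξ => regularizedMean f x (1 / ((k : ℝ) + 1)) ξ) (fun k => ?_) ?_
    · exact (stronglyMeasurable_regularizedMean hθ₀ hθ (by omega) hf hsupp x
        (by positivity)).aestronglyMeasurable
    · filter_upwards [hae] with ξ hξ using (hV ξ hξ).comp hseq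
  refine ⟨Integrable.of_bound hmeas C ?_, ?_⟩
  · filter_upwards [hae] with ξ hξ
    refine le_of_tendsto (hV ξ hξ).norm ?_
    filter_upwards [hlt] with ε hε using hC ξ hξ ε hε.1 hε.2
  · have h1 : Tendsto (fun ε => ∫ ξ, regularizedMean f x ε ξ ∂(capBoundaryMeasure n θ)) (𝓝[>] 0)
        (𝓝 (∫ ξ, V ξ ∂(capBoundaryMeasure n θ))) := by
      refine tendsto_integral_filter_of_dominated_convergence (fun _ => C) ?_ ?_ (integrable_const C) ?_
      · filter_upwards [self_mem_nhdsWithin] with ε hε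
        exact (stronglyMeasurable_regularizedMean hθ₀ hθ (by omega) hf hsupp x hε).aestronglyMeasurable
      · filter_upwards [hlt] with ε hε
        filter_upwards [hae] with ξ hξ using hC ξ hξ ε hε.1 hε.2
      · filter_upwards [hae] with ξ hξ using hV ξ hξ
    refine tendsto_nhds_unique h1 ?_
    refine ((tendsto_integral_graphDensity_mul_capKernel hθ₀ hθ hn hf hsupp hx).const_mul
      (sphereArea n)⁻¹).congr' ?_
    filter_upwards [self_mem_nhdsWithin] with ε hε
    exact (integral_regularizedMean hθ₀ hθ (by omega) hf hsupp x hε).symm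

theorem tendsto_regularizedMean_of_odd (hodd : Odd n) (x : Sph n) {ξ : Sph n} (hξ : ξ ∈ capBoundary n θ) :
    Tendsto (fun ε => regularizedMean f x ε ξ) (𝓝[>] 0) (𝓝 (-oddIntegrand (sphericalMean f) x ξ)) := by
  obtain ⟨c, d, hc, hcd, hd, hw⟩ := exists_weighted_eq_zero hθ₀ hθ (by omega) hf.continuous hsupp
  exact tendsto_integral_mul_backKernel_of_odd (contDiff_weighted hθ₀ hθ (by omega) hf hξ hc hd (hw ξ hξ))
    hcd (neg_one_le_of_cos_two_mul_lt hc).le hd.le (hw ξ hξ) (dot_mem_Icc ξ x)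
    (by obtain ⟨k, hk⟩ := hodd; exact ⟨k - 1, by omega⟩)

theorem tendsto_regularizedMean_of_even (heven : Even n) (x : Sph n) {ξ : Sph n}
    (hξ : ξ ∈ capBoundary n θ) :
    Tendsto (fun ε => regularizedMean f x ε ξ) (𝓝[>] 0)
      (𝓝 (1 / Real.pi * evenIntegrand θ (sphericalMean f) x ξ)) := by
  obtain ⟨c, d, hc, hcd, hd, hw⟩ := exists_weighted_eq_zero hθ₀ hθ (by omega) hf.continuous hsupp
  exact tendsto_integral_mul_backKernel_of_even (contDiff_weighted hθ₀ hθ (by omega) hf hξ hc hd (hw ξ hξ))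
    hcd (neg_one_le_of_cos_two_mul_lt hc).le hd.le (hw ξ hξ) (dot_mem_Icc ξ x)
    (heven.tsub even_two) (by omega) hc

omit hθ₀ hθ hn hf hsupp in
theorem integrable_of_integrable_neg {V : Sph n → ℝ} {μ : Measure (Sph n)}
    (h : Integrable (fun ξ => -V ξ) μ) : Integrable V μ := by
  simpa using h.neg

include hx in
theorem integrable_oddIntegrand (hodd : Odd n) :
    Integrable (oddIntegrand (sphericalMean f) x) (capBoundaryMeasure n θ) :=
  integrable_of_integrable_neg (integrable_and_integral_eq_of_tendsto hθ₀ hθ hn hf hsupp hx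
    fun _ hξ => tendsto_regularizedMean_of_odd hθ₀ hθ hn hf hsupp hodd x hξ).1

include hx in
theorem integrable_evenIntegrand (heven : Even n) :
    Integrable (evenIntegrand θ (sphericalMean f) x) (capBoundaryMeasure n θ) := by
  have h := (integrable_and_integral_eq_of_tendsto hθ₀ hθ hn hf hsupp hx
    fun _ hξ => tendsto_regularizedMean_of_even hθ₀ hθ hn hf hsupp heven x hξ).1.const_mul Real.pi
  refine h.congr (Eventually.of_forall fun ξ => ?_)
  have := Real.pi_pos.ne'
  simp only
  field_simp

theorem intervalIntegrable_logIntegrand (x : EuclideanSpace ℝ (Fin (n + 1))) {ξ : Sph n}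
    (hξ : ξ ∈ capBoundary n θ) :
    IntervalIntegrable (logIntegrand (sphericalMean f) x ξ) volume (Real.cos (2 * θ)) 1 := by
  obtain ⟨c, d, hc, hcd, hd, hw⟩ := exists_weighted_eq_zero hθ₀ hθ (by omega) hf.continuous hsupp
  have hs := contDiff_weighted hθ₀ hθ (by omega) hf hξ hc hd (hw ξ hξ)
  set τ := inner ℝ (ξ : EuclideanSpace ℝ (Fin (n + 1))) x
  have h : IntervalIntegrable Real.log volume (Real.cos (2 * θ) - τ) (1 - τ) :=
    intervalIntegral.intervalIntegrable_log'
  have h2 := h.comp_sub_right τ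
  rw [sub_add_cancel, sub_add_cancel] at h2
  have h3 := h2.continuousOn_mul (continuous_iteratedDeriv hs (n - 2)).continuousOn
  refine h3.congr fun t _ => ?_
  rw [logIntegrand, Real.log_abs]

include hx in
theorem backprojection_eq :
    backprojection θ (sphericalMean f) x =
      -((-1) ^ ((n - 2) / 2) * (n - 3).factorial * Real.sin θ * sphereArea (n - 1)) / sphereArea n *
        newtonPotential (graphDensity f) (proj x) := by
  have hcomm : ∀ a b c : ℝ, a⁻¹ * (b * c) = b / a * c := fun a b c => by ring
  rw [backprojection]
  rcases Nat.even_or_odd n with hp | hp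
  · rw [if_neg (Nat.not_odd_iff_even.2 hp), ← integral_const_mul, ← hcomm]
    exact (integrable_and_integral_eq_of_tendsto hθ₀ hθ hn hf hsupp hx
      fun _ hξ => tendsto_regularizedMean_of_even hθ₀ hθ hn hf hsupp hp x hξ).2
  · rw [if_pos hp, ← integral_neg, ← hcomm]
    exact (integrable_and_integral_eq_of_tendsto hθ₀ hθ hn hf hsupp hx
      fun _ hξ => tendsto_regularizedMean_of_odd hθ₀ hθ hn hf hsupp hp x hξ).2

theorem backprojection_lift_eq : EqOn (fun z => backprojection θ (sphericalMean f) (lift z))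
    (fun z => (-((-1) ^ ((n - 2) / 2) * (n - 3).factorial * Real.sin θ * sphereArea (n - 1)) /
      sphereArea n) • newtonPotential (graphDensity f) z) (ball 0 (Real.sin θ)) := by
  intro z hz
  have hz' : ‖z‖ < Real.sin θ := mem_ball_zero_iff.1 hz
  have h := backprojection_eq hθ₀ hθ hn hf hsupp (liftSph_mem_cap (n := n) hz')
  rw [proj_liftSph] at h
  exact h

theorem contDiffOn_backprojection_lift :
    ContDiffOn ℝ ∞ (fun z => backprojection θ (sphericalMean f) (lift z)) (ball 0 (Real.sin θ)) := by
  refine ContDiffOn.congr ?_ (backprojection_lift_eq hθ₀ hθ hn hf hsupp)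
  exact ((contDiff_newtonPotential (by simpa using hn)
    (contDiff_graphDensity hθ₀ hθ hf hsupp) (hasCompactSupport_graphDensity f)).const_smul _).contDiffOn

-- Poisson's equation contributes `-(n - 2) σ_{n-1}` times the density. Here `σ_{n-1}` cancels the
-- normalization of the mean, and `(n - 2) (n - 3)!` combines to `(n - 2)!`.
include hx in
theorem laplacian_backprojection_lift :
    Laplacian.laplacian (fun z => backprojection θ (sphericalMean f) (lift z)) (proj x) =
      (-1) ^ ((n - 2) / 2) * ((n - 2).factorial * sphereArea (n - 1)) * Real.sin θ *
        ((dot x (north n))⁻¹ * f x) := by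
  have hfin : Module.finrank ℝ (EuclideanSpace ℝ (Fin n)) = n := finrank_euclideanSpace_fin
  have hg := contDiff_graphDensity hθ₀ hθ hf hsupp
  have hgc := hasCompactSupport_graphDensity f
  have hN := contDiff_newtonPotential (by omega) hg hgc
  have hnhds : ball (0 : EuclideanSpace ℝ (Fin n)) (Real.sin θ) ∈ 𝓝 (proj x) :=
    isOpen_ball.mem_nhds (mem_ball_zero_iff.2 (norm_proj_lt hθ₀ hθ hx))
  rw [(InnerProductSpace.laplacian_congr_nhds
    ((backprojection_lift_eq hθ₀ hθ hn hf hsupp).eventuallyEq_of_mem hnhds)).eq_of_nhds]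
  have hsm := InnerProductSpace.laplacian_smul
    (-((-1) ^ ((n - 2) / 2) * (n - 3).factorial * Real.sin θ * sphereArea (n - 1)) / sphereArea n)
    ((contDiff_infty.1 hN 2).contDiffAt (x := proj x))
  have hL := laplacian_newtonPotential (by omega) hg hgc (proj x)
  rw [hfin, toSphere_real_univ (by omega) hfin,
    graphDensity_proj (dot_pos_of_mem_cap hθ₀ hθ hx).le] at hL
  have hsA := (sphereArea_pos (n := n) (by omega)).ne'
  have hfac : ((n - 2).factorial : ℝ) = ((n : ℝ) - 2) * (n - 3).factorial := by
    obtain ⟨k, rfl⟩ : ∃ k, n = k + 3 := ⟨n - 3, by omega⟩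
    rw [show k + 3 - 2 = k + 1 by omega, Nat.factorial_succ, Nat.add_sub_cancel]
    push_cast
    ring
  refine hsm.trans ?_
  rw [hL, hfac, smul_eq_mul]
  field_simp

end Inversion

theorem theorem5p3 (n : ℕ) (hn : 3 ≤ n) (θ : ℝ) (hθ₀ : 0 < θ) (hθ : θ ≤ Real.pi / 2)
    (f : Sph n → ℝ) (hf : ContMDiff (𝓡 n) 𝓘(ℝ, ℝ) ∞ f) (hsupp : tsupport f ⊆ cap n θ) :
    -- the derivatives and integrals that define `f₀` on the cap exist in the ordinary sense
    (∀ ξ ∈ capBoundary n θ,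
      ContDiffOn ℝ ∞ (weighted (sphericalMean f) ξ) (Set.Ioo (-1) 1)) ∧
    (Odd n → ∀ x ∈ cap n θ,
      Integrable (oddIntegrand (sphericalMean f) x) (capBoundaryMeasure n θ)) ∧
    (Even n → ∀ x ∈ cap n θ,
      (∀ ξ ∈ capBoundary n θ,
        IntervalIntegrable (logIntegrand (sphericalMean f) x ξ) volume (Real.cos (2 * θ)) 1) ∧
      Integrable (evenIntegrand θ (sphericalMean f) x) (capBoundaryMeasure n θ)) ∧
    -- `f₀(x', √(1 - |x'|²))` is smooth on the projection of the cap
    ContDiffOn ℝ ∞ (fun z : EuclideanSpace ℝ (Fin n) =>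
      backprojection θ (sphericalMean f) (lift z)) (Metric.ball 0 (Real.sin θ)) ∧
    -- the inversion formula
    (∀ x ∈ cap n θ,
      f x = inversionConst n * (x : EuclideanSpace ℝ (Fin (n + 1))) (Fin.last n) / Real.sin θ *
        Laplacian.laplacian (fun z : EuclideanSpace ℝ (Fin n) =>
          backprojection θ (sphericalMean f) (lift z)) (proj x)) := by
  refine ⟨fun ξ hξ => contDiffOn_weighted hθ₀ hθ (by omega) hf hξ,
    fun hodd x hx => integrable_oddIntegrand hθ₀ hθ hn hf hsupp hx hodd,
    fun heven x hx => ⟨fun ξ hξ => intervalIntegrable_logIntegrand hθ₀ hθ hn hf hsupp x hξ,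
      integrable_evenIntegrand hθ₀ hθ hn hf hsupp hx heven⟩,
    contDiffOn_backprojection_lift hθ₀ hθ hn hf hsupp, fun x hx => ?_⟩
  rw [laplacian_backprojection_lift hθ₀ hθ hn hf hsupp hx, ← dot_north]
  have h1 := inversionConst_mul hn
  have h2 := (dot_pos_of_mem_cap hθ₀ hθ hx).ne'
  have h3 := (sin_pos_of_le hθ₀ hθ).ne'
  field_simp
  linear_combination -f x * h1
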